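/- **Setting.** Let $\mathcal S=\mathbb R^{d_S}$, $\mathcal V=\mathbb R^{d_V}$, $d=d_S+d_V$, $z=(s,v)\in\mathcal S\times\mathcal V$, $x\in\mathbb R^{d}$, $y\in\mathbb R^{d_Y}$. A CSG (causal semantic generative model) $p=\langle p(s,v),p(x|s,v),p(y|s)\rangle$ consists of a prior and two mechanisms; its data distribution is $p(x,y)=\int p(s,v)\,p(x|s,v)\,p(y|s)\,ds\,dv$. Two CSGs $p,p'$ are *semantic-equivalent* if there is a homeomorphism $\Phi=(\Phi^{\mathcal S},\Phi^{\mathcal V})$ of $\mathcal S\times\mathcal V$ such that $\Phi^{\mathcal S}(s,v)$ does not depend on $v$, $\Phi_\#[p_{s,v}]=p'_{s,v}$, $p(x|s,v)=p'(x|\Phi(s,v))$ and $p(y|s)=p'(y|\Phi^{\mathcal S}(s,v))$ for all $(s,v)$. We consider CSGs of the form $x=f(s,v)+\mu$ and either $y=g(s)+\nu$ or $y\sim\mathrm{Cat}(g(s))$ (one-hot vectors, $g(s)$ in the probability simplex), with $(s,v),\mu,\nu$ independent, $f:\mathcal S\times\mathcal V\to\mathbb R^d$ a bijection, $f$ thrice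 and $f^{-1},g$ twice differentiable, $g$ injective, and a positive prior density whose logarithm is twice differentiable. There are constants such that $p(s,v)\le B_p$; the 2-norms of the Jacobian of $f^{-1}$, of the Hessians of the components $f_c$, of the gradients and Hessians of the components $g_l$, and of the gradient and Hessian of $\log p(s,v)$ are at most $B'_{f^{-1}},B''_f,B'_g,B''_g,B'_{\log p},B''_{\log p}$; and all third-order partial derivatives of the $f_c$ are at most $B'''_f$ in absolute value. The objects of a second CSG $p'$, subject to the same constants and with the same kind of output, carry a prime. Put $\Phi=f'^{-1}\circ f$, a homeomorphism, and $\sigma_\mu^2=\mathbb E\|\mu\|^2$. Let $q=f_\#[p_{s,v}]$ be the density of $f(s,v)$. **Theorem.** Suppose that $p(x,y)=p'(x,y)$. (i) If $\mu$ and $\mu'$ have the same law and its characteristic function is a.e. non-zero, then $p$ and $p'$ are semantic-equivalent through $\Phi$. (ii) Fix the parameters $f,g,p_{s,v}$ (and the law of $\nu$) of $p$, and let noises $\mu_n$, CSGs $p'_n$ (all with the same constants) and their noises $\mu'_n$ be such that $p_n(x,y)=p'_n(x,y)$ for all $n$, where $p_n$ is $p$ with noise $\mu_n$, and $\mathbb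 E\|\mu_n\|^2\to0$, $\mathbb E\|\mu'_n\|^2\to0$. Then the equalities of semantic-equivalence through $\Phi_n=f_n'^{-1}\circ f$ hold asymptotically: $\|\Phi_n^{\mathcal S}(s,v_1)-\Phi_n^{\mathcal S}(s,v_2)\|\to0$ uniformly for $(s,v_1),(s,v_2)$ in a compact set; $\Phi_{n\#}[p_{s,v}]-p'_{n;s,v}\to0$ in total variation, and the densities satisfy $\sup_z|\Phi_{n\#}[p_{s,v}](z)-p'_n(z)|/|\det Df'_n(z)|\to0$; $p_n(x|z)$ equals $p'_n(x|\Phi_n(z))$ if $\mu_n,\mu_n'$ have the same law, and in general the difference of their integrals of any bounded continuous function tends to $0$ locally uniformly in $z$; and for every bounded continuous $h$, $\int h(y)\,p'_n(dy|\Phi^{\mathcal S}_n(s,v))\to\int h(y)\,p(dy|s)$ locally uniformly in $(s,v)$. (iii) Let $\sigma^2\ge\sigma_\mu^2,\sigma_{\mu'}^2$ and suppose that $\mathbb E\mu=\mathbb E\mu'$ and, for continuous $y$, $\mathbb E\nu=\mathbb E\nu'$ (finite). Let $\varepsilon$ be such that $\sigma^2\,T\le\varepsilon$ with $$T=B'^2_{f^{-1}}\max\Big\{B'_{\log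 p}B'_g+\tfrac12B''_g+\tfrac32dB'_{f^{-1}}B''_fB'_g,\;B_pB'^d_{f^{-1}}\big(B'^2_{\log p}+B''_{\log p}+3dB'_{f^{-1}}B''_fB'_{\log p}+3d^{3/2}B'^2_{f^{-1}}B''^2_f+d^3B'''_fB'_{f^{-1}}\big)\Big\}.$$ Then semantic-equivalence through $\Phi$ holds up to errors of order $\varepsilon$. For all $z=(s,v)$ and all $l$: $p(x|z)=p'(x|\Phi(z))$ if $\mu,\mu'$ have the same law, and in general $|\int h(x)\,p(dx|z)-\int h(x)\,p'(dx|\Phi(z))|\le2K\sigma$ for all $K$-Lipschitz $h$; $|\Phi_\#[p_{s,v}](z)-p'_{s,v}(z)|\le\sqrt d\,\varepsilon\,|\det Df'(z)|$; $\mathbb E_{p(s,v)}|g_l(s)-g'_l(\Phi^{\mathcal S}(s,v))|\le4\varepsilon$; with $Q=B_pB'^d_{f^{-1}}$ (an upper bound of $q$) and $C=2\varepsilon\exp(\sqrt d\,\varepsilon/(2Q))$, $|g_l(s)-g'_l(\Phi^{\mathcal S}(s,v))|\le C\,Q/q(f(s,v))$; and for all $v_1,v_2$, $|g'_l(\Phi^{\mathcal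 S}(s,v_1))-g'_l(\Phi^{\mathcal S}(s,v_2))|\le C\,Q/q(f(s,v_1))+C\,Q/q(f(s,v_2))$. -/

import Mathlib

open MeasureTheory Filter Topology

noncomputable section

namespace CausalSemantic

/-- The latent space `𝒮 × 𝒱 = ℝ^dS × ℝ^dV` with its Euclidean norm, a point being
`z = (s, v)`. -/
abbrev Latent (dS dV : ℕ) : Type := EuclideanSpace ℝ (Fin dS ⊕ Fin dV)

/-- The space of `x`: a Euclidean space of dimension `dS + dV`, the only dimension possible when
`f` is a bijection that is differentiable in both directions. Its coordinates carry the same labels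
as those of the latent space, so that Jacobian determinants make sense. -/
abbrev Obs (dS dV : ℕ) : Type := EuclideanSpace ℝ (Fin dS ⊕ Fin dV)

/-- The space of the semantic factor `s`. -/
abbrev Sem (dS : ℕ) : Type := EuclideanSpace ℝ (Fin dS)

/-- The space of the output `y`; a categorical `y` is represented by one-hot vectors. -/
abbrev Out (dY : ℕ) : Type := EuclideanSpace ℝ (Fin dY)

/-- The component `s` of `z = (s, v)`. -/
def sem {dS dV : ℕ} (z : Latent dS dV) : Sem dS := WithLp.toLp 2 (fun i => z (Sum.inl i))

/-- A causal semantic generative model: a prior `p(s, v)` and mechanisms `p(x | s, v)`,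
`p(y | s)`. -/
structure CSG (dS dV dY : ℕ) where
  /-- the law of `(s, v)` -/
  prior : Measure (Latent dS dV)
  /-- the law of `x` given `(s, v)` -/
  mechX : Latent dS dV → Measure (Obs dS dV)
  /-- the law of `y` given `s` -/
  mechY : Sem dS → Measure (Out dY)

/-- The law `p(x, y) = ∫ p(s, v) p(x | s, v) p(y | s) ds dv` of the data. -/
def CSG.dataLaw {dS dV dY : ℕ} (C : CSG dS dV dY) : Measure (Obs dS dV × Out dY) :=
  C.prior.bind (fun z => (C.mechX z).prod (C.mechY (sem z)))

/-- `Φ` is a semantic-preserving reparameterization from `C` to `C'`. -/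
structure IsSemanticReparam {dS dV dY : ℕ} (C C' : CSG dS dV dY)
    (Φ : Latent dS dV ≃ₜ Latent dS dV) : Prop where
  sem_const : ∀ z₁ z₂, sem z₁ = sem z₂ → sem (Φ z₁) = sem (Φ z₂)
  prior_map : C.prior.map Φ = C'.prior
  mechX_eq : ∀ z, C.mechX z = C'.mechX (Φ z)
  mechY_eq : ∀ z, C.mechY (sem z) = C'.mechY (sem (Φ z))

/-- Semantic-equivalence of two models. -/
def SemanticEquivalent {dS dV dY : ℕ} (C C' : CSG dS dV dY) : Prop :=
  ∃ Φ : Latent dS dV ≃ₜ Latent dS dV, IsSemanticReparam C C' Φ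

/-- The two kinds of output mechanism: `y = g(s) + ν` with `ν` of the given law, or
`y ∼ Cat(g(s))`. -/
inductive OutputKind (dY : ℕ) where
  | additive (ν : Measure (Out dY)) : OutputKind dY
  | categorical : OutputKind dY

/-- The law of `y` when `g(s) = a`. -/
def OutputKind.law {dY : ℕ} : OutputKind dY → Out dY → Measure (Out dY)
  | additive ν, a => ν.map (fun w => a + w)
  | categorical, a => ∑ k, ENNReal.ofReal (a k) • Measure.dirac (EuclideanSpace.single k (1 : ℝ))

/-- What makes `OutputKind.law` a probability law: the law of `ν` is a probability measure,
respectively `g(s)` is a probability vector. -/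
def OutputKind.Valid {dS dY : ℕ} (o : OutputKind dY) (g : Sem dS → Out dY) : Prop :=
  match o with
  | additive ν => IsProbabilityMeasure ν
  | categorical => ∀ s, (fun k => g s k) ∈ stdSimplex ℝ (Fin dY)

/-- Both outputs are continuous or both are categorical. -/
def OutputKind.SameKind {dY : ℕ} : OutputKind dY → OutputKind dY → Prop
  | additive _, additive _ => True
  | categorical, categorical => True
  | _, _ => False

/-- Same kind and, for additive output noises, the same finite mean. -/
def OutputKind.SameMean {dY : ℕ} : OutputKind dY → OutputKind dY → Prop
  | additive ν, additive ν' => Integrable (fun w => w) ν ∧ Integrable (fun w => w) ν' ∧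
      ∫ w, w ∂ν = ∫ w, w ∂ν'
  | categorical, categorical => True
  | _, _ => False

/-- The parameters of an additive-noise model, except for the law of the noise `μ` of `x`. -/
structure Model (dS dV dY : ℕ) where
  /-- the function of `x = f(s, v) + μ`, a bijection (continuous in both directions) -/
  f : Latent dS dV ≃ₜ Obs dS dV
  /-- the function of `y = g(s) + ν` or `y ∼ Cat(g(s))` -/
  g : Sem dS → Out dY
  /-- the density of the prior `p(s, v)` -/
  dens : Latent dS dV → ℝ
  /-- the kind of output -/
  out : OutputKind dY

variable {dS dV dY : ℕ}

/-- The prior as a measure. -/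
def Model.prior (M : Model dS dV dY) : Measure (Latent dS dV) :=
  volume.withDensity (fun z => ENNReal.ofReal (M.dens z))

/-- The CSG given by the parameters `M` and the law `μ` of the noise of `x`. -/
def Model.toCSG (M : Model dS dV dY) (μ : Measure (Obs dS dV)) : CSG dS dV dY where
  prior := M.prior
  mechX := fun z => μ.map (fun u => M.f z + u)
  mechY := fun s => M.out.law (M.g s)

/-- Constants for the bounds on a model: `p` for the prior density, `finv1` for the Jacobian of
`f⁻¹`, `f2` for the Hessians and `f3` for the third-order derivatives of the components of `f`,
`g1`, `g2` for the gradients and Hessians of the components of `g`, `lp1`, `lp2` for the gradient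
and the Hessian of the log-density of the prior. -/
structure Bounds where
  p : ℝ
  finv1 : ℝ
  f2 : ℝ
  f3 : ℝ
  g1 : ℝ
  g2 : ℝ
  lp1 : ℝ
  lp2 : ℝ

/-- `B` bounds the model `M`: Jacobians, gradients and Hessians in the induced 2-norm, third-order
partial derivatives one by one. -/
structure Model.BoundedBy (M : Model dS dV dY) (B : Bounds) : Prop where
  p : ∀ z, M.dens z ≤ B.p
  finv1 : ∀ x, ‖fderiv ℝ M.f.symm x‖ ≤ B.finv1
  f2 : ∀ z c, ‖fderiv ℝ (fderiv ℝ (fun w => M.f w c)) z‖ ≤ B.f2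
  f3 : ∀ z c i j k, |fderiv ℝ (fderiv ℝ (fderiv ℝ (fun w => M.f w c))) z
    (EuclideanSpace.single i 1) (EuclideanSpace.single j 1) (EuclideanSpace.single k 1)| ≤ B.f3
  g1 : ∀ s l, ‖fderiv ℝ (fun t => M.g t l) s‖ ≤ B.g1
  g2 : ∀ s l, ‖fderiv ℝ (fderiv ℝ (fun t => M.g t l)) s‖ ≤ B.g2
  lp1 : ∀ z, ‖fderiv ℝ (fun w => Real.log (M.dens w)) z‖ ≤ B.lp1
  lp2 : ∀ z, ‖fderiv ℝ (fderiv ℝ (fun w => Real.log (M.dens w))) z‖ ≤ B.lp2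

/-- The standing assumptions on a model: `f` is thrice and `f⁻¹`, `g` are twice differentiable,
`g` is injective, the prior has a positive density with twice differentiable logarithm. -/
structure Model.Admissible (M : Model dS dV dY) : Prop where
  f_diff : Differentiable ℝ M.f
  f_diff2 : Differentiable ℝ (fderiv ℝ M.f)
  f_diff3 : Differentiable ℝ (fderiv ℝ (fderiv ℝ M.f))
  finv_diff : Differentiable ℝ M.f.symm
  finv_diff2 : Differentiable ℝ (fderiv ℝ M.f.symm)
  g_diff : Differentiable ℝ M.g
  g_diff2 : Differentiable ℝ (fderiv ℝ M.g)
  g_inj : Function.Injective M.g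
  out_valid : M.out.Valid M.g
  dens_pos : ∀ z, 0 < M.dens z
  prior_prob : IsProbabilityMeasure M.prior
  logdens_diff : Differentiable ℝ (fun z => Real.log (M.dens z))
  logdens_diff2 : Differentiable ℝ (fderiv ℝ (fun z => Real.log (M.dens z)))

/-- The reparameterization `Φ = f'⁻¹ ∘ f`. -/
def reparam (M M' : Model dS dV dY) : Latent dS dV ≃ₜ Latent dS dV := M.f.trans M'.f.symm

/-- The density `(Φ_# q)(z) = q(Φ⁻¹ z) |det D(Φ⁻¹)(z)|` of the push-forward by `Φ` of the law with
density `q`. -/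
def pushDensity (Φ : EuclideanSpace ℝ (Fin dS ⊕ Fin dV) ≃ₜ EuclideanSpace ℝ (Fin dS ⊕ Fin dV))
    (q : EuclideanSpace ℝ (Fin dS ⊕ Fin dV) → ℝ) (z : EuclideanSpace ℝ (Fin dS ⊕ Fin dV)) : ℝ :=
  q (Φ.symm z) * |(fderiv ℝ Φ.symm z).det|

/-- The intensity threshold, with `d = dS + dV`: `1 / σ²` is to be large compared to it. -/
def Bounds.threshold (B : Bounds) (dS dV : ℕ) : ℝ :=
  let d : ℝ := (dS : ℝ) + (dV : ℝ)
  B.finv1 ^ 2 * max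
    (B.lp1 * B.g1 + 1 / 2 * B.g2 + 3 / 2 * d * B.finv1 * B.f2 * B.g1)
    (B.p * B.finv1 ^ (dS + dV) * (B.lp1 ^ 2 + B.lp2 + 3 * d * B.finv1 * B.f2 * B.lp1
      + 3 * d ^ (3 / 2 : ℝ) * B.finv1 ^ 2 * B.f2 ^ 2 + d ^ 3 * B.f3 * B.finv1))

/-- The semantic-equivalence through the homeomorphisms `Φₙ = f'ₙ⁻¹ ∘ f` of the models
`(M, μ n)` and `(M' n, μ' n)` holds asymptotically, as `n → ∞`. -/
structure AsympSemanticEquivalent (M : Model dS dV dY) (μ : ℕ → Measure (Obs dS dV))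
    (M' : ℕ → Model dS dV dY) (μ' : ℕ → Measure (Obs dS dV)) : Prop where
  /-- the `𝒮`-component of `Φₙ(s, v)` becomes constant in `v`, uniformly on compact sets -/
  sem_const : ∀ K : Set (Latent dS dV), IsCompact K → ∀ ε > 0, ∀ᶠ n in atTop,
    ∀ z₁ ∈ K, ∀ z₂ ∈ K, sem z₁ = sem z₂ →
      dist (sem (reparam M (M' n) z₁)) (sem (reparam M (M' n) z₂)) ≤ ε
  /-- the push-forward of the prior converges to the other prior in total variation -/
  prior_tv : ∀ ε > 0, ∀ᶠ n in atTop, ∀ A : Set (Latent dS dV), MeasurableSet A →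
    |(M.prior.map (reparam M (M' n))).real A - (M' n).prior.real A| ≤ ε
  /-- and so does its density, uniformly with respect to the volume in the space of `x` -/
  prior_dens : ∀ ε > 0, ∀ᶠ n in atTop, ∀ z : Latent dS dV,
    |pushDensity (reparam M (M' n)) M.dens z - (M' n).dens z| ≤ ε * |(fderiv ℝ (M' n).f z).det|
  /-- the mechanisms of `x` are converted: exactly if the noise laws agree -/
  mechX_eq : ∀ n, μ n = μ' n → ∀ z,
    (M.toCSG (μ n)).mechX z = ((M' n).toCSG (μ' n)).mechX (reparam M (M' n) z)
  /-- and in the sense of weak convergence, locally uniformly in `z`, in general -/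
  mechX_lim : ∀ h : BoundedContinuousFunction (Obs dS dV) ℝ, TendstoLocallyUniformly
    (fun (n : ℕ) (z : Latent dS dV) => ∫ x, h x ∂((M.toCSG (μ n)).mechX z)
      - ∫ x, h x ∂(((M' n).toCSG (μ' n)).mechX (reparam M (M' n) z))) (fun _ => 0) atTop
  /-- the mechanisms of `y` are converted, in the sense of weak convergence, locally uniformly
  in `z = (s, v)` -/
  mechY_lim : ∀ h : BoundedContinuousFunction (Out dY) ℝ, TendstoLocallyUniformly
    (fun (n : ℕ) (z : Latent dS dV) =>
      ∫ y, h y ∂((M' n).out.law ((M' n).g (sem (reparam M (M' n) z)))))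
    (fun z => ∫ y, h y ∂(M.out.law (M.g (sem z)))) atTop

/-- The semantic-equivalence of the models `(M, μ)` and `(M', μ')` through the homeomorphism
`Φ = f'⁻¹ ∘ f` holds up to errors of size `ε`; `σ2` bounds the second moments of the noises, `B`
bounds the models, `d = dS + dV`. -/
structure NearSemanticEquivalent (M M' : Model dS dV dY) (μ μ' : Measure (Obs dS dV))
    (B : Bounds) (σ2 ε : ℝ) : Prop where
  /-- the mechanisms of `x` are converted: exactly if the noise laws agree -/
  mechX_eq : μ = μ' → ∀ z, (M.toCSG μ).mechX z = (M'.toCSG μ').mechX (reparam M M' z)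
  /-- and up to `2 σ` in the Wasserstein distance in general -/
  mechX_near : ∀ z, ∀ (K : NNReal) (h : Obs dS dV → ℝ), LipschitzWith K h →
    |∫ x, h x ∂((M.toCSG μ).mechX z) - ∫ x, h x ∂((M'.toCSG μ').mechX (reparam M M' z))|
      ≤ 2 * K * √σ2
  /-- the density of `Φ_# p` is close to `p'`, with respect to the volume in the space of `x` -/
  prior_near : ∀ z, |pushDensity (reparam M M') M.dens z - M'.dens z|
    ≤ √((dS : ℝ) + dV) * ε * |(fderiv ℝ M'.f z).det|
  /-- the parameter of `p(y | s)` is converted, on average over the prior -/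
  g_near_avg : ∀ l, ∫⁻ z, ENNReal.ofReal |M.g (sem z) l - M'.g (sem (reparam M M' z)) l| ∂M.prior
    ≤ ENNReal.ofReal (4 * ε)
  /-- and at every point, inversely to the density of `f(s, v)` there -/
  g_near : ∀ l z, |M.g (sem z) l - M'.g (sem (reparam M M' z)) l|
    ≤ 2 * ε * Real.exp (√((dS : ℝ) + dV) * ε / (2 * (B.p * B.finv1 ^ (dS + dV))))
      * (B.p * B.finv1 ^ (dS + dV) / pushDensity M.f M.dens (M.f z))
  /-- the `𝒮`-component of `Φ(s, v)`, as seen by the injective `g'`, is nearly constant in `v` -/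
  sem_near : ∀ l z₁ z₂, sem z₁ = sem z₂ →
    |M'.g (sem (reparam M M' z₁)) l - M'.g (sem (reparam M M' z₂)) l|
      ≤ 2 * ε * Real.exp (√((dS : ℝ) + dV) * ε / (2 * (B.p * B.finv1 ^ (dS + dV))))
        * (B.p * B.finv1 ^ (dS + dV) / pushDensity M.f M.dens (M.f z₁)
          + B.p * B.finv1 ^ (dS + dV) / pushDensity M.f M.dens (M.f z₂))

end CausalSemantic

end

/-! Everything is transported to the space of `x`. A model enters only through the density q of f(s,
v) (`obsDens`), the parameter G = g ∘ sem ∘ f⁻¹ (`obsOut`) and the output law at a point x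
(`outLaw`). Since Φ = f'⁻¹ ∘ f pairs the latent points with the same image, semantic-equivalence
through Φ amounts to comparing q with q' and the output laws at the same x. For a test function h ≥
0 with H(x) = ∫ h d(`outLaw` x), integrating h(y) over y in the data law leaves the density μ ∗ (qH)
in x (`lintegral_dataLaw`). Equal data laws therefore give μ ∗ (qH) = μ' ∗ (q'H') a.e., and h = 1
gives μ ∗ q = μ' ∗ q' (`ae_eq_of_dataLaw_eq`).

(i) Characteristic functions undo the common convolution (`ae_eq_of_conv_ae_eq`), so qH = q'H' for
every h; hence q = q' and the output laws agree (`exact_identification`). The output law determines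
its parameter (`law_injOn`) and g' is injective, so Φ preserves the fibres of `sem`.

(ii) The functions qH and q'ₙH'ₙ are Lipschitz with a common constant, so removing the noise costs
at most a multiple of its first moment, and q'ₙH'ₙ → qH uniformly (`exists_rate`). Division by q > 0
gives convergence of the output laws, and Scheffé's lemma gives total variation. Constancy of the
semantic factor needs more, because the injectivity of the g'ₙ may degenerate in the limit. Along an
ultrafilter the maps f'ₙ⁻¹ − f'ₙ⁻¹(0) converge to a map φ with a Lipschitz derivative
(`exists_ultrafilter_limit`), invertible because |det Df'ₙ⁻¹| ≥ q'ₙ / B_p. If sem φ(x) = sem φ(y),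
the limiting output laws at x and y agree, hence sem f⁻¹(x) = sem f⁻¹(y) by injectivity of g
(`sem_eq_of_tendsto`). This is an inclusion of fibres in the opposite direction to the desired one;
at the level of derivatives it is an inclusion of kernels of equal dimension, hence an equality, and
sem ∘ φ ∘ f is constant on the fibres of `sem` (`fibre_constant`).

(iii) A common translation centres both noises, so the linear Taylor terms average out and every
error is of order σ². For the densities this gives |q − q'| ≤ sσ², where s bounds the second
derivative of q. For the parameters, the commutator μ ∗ (qG) − G · (μ ∗ q) is of order σ² both
uniformly and in L¹ (`abs_conv_mul_sub_le_sup`, `lintegral_conv_mul_sub_le`), and the two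
commutators together control (μ ∗ q)|G − G'|. Jensen's inequality for log q bounds μ ∗ q below by q
exp(−cσ²/2), which yields the pointwise estimate; a second-order expansion of G − G' yields the
average one. The constants are compared with the threshold in `exists_controls`. -/

noncomputable section

namespace CausalSemantic

section

/-! ### Second-order calculus: Taylor's inequality and iterated chain rules. -/

section Taylor

variable {E W : Type*} [NormedAddCommGroup E] [NormedSpace ℝ E]
  [NormedAddCommGroup W] [NormedSpace ℝ W]
  {E' : Type*} [NormedAddCommGroup E'] [NormedSpace ℝ E']

/-- Taylor's inequality of order two, from a bound on the second derivative as a quadratic form. -/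
theorem norm_sub_sub_fderiv_le {F : E → W} (hF : Differentiable ℝ F)
    (hF2 : Differentiable ℝ (fderiv ℝ F)) {C : ℝ}
    (hC : ∀ x u, ‖fderiv ℝ (fderiv ℝ F) x u u‖ ≤ C * ‖u‖ ^ 2) (x u : E) :
    ‖F (x + u) - F x - fderiv ℝ F x u‖ ≤ C / 2 * ‖u‖ ^ 2 := by
  have hline : ∀ t : ℝ, HasDerivAt (fun t : ℝ => x + t • u) u t := fun t => by
    simpa using ((hasDerivAt_id t).smul_const u).const_add x
  have h1 : ∀ t : ℝ, HasDerivAt (fun t : ℝ => fderiv ℝ F (x + t • u) u - fderiv ℝ F x u)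
      (fderiv ℝ (fderiv ℝ F) (x + t • u) u u) t := fun t => by
    have h : HasDerivAt (fun t : ℝ => fderiv ℝ F (x + t • u))
        (fderiv ℝ (fderiv ℝ F) (x + t • u) u) t :=
      HasFDerivAt.comp_hasDerivAt t (hF2 (x + t • u)).hasFDerivAt (hline t)
    simpa using (h.clm_apply (hasDerivAt_const t u)).sub_const (fderiv ℝ F x u)
  have h2 : ∀ t : ℝ, HasDerivAt (fun t : ℝ => F (x + t • u) - F x - t • fderiv ℝ F x u)
      (fderiv ℝ F (x + t • u) u - fderiv ℝ F x u) t := fun t => by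
    have h : HasDerivAt (fun t : ℝ => F (x + t • u)) (fderiv ℝ F (x + t • u) u) t :=
      HasFDerivAt.comp_hasDerivAt t (hF (x + t • u)).hasFDerivAt (hline t)
    have h' : HasDerivAt (fun t : ℝ => t • fderiv ℝ F x u) (fderiv ℝ F x u) t := by
      simpa using (hasDerivAt_id t).smul_const (fderiv ℝ F x u)
    exact (h.sub_const (F x)).sub h'
  -- The mean value inequality is applied twice along the segment, so no continuity of the second
  -- derivative is needed and only its values on the diagonal (u, u) enter.
  have b1 : ∀ t ∈ Set.Icc (0 : ℝ) 1, ‖fderiv ℝ F (x + t • u) u - fderiv ℝ F x u‖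
      ≤ C * ‖u‖ ^ 2 * t := by
    intro t ht
    refine image_norm_le_of_norm_deriv_right_le_deriv_boundary (B' := fun _ => C * ‖u‖ ^ 2)
      (fun t _ => (h1 t).continuousAt.continuousWithinAt)
      (fun t _ => (h1 t).hasDerivWithinAt) (by simp) (fun t => ?_) (fun t _ => hC _ _) ht
    simpa using (hasDerivAt_id t).const_mul (C * ‖u‖ ^ 2)
  have b2 := image_norm_le_of_norm_deriv_right_le_deriv_boundary (a := 0) (b := 1)
      (B := fun t => C * ‖u‖ ^ 2 * t ^ 2 / 2) (B' := fun t => C * ‖u‖ ^ 2 * t)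
      (fun t _ => (h2 t).continuousAt.continuousWithinAt)
      (fun t _ => (h2 t).hasDerivWithinAt) (by simp)
      (fun t => by
        have := (((hasDerivAt_id t).pow 2).const_mul (C * ‖u‖ ^ 2)).div_const 2
        refine this.congr_deriv ?_
        simp; ring)
      (fun t ht => b1 t ⟨ht.1, ht.2.le⟩) (Set.right_mem_Icc.2 zero_le_one)
  simp only [one_smul] at b2
  refine b2.trans_eq (by ring)

theorem fderiv_comp_eq {F : E → W} {ψ : E' → E} (hF : Differentiable ℝ F)
    (hψ : Differentiable ℝ ψ) :
    fderiv ℝ (fun x => F (ψ x)) = fun x => (fderiv ℝ F (ψ x)).comp (fderiv ℝ ψ x) :=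
  funext fun x => ((hF (ψ x)).hasFDerivAt.comp x (hψ x).hasFDerivAt).fderiv

theorem differentiable_fderiv_comp {F : E → W} {ψ : E' → E} (hF : Differentiable ℝ F)
    (hF2 : Differentiable ℝ (fderiv ℝ F)) (hψ : Differentiable ℝ ψ)
    (hψ2 : Differentiable ℝ (fderiv ℝ ψ)) : Differentiable ℝ (fderiv ℝ (fun x => F (ψ x))) := by
  rw [fderiv_comp_eq hF hψ]
  exact (hF2.comp hψ).clm_comp hψ2

/-- The chain rule of order two. -/
theorem fderiv_fderiv_comp {F : E → W} {ψ : E' → E} (hF : Differentiable ℝ F)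
    (hF2 : Differentiable ℝ (fderiv ℝ F)) (hψ : Differentiable ℝ ψ)
    (hψ2 : Differentiable ℝ (fderiv ℝ ψ)) (x u v : E') :
    fderiv ℝ (fderiv ℝ (fun x => F (ψ x))) x u v =
      fderiv ℝ (fderiv ℝ F) (ψ x) (fderiv ℝ ψ x u) (fderiv ℝ ψ x v)
        + fderiv ℝ F (ψ x) (fderiv ℝ (fderiv ℝ ψ) x u v) := by
  rw [fderiv_comp_eq hF hψ]
  have h1 := ((hF2 (ψ x)).hasFDerivAt.comp x (hψ x).hasFDerivAt)
  have h2 := (h1.clm_comp (hψ2 x).hasFDerivAt).fderiv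
  simp only [Function.comp_def] at h2
  rw [h2]
  simp [add_comm]

/-- The derivatives of a function up to a linear map. -/
theorem fderiv_clm_comp {W' : Type*} [NormedAddCommGroup W'] [NormedSpace ℝ W'] {F : E → W}
    (hF : Differentiable ℝ F) (L : W →L[ℝ] W') :
    fderiv ℝ (fun w => L (F w)) = fun z => ContinuousLinearMap.compL ℝ E W W' L (fderiv ℝ F z) :=
  funext fun z => (HasFDerivAt.comp z L.hasFDerivAt (hF z).hasFDerivAt).fderiv

theorem differentiable_clm_comp {W' : Type*} [NormedAddCommGroup W'] [NormedSpace ℝ W']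
    {F : E → W} (hF : Differentiable ℝ F) (L : W →L[ℝ] W') : Differentiable ℝ (fun w => L (F w)) :=
  L.differentiable.comp hF

theorem differentiable_apply {F : E → W} (hF : Differentiable ℝ F) (L : W →L[ℝ] E') :
    Differentiable ℝ (fun x => L.comp (ContinuousLinearMap.apply ℝ W (F x))) :=
  (differentiable_const L).clm_comp (F := W →L[ℝ] W)
    (differentiable_clm_comp (W' := (W →L[ℝ] W) →L[ℝ] W) hF (ContinuousLinearMap.apply ℝ W))

theorem fderiv_fderiv_clm_comp {W' : Type*} [NormedAddCommGroup W'] [NormedSpace ℝ W'] {F : E → W}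
    (hF : Differentiable ℝ F) (hF2 : Differentiable ℝ (fderiv ℝ F)) (L : W →L[ℝ] W')
    (z u v : E) :
    fderiv ℝ (fderiv ℝ (fun w => L (F w))) z u v = L (fderiv ℝ (fderiv ℝ F) z u v) := by
  rw [fderiv_clm_comp hF, fderiv_clm_comp hF2]; rfl

theorem fderiv_fderiv_fderiv_clm_comp {W' : Type*} [NormedAddCommGroup W'] [NormedSpace ℝ W']
    {F : E → W} (hF : Differentiable ℝ F) (hF2 : Differentiable ℝ (fderiv ℝ F))
    (hF3 : Differentiable ℝ (fderiv ℝ (fderiv ℝ F))) (L : W →L[ℝ] W') (z u v w : E) :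
    fderiv ℝ (fderiv ℝ (fderiv ℝ (fun w => L (F w)))) z u v w
      = L (fderiv ℝ (fderiv ℝ (fderiv ℝ F)) z u v w) := by
  rw [fderiv_clm_comp hF]
  have := fderiv_fderiv_clm_comp hF2 hF3 (ContinuousLinearMap.compL ℝ E W W' L) z u v
  rw [this]; rfl

theorem hasFDerivAt_fderiv_comp {F : E → W} {ψ : E' → E} (hF2 : Differentiable ℝ (fderiv ℝ F))
    (hψ : Differentiable ℝ ψ) (x : E') :
    HasFDerivAt (fun x => fderiv ℝ F (ψ x))
      ((fderiv ℝ (fderiv ℝ F) (ψ x)).comp (fderiv ℝ ψ x)) x :=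
  HasFDerivAt.comp x (hF2 (ψ x)).hasFDerivAt (hψ x).hasFDerivAt

theorem hasFDerivAt_fderiv_apply {F : E → W} (hF2 : Differentiable ℝ (fderiv ℝ F)) (x v : E) :
    HasFDerivAt (fun x => fderiv ℝ F x v)
      ((ContinuousLinearMap.apply ℝ W v).comp (fderiv ℝ (fderiv ℝ F) x)) x :=
  HasFDerivAt.comp x (ContinuousLinearMap.apply ℝ W v).hasFDerivAt (hF2 x).hasFDerivAt

/-- The gradient of the log-Jacobian is a sum of terms of this shape, with `L` a coordinate. Only
the values of the derivative matter later, hence the existential form. -/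
theorem exists_hasFDerivAt_snd_comp {W' : Type*} [NormedAddCommGroup W'] [NormedSpace ℝ W']
    {F : E → W} {ψ : E' → E} (hF3 : Differentiable ℝ (fderiv ℝ (fderiv ℝ F)))
    (hψ : Differentiable ℝ ψ) (hψ2 : Differentiable ℝ (fderiv ℝ ψ)) (L : W →L[ℝ] W')
    (x v w : E') : ∃ D : E' →L[ℝ] W',
      HasFDerivAt (fun x => L (fderiv ℝ (fderiv ℝ F) (ψ x) (fderiv ℝ ψ x v) (fderiv ℝ ψ x w))) D x ∧
      ∀ u, D u = L (fderiv ℝ (fderiv ℝ (fderiv ℝ F)) (ψ x) (fderiv ℝ ψ x u) (fderiv ℝ ψ x v)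
          (fderiv ℝ ψ x w))
        + L (fderiv ℝ (fderiv ℝ F) (ψ x) (fderiv ℝ (fderiv ℝ ψ) x u v) (fderiv ℝ ψ x w))
        + L (fderiv ℝ (fderiv ℝ F) (ψ x) (fderiv ℝ ψ x v) (fderiv ℝ (fderiv ℝ ψ) x u w)) := by
  have h := HasFDerivAt.comp x L.hasFDerivAt (((hasFDerivAt_fderiv_comp hF3 hψ x).clm_apply
    (hasFDerivAt_fderiv_apply hψ2 x v)).clm_apply (hasFDerivAt_fderiv_apply hψ2 x w))
  refine ⟨_, h, fun u => ?_⟩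
  simp
  abel

end Taylor

/-! ### Determinants of linear maps and Euclidean norms in coordinates. -/

section Det

variable {ι : Type*} [Fintype ι]

theorem det_eq_matrix_det [DecidableEq ι] (T : EuclideanSpace ℝ ι →L[ℝ] EuclideanSpace ℝ ι) :
    T.det = (Matrix.of fun i j => T (EuclideanSpace.single j 1) i).det := by
  rw [ContinuousLinearMap.det, ← LinearMap.det_toMatrix (EuclideanSpace.basisFun ι ℝ).toBasis]
  congr 1

/-- The determinant is a polynomial in the matrix entries. Knowing differentiability beforehand,
Jacobi's formula only has to be checked along lines. -/
theorem differentiable_det : Differentiable ℝ (fun T : EuclideanSpace ℝ ι →L[ℝ] EuclideanSpace ℝ ι => T.det) := by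
  classical
  have h : ∀ i j, Differentiable ℝ
      (fun T : EuclideanSpace ℝ ι →L[ℝ] EuclideanSpace ℝ ι => T (EuclideanSpace.single j 1) i) := fun i j =>
    ((EuclideanSpace.proj i : EuclideanSpace ℝ ι →L[ℝ] ℝ).comp
      (ContinuousLinearMap.apply ℝ (EuclideanSpace ℝ ι) (EuclideanSpace.single j (1 : ℝ)))).differentiable
  simp_rw [det_eq_matrix_det, Matrix.det_apply, Matrix.of_apply]
  fun_prop

/-- The functional `H ↦ tr (H S)`. -/
def traceMul [DecidableEq ι] (S : EuclideanSpace ℝ ι →L[ℝ] EuclideanSpace ℝ ι) :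
    (EuclideanSpace ℝ ι →L[ℝ] EuclideanSpace ℝ ι) →L[ℝ] ℝ :=
  ∑ c, (EuclideanSpace.proj c : EuclideanSpace ℝ ι →L[ℝ] ℝ).comp
    (ContinuousLinearMap.apply ℝ (EuclideanSpace ℝ ι) (S (EuclideanSpace.single c (1 : ℝ))))

theorem traceMul_apply [DecidableEq ι] (S H : EuclideanSpace ℝ ι →L[ℝ] EuclideanSpace ℝ ι) :
    traceMul S H = ∑ c, H (S (EuclideanSpace.single c 1)) c := by
  simp [traceMul]

theorem differentiable_traceMul [DecidableEq ι] {W : Type*} [NormedAddCommGroup W] [NormedSpace ℝ W]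
    {S : W → EuclideanSpace ℝ ι →L[ℝ] EuclideanSpace ℝ ι} (hS : Differentiable ℝ S) :
    Differentiable ℝ (fun x => traceMul (S x)) := by
  unfold traceMul
  have h : ∀ c, Differentiable ℝ (fun x => (EuclideanSpace.proj c : EuclideanSpace ℝ ι →L[ℝ] ℝ).comp
      (ContinuousLinearMap.apply ℝ (EuclideanSpace ℝ ι)
      (S x (EuclideanSpace.single c (1 : ℝ))))) := fun c =>
    differentiable_apply (hS.clm_apply (differentiable_const (EuclideanSpace.single c (1 : ℝ)))) _
  exact Differentiable.fun_sum (𝕜 := ℝ) (E := W) (u := Finset.univ)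
    (F := (EuclideanSpace ℝ ι →L[ℝ] EuclideanSpace ℝ ι) →L[ℝ] ℝ)
    (A := fun c x => (EuclideanSpace.proj c : EuclideanSpace ℝ ι →L[ℝ] ℝ).comp
      (ContinuousLinearMap.apply ℝ (EuclideanSpace ℝ ι)
      (S x (EuclideanSpace.single c (1 : ℝ))))) fun c _ => h c

/-- Jacobi's formula. -/
theorem hasFDerivAt_det [DecidableEq ι] {T S : EuclideanSpace ℝ ι →L[ℝ] EuclideanSpace ℝ ι} (hST : S.comp T = ContinuousLinearMap.id ℝ (EuclideanSpace ℝ ι)) :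
    HasFDerivAt (fun T : EuclideanSpace ℝ ι →L[ℝ] EuclideanSpace ℝ ι => T.det) (T.det • traceMul S) T := by
  have hd := (differentiable_det (ι := ι) T).hasFDerivAt
  convert hd using 1
  ext H
  have hline : HasDerivAt (fun t : ℝ => T + t • H) H 0 := by
    simpa using ((hasDerivAt_id (0 : ℝ)).smul_const H).const_add T
  have h1 : HasDerivAt (fun t : ℝ => (T + t • H).det)
      (fderiv ℝ (fun T : EuclideanSpace ℝ ι →L[ℝ] EuclideanSpace ℝ ι => T.det) T H) 0 := by
    have hd' : HasFDerivAt (fun T : EuclideanSpace ℝ ι →L[ℝ] EuclideanSpace ℝ ι => T.det)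
        (fderiv ℝ (fun T : EuclideanSpace ℝ ι →L[ℝ] EuclideanSpace ℝ ι => T.det) T) (T + (0 : ℝ) • H) := by
      have e0 : T + (0 : ℝ) • H = T := by
        rw [show (0 : ℝ) • H = 0 from zero_smul ℝ H, add_zero]
      rw [e0]; exact hd
    exact HasFDerivAt.comp_hasDerivAt (0 : ℝ) hd' hline
  -- Factor T + tH = (1 + tHS)T, which reduces the computation to the derivative of the determinant
  -- at the identity.
  have h2 : ∀ t : ℝ, (T + t • H).det = T.det * (1 + t • (Matrix.of fun i j =>
      H (S (EuclideanSpace.single j 1)) i)).det := by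
    intro t
    have e : T + t • H = (ContinuousLinearMap.id ℝ (EuclideanSpace ℝ ι) + t • H.comp S).comp T := by
      ext1 v
      have : S (T v) = v := DFunLike.congr_fun hST v
      simp [this]
    have e2 : ((ContinuousLinearMap.id ℝ (EuclideanSpace ℝ ι) + t • H.comp S).comp T).det
        = (ContinuousLinearMap.id ℝ (EuclideanSpace ℝ ι) + t • H.comp S).det * T.det := by
      simp only [ContinuousLinearMap.det]
      exact LinearMap.det_comp _ _
    rw [e, e2, mul_comm, det_eq_matrix_det (ContinuousLinearMap.id ℝ (EuclideanSpace ℝ ι) + t • H.comp S)]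
    congr 2
    ext i j
    simp [Matrix.one_apply]
  set N : Matrix ι ι ℝ := Matrix.of fun i j => H (S (EuclideanSpace.single j 1)) i
  -- det(1 + XN) is a polynomial in X with constant term 1 and linear coefficient tr N; `P` is what
  -- remains after X² is factored out of the rest.
  set P := (1 + (Polynomial.X : Polynomial ℝ) • N.map Polynomial.C).det.divX.divX
  have h1' := h1.congr_of_eventuallyEq (f₁ := fun r : ℝ =>
    T.det * (1 + N.trace * r + P.eval r * r ^ 2)) (Eventually.of_forall fun r => by
      dsimp only; rw [h2, Matrix.det_one_add_smul])
  have h3 : HasDerivAt (fun r : ℝ => T.det * (1 + N.trace * r + P.eval r * r ^ 2))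
      (T.det * N.trace) 0 := by
    have a := (((hasDerivAt_id (0 : ℝ)).const_mul N.trace).const_add 1).add
      ((P.hasDerivAt 0).mul ((hasDerivAt_id (0 : ℝ)).pow 2))
    have b := a.const_mul T.det
    simpa using b
  have := h3.unique h1'
  rw [← this]
  simp [traceMul_apply, N, Matrix.trace]

/-- Compare volumes: `T` maps the unit ball into the ball of radius ‖T‖ and multiplies volumes by
|det T|. -/
theorem abs_det_le_norm_pow (T : EuclideanSpace ℝ ι →L[ℝ] EuclideanSpace ℝ ι) : |T.det| ≤ ‖T‖ ^ Fintype.card ι := by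
  have h1 := Measure.addHaar_image_continuousLinearMap (volume : Measure (EuclideanSpace ℝ ι)) T (Metric.closedBall 0 1)
  have h2 : T '' Metric.closedBall 0 1 ⊆ Metric.closedBall 0 ‖T‖ := by
    rintro _ ⟨x, hx, rfl⟩
    have hx : ‖x‖ ≤ 1 := by simpa using hx
    simpa using T.le_of_opNorm_le_of_le le_rfl hx
  have h3 := measure_mono (μ := (volume : Measure (EuclideanSpace ℝ ι))) h2
  rw [h1, Measure.addHaar_closedBall _ _ (norm_nonneg _), Measure.addHaar_closedBall _ _ zero_le_one]
    at h3
  simp only [one_pow, ENNReal.ofReal_one, one_mul] at h3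
  have h4 : volume (Metric.ball (0 : EuclideanSpace ℝ ι) 1) ≠ 0 := (Metric.measure_ball_pos _ _ one_pos).ne'
  rw [ENNReal.mul_le_mul_iff_left h4 measure_ball_lt_top.ne,
    ENNReal.ofReal_le_ofReal_iff (by positivity)] at h3
  simpa using h3

theorem euclidean_norm_le {x : EuclideanSpace ℝ ι} {a : ℝ} (ha : 0 ≤ a) (h : ∀ c, |x c| ≤ a) :
    ‖x‖ ≤ √(Fintype.card ι) * a := by
  rw [EuclideanSpace.norm_eq, ← Real.sqrt_sq ha, ← Real.sqrt_mul (by positivity)]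
  refine Real.sqrt_le_sqrt ?_
  calc ∑ i, ‖x i‖ ^ 2 ≤ ∑ _i : ι, a ^ 2 := Finset.sum_le_sum fun i _ => by
        rw [Real.norm_eq_abs]; gcongr; exact h i
    _ = _ := by simp

theorem sum_abs_le (x : EuclideanSpace ℝ ι) : ∑ i, |x i| ≤ √(Fintype.card ι) * ‖x‖ := by
  have h := sq_sum_le_card_mul_sum_sq (s := (Finset.univ : Finset ι)) (f := fun i => |x i|)
  rw [EuclideanSpace.norm_eq, ← Real.sqrt_mul (by positivity)]
  refine Real.le_sqrt_of_sq_le (h.trans_eq ?_)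
  simp [Real.norm_eq_abs]

end Det

end

/-! ### Bounds for the inverse of a diffeomorphism and for its log-Jacobian. -/

section

section Diffeo

variable {ι : Type*} [Fintype ι]

theorem fderiv_fderiv_coord_apply {f : EuclideanSpace ℝ ι → EuclideanSpace ℝ ι}
    (hf : Differentiable ℝ f) (hf2 : Differentiable ℝ (fderiv ℝ f)) (c : ι)
    (z u v : EuclideanSpace ℝ ι) :
    fderiv ℝ (fderiv ℝ (fun w => f w c)) z u v = fderiv ℝ (fderiv ℝ f) z u v c :=
  fderiv_fderiv_clm_comp hf hf2 (EuclideanSpace.proj c : EuclideanSpace ℝ ι →L[ℝ] ℝ) z u v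

theorem fderiv_fderiv_fderiv_coord_apply {f : EuclideanSpace ℝ ι → EuclideanSpace ℝ ι}
    (hf : Differentiable ℝ f) (hf2 : Differentiable ℝ (fderiv ℝ f))
    (hf3 : Differentiable ℝ (fderiv ℝ (fderiv ℝ f))) (c : ι) (z u v w : EuclideanSpace ℝ ι) :
    fderiv ℝ (fderiv ℝ (fderiv ℝ (fun w => f w c))) z u v w
      = fderiv ℝ (fderiv ℝ (fderiv ℝ f)) z u v w c :=
  fderiv_fderiv_fderiv_clm_comp hf hf2 hf3
    (EuclideanSpace.proj c : EuclideanSpace ℝ ι →L[ℝ] ℝ) z u v w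

/-- A diffeomorphism `f` with inverse `ψ` and bounds for its derivatives. -/
structure BoundedDiffeo [DecidableEq ι] (f ψ : EuclideanSpace ℝ ι → EuclideanSpace ℝ ι) (b f2 f3 : ℝ) : Prop where
  left_inv : ∀ x, f (ψ x) = x
  right_inv : ∀ z, ψ (f z) = z
  diff : Differentiable ℝ f
  diff2 : Differentiable ℝ (fderiv ℝ f)
  diff3 : Differentiable ℝ (fderiv ℝ (fderiv ℝ f))
  inv_diff : Differentiable ℝ ψ
  inv_diff2 : Differentiable ℝ (fderiv ℝ ψ)
  inv_bound : ∀ x, ‖fderiv ℝ ψ x‖ ≤ b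
  bound2 : ∀ z c, ‖fderiv ℝ (fderiv ℝ (fun w => (f w c : ℝ))) z‖ ≤ f2
  bound3 : ∀ z c i j k, |fderiv ℝ (fderiv ℝ (fderiv ℝ (fun w => (f w c : ℝ)))) z
    (EuclideanSpace.single i 1) (EuclideanSpace.single j 1) (EuclideanSpace.single k 1)| ≤ f3

namespace BoundedDiffeo

variable [DecidableEq ι] {f ψ : EuclideanSpace ℝ ι → EuclideanSpace ℝ ι} {b f2 f3 : ℝ}

theorem b_nonneg (h : BoundedDiffeo f ψ b f2 f3) : 0 ≤ b := (norm_nonneg _).trans (h.inv_bound 0)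

theorem f2_nonneg (h : BoundedDiffeo f ψ b f2 f3) [Nonempty ι] : 0 ≤ f2 :=
  le_trans (by positivity) (h.bound2 0 (Classical.arbitrary ι))

theorem f3_nonneg (h : BoundedDiffeo f ψ b f2 f3) [Nonempty ι] : 0 ≤ f3 :=
  let c := Classical.arbitrary ι
  (abs_nonneg _).trans (h.bound3 0 c c c c)

theorem norm_inv_apply_le (h : BoundedDiffeo f ψ b f2 f3) (x u : EuclideanSpace ℝ ι) : ‖fderiv ℝ ψ x u‖ ≤ b * ‖u‖ :=
  (fderiv ℝ ψ x).le_of_opNorm_le (h.inv_bound x) u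

theorem comp_eq_id (h : BoundedDiffeo f ψ b f2 f3) (x : EuclideanSpace ℝ ι) :
    (fderiv ℝ f (ψ x)).comp (fderiv ℝ ψ x) = ContinuousLinearMap.id ℝ (EuclideanSpace ℝ ι) := by
  have h1 := (h.diff (ψ x)).hasFDerivAt.comp x (h.inv_diff x).hasFDerivAt
  have : f ∘ ψ = id := funext h.left_inv
  rw [this] at h1
  exact h1.unique (hasFDerivAt_id x)

theorem comp_eq_id' (h : BoundedDiffeo f ψ b f2 f3) (x : EuclideanSpace ℝ ι) :
    (fderiv ℝ ψ x).comp (fderiv ℝ f (ψ x)) = ContinuousLinearMap.id ℝ (EuclideanSpace ℝ ι) := by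
  have h0 := (h.diff (ψ x)).hasFDerivAt
  have h1 := HasFDerivAt.comp (ψ x) (h.inv_diff (f (ψ x))).hasFDerivAt h0
  rw [h.left_inv] at h1
  have : ψ ∘ f = id := funext h.right_inv
  rw [this] at h1
  exact h1.unique (hasFDerivAt_id _)

theorem det_mul_det (h : BoundedDiffeo f ψ b f2 f3) (x : EuclideanSpace ℝ ι) : (fderiv ℝ f (ψ x)).det * (fderiv ℝ ψ x).det = 1 := by
  have h1 := congrArg ContinuousLinearMap.det (h.comp_eq_id x)
  have h2 : (ContinuousLinearMap.id ℝ (EuclideanSpace ℝ ι)).det = 1 := LinearMap.det_id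
  have h3 : ((fderiv ℝ f (ψ x)).comp (fderiv ℝ ψ x)).det
      = (fderiv ℝ f (ψ x)).det * (fderiv ℝ ψ x).det := LinearMap.det_comp _ _
  rw [← h3, h1, h2]

theorem abs_coord_snd_le (h : BoundedDiffeo f ψ b f2 f3) (z u v : EuclideanSpace ℝ ι) (c : ι) :
    |fderiv ℝ (fderiv ℝ f) z u v c| ≤ f2 * ‖u‖ * ‖v‖ := by
  rw [← fderiv_fderiv_coord_apply h.diff h.diff2]
  exact (ContinuousLinearMap.le_opNorm₂ (fderiv ℝ (fderiv ℝ (fun w => (f w c : ℝ))) z) u v).trans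
    (mul_le_mul_of_nonneg_right (mul_le_mul_of_nonneg_right (h.bound2 z c) (norm_nonneg u))
      (norm_nonneg v))

theorem norm_snd_le (h : BoundedDiffeo f ψ b f2 f3) [Nonempty ι] (z u v : EuclideanSpace ℝ ι) :
    ‖fderiv ℝ (fderiv ℝ f) z u v‖ ≤ √(Fintype.card ι) * (f2 * ‖u‖ * ‖v‖) := by
  have := h.f2_nonneg
  exact euclidean_norm_le (by positivity) (h.abs_coord_snd_le z u v)

/-- Third-order bounds are assumed only for single partial derivatives, so the form is expanded in
the basis; by Cauchy–Schwarz each of the three ℓ¹-norms costs a factor √d. -/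
theorem abs_coord_third_le (h : BoundedDiffeo f ψ b f2 f3) [Nonempty ι] (z u v w : EuclideanSpace ℝ ι) (c : ι) :
    |fderiv ℝ (fderiv ℝ (fderiv ℝ f)) z u v w c|
      ≤ f3 * (√(Fintype.card ι) * ‖u‖) * (√(Fintype.card ι) * ‖v‖)
        * (√(Fintype.card ι) * ‖w‖) := by
  have h3 := h.f3_nonneg
  rw [← fderiv_fderiv_fderiv_coord_apply h.diff h.diff2 h.diff3]
  set T := fderiv ℝ (fderiv ℝ (fderiv ℝ (fun w => f w c))) z
  have hs : ∀ x : EuclideanSpace ℝ ι, x = ∑ i, x i • EuclideanSpace.single i (1 : ℝ) := fun x => by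
    have := (EuclideanSpace.basisFun ι ℝ).sum_repr x
    simpa using this.symm
  have e : T u v w = ∑ i, ∑ j, ∑ k, u i * (v j * (w k * T (EuclideanSpace.single i 1)
      (EuclideanSpace.single j 1) (EuclideanSpace.single k 1))) := by
    conv_lhs => rw [hs u, hs v, hs w]
    simp only [map_sum, map_smul, sum_apply, smul_apply, smul_eq_mul, Finset.mul_sum]
    rw [Finset.sum_comm_cycle, Finset.sum_congr rfl fun _ _ => Finset.sum_comm]
    refine Finset.sum_congr rfl fun i _ => Finset.sum_congr rfl fun j _ =>
      Finset.sum_congr rfl fun k _ => ?_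
    ring
  rw [e]
  calc _ ≤ ∑ i, ∑ j, ∑ k, |u i| * (|v j| * (|w k| * f3)) := by
        refine (Finset.abs_sum_le_sum_abs _ _).trans (Finset.sum_le_sum fun i _ => ?_)
        refine (Finset.abs_sum_le_sum_abs _ _).trans (Finset.sum_le_sum fun j _ => ?_)
        refine (Finset.abs_sum_le_sum_abs _ _).trans (Finset.sum_le_sum fun k _ => ?_)
        rw [abs_mul, abs_mul, abs_mul]
        gcongr
        exact h.bound3 z c i j k
    _ = f3 * (∑ i, |u i|) * (∑ j, |v j|) * ∑ k, |w k| := by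
        simp only [← Finset.mul_sum, ← Finset.sum_mul]; ring
    _ ≤ _ := by
        have := Finset.sum_nonneg fun i (_ : i ∈ Finset.univ) => abs_nonneg (v i)
        gcongr <;> apply sum_abs_le

/-- Differentiate f ∘ ψ = id twice and solve for ψ'' by applying ψ'. -/
theorem fderiv_fderiv_inv (h : BoundedDiffeo f ψ b f2 f3) (x u v : EuclideanSpace ℝ ι) : fderiv ℝ (fderiv ℝ ψ) x u v =
    -(fderiv ℝ ψ x (fderiv ℝ (fderiv ℝ f) (ψ x) (fderiv ℝ ψ x u) (fderiv ℝ ψ x v))) := by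
  have h1 := fderiv_fderiv_comp h.diff h.diff2 h.inv_diff h.inv_diff2 x u v
  have h2 : fderiv ℝ (fderiv ℝ fun x => f (ψ x)) = 0 := by
    have : (fun x => f (ψ x)) = id := funext h.left_inv
    rw [this]
    have : fderiv ℝ (id : EuclideanSpace ℝ ι → EuclideanSpace ℝ ι) = fun _ => ContinuousLinearMap.id ℝ (EuclideanSpace ℝ ι) := funext fun _ => fderiv_id
    rw [this]
    exact funext fun _ => fderiv_const_apply _
  rw [h2] at h1
  have h3 := congrArg (fderiv ℝ ψ x) h1
  have h4 := DFunLike.congr_fun (h.comp_eq_id' x) (fderiv ℝ (fderiv ℝ ψ) x u v)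
  simp only [ContinuousLinearMap.comp_apply, ContinuousLinearMap.id_apply] at h4
  simp only [map_add, h4] at h3
  simp only [Pi.zero_apply, zero_apply, map_zero] at h3
  exact eq_neg_of_add_eq_zero_right h3.symm

theorem norm_fderiv_fderiv_inv_le (h : BoundedDiffeo f ψ b f2 f3) [Nonempty ι] (x u v : EuclideanSpace ℝ ι) :
    ‖fderiv ℝ (fderiv ℝ ψ) x u v‖ ≤ √(Fintype.card ι) * b ^ 3 * f2 * ‖u‖ * ‖v‖ := by
  have := h.f2_nonneg
  have := h.b_nonneg
  rw [h.fderiv_fderiv_inv, norm_neg]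
  calc _ ≤ b * (√(Fintype.card ι) * (f2 * (b * ‖u‖) * (b * ‖v‖))) := by
        refine (h.norm_inv_apply_le _ _).trans ?_
        gcongr
        refine (h.norm_snd_le _ _ _).trans ?_
        gcongr <;> apply h.norm_inv_apply_le
    _ = _ := by ring

/-- The logarithm of the Jacobian determinant of `f` at `ψ x`. -/
theorem hasFDerivAt_log_det (h : BoundedDiffeo f ψ b f2 f3) (x : EuclideanSpace ℝ ι) :
    HasFDerivAt (fun x => Real.log (fderiv ℝ f (ψ x)).det)
      ((traceMul (fderiv ℝ ψ x)).comp ((fderiv ℝ (fderiv ℝ f) (ψ x)).comp (fderiv ℝ ψ x))) x := by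
  -- `Real.log` is log |·|, so a nonzero determinant suffices and orientation plays no role.
  have h0 : (fderiv ℝ f (ψ x)).det ≠ 0 := left_ne_zero_of_mul_eq_one (h.det_mul_det x)
  have h2 := HasFDerivAt.comp x (hasFDerivAt_det (h.comp_eq_id' x))
    (hasFDerivAt_fderiv_comp h.diff2 h.inv_diff x)
  refine (h2.log h0).congr_fderiv (ContinuousLinearMap.ext fun u => ?_)
  simp [inv_mul_cancel_left₀ h0]

theorem fderiv_log_det_apply (h : BoundedDiffeo f ψ b f2 f3) (x u : EuclideanSpace ℝ ι) :
    fderiv ℝ (fun x => Real.log (fderiv ℝ f (ψ x)).det) x u = ∑ c,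
      fderiv ℝ (fderiv ℝ f) (ψ x) (fderiv ℝ ψ x u)
        (fderiv ℝ ψ x (EuclideanSpace.single c 1)) c := by
  rw [(h.hasFDerivAt_log_det x).fderiv]
  simp [traceMul_apply]

theorem abs_fderiv_log_det_le (h : BoundedDiffeo f ψ b f2 f3) (x u : EuclideanSpace ℝ ι) :
    |fderiv ℝ (fun x => Real.log (fderiv ℝ f (ψ x)).det) x u|
      ≤ Fintype.card ι * (b ^ 2 * f2) * ‖u‖ := by
  rw [h.fderiv_log_det_apply]
  have hb := h.b_nonneg
  calc _ ≤ ∑ _c : ι, f2 * (b * ‖u‖) * (b * 1) := by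
        refine (Finset.abs_sum_le_sum_abs _ _).trans (Finset.sum_le_sum fun c _ => ?_)
        have : Nonempty ι := ⟨c⟩
        have := h.f2_nonneg
        refine (h.abs_coord_snd_le _ _ _ c).trans ?_
        gcongr
        · exact h.norm_inv_apply_le _ _
        · exact (h.norm_inv_apply_le _ _).trans (by simp)
    _ = _ := by simp; ring

theorem differentiable_fderiv_log_det (h : BoundedDiffeo f ψ b f2 f3) :
    Differentiable ℝ (fderiv ℝ (fun x => Real.log (fderiv ℝ f (ψ x)).det)) := by
  have e : fderiv ℝ (fun x => Real.log (fderiv ℝ f (ψ x)).det) = fun x =>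
      (traceMul (fderiv ℝ ψ x)).comp ((fderiv ℝ (fderiv ℝ f) (ψ x)).comp (fderiv ℝ ψ x)) :=
    funext fun x => (h.hasFDerivAt_log_det x).fderiv
  rw [e]
  have h1 : Differentiable ℝ (fun x => traceMul (fderiv ℝ ψ x)) :=
    differentiable_traceMul h.inv_diff2
  exact h1.clm_comp (Differentiable.clm_comp
    (fun x => (hasFDerivAt_fderiv_comp h.diff3 h.inv_diff x).differentiableAt) h.inv_diff2)

theorem fderiv_fderiv_log_det_apply (h : BoundedDiffeo f ψ b f2 f3) (x u v : EuclideanSpace ℝ ι) :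
    fderiv ℝ (fderiv ℝ (fun x => Real.log (fderiv ℝ f (ψ x)).det)) x u v = ∑ c,
      (fderiv ℝ (fderiv ℝ (fderiv ℝ f)) (ψ x) (fderiv ℝ ψ x u) (fderiv ℝ ψ x v)
          (fderiv ℝ ψ x (EuclideanSpace.single c 1)) c
        + fderiv ℝ (fderiv ℝ f) (ψ x) (fderiv ℝ (fderiv ℝ ψ) x u v)
          (fderiv ℝ ψ x (EuclideanSpace.single c 1)) c
        + fderiv ℝ (fderiv ℝ f) (ψ x) (fderiv ℝ ψ x v)
          (fderiv ℝ (fderiv ℝ ψ) x u (EuclideanSpace.single c 1)) c) := by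
  choose D hD hDu using fun c => exists_hasFDerivAt_snd_comp h.diff3 h.inv_diff h.inv_diff2
    (EuclideanSpace.proj c : EuclideanSpace ℝ ι →L[ℝ] ℝ) x v (EuclideanSpace.single c 1)
  have h4 := HasFDerivAt.fun_sum (u := Finset.univ) fun c _ => hD c
  have h5 := hasFDerivAt_fderiv_apply h.differentiable_fderiv_log_det x v
  simp_rw [h.fderiv_log_det_apply] at h5
  have h6 := DFunLike.congr_fun (h5.unique h4) u
  simp only [ContinuousLinearMap.comp_apply, ContinuousLinearMap.apply_apply, sum_apply,
    hDu] at h6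
  exact h6

/-- Each of the d summands of the trace gives a third-derivative term, where the bound on partial
derivatives costs √d³, and two terms containing ψ'', each using ‖ψ''‖ ≤ √d b³ f2. -/
theorem abs_fderiv_fderiv_log_det_le (h : BoundedDiffeo f ψ b f2 f3) [Nonempty ι] (x u : EuclideanSpace ℝ ι) :
    |fderiv ℝ (fderiv ℝ (fun x => Real.log (fderiv ℝ f (ψ x)).det)) x u u|
      ≤ Fintype.card ι * (√(Fintype.card ι) ^ 3 * b ^ 3 * f3
        + 2 * √(Fintype.card ι) * b ^ 4 * f2 ^ 2) * ‖u‖ ^ 2 := by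
  rw [h.fderiv_fderiv_log_det_apply]
  have hb := h.b_nonneg
  have := h.f2_nonneg
  have := h.f3_nonneg
  set n := √(Fintype.card ι : ℝ) with hn
  have hu := h.norm_inv_apply_le x u
  have he : ∀ c, ‖fderiv ℝ ψ x (EuclideanSpace.single c 1)‖ ≤ b := fun c =>
    (h.norm_inv_apply_le x _).trans (by simp)
  calc _ ≤ ∑ _c : ι, (f3 * (n * (b * ‖u‖)) * (n * (b * ‖u‖)) * (n * b)
          + f2 * (n * b ^ 3 * f2 * ‖u‖ * ‖u‖) * b
          + f2 * (b * ‖u‖) * (n * b ^ 3 * f2 * ‖u‖ * 1)) := by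
        refine (Finset.abs_sum_le_sum_abs _ _).trans (Finset.sum_le_sum fun c _ => ?_)
        refine (abs_add_le _ _).trans (add_le_add ((abs_add_le _ _).trans (add_le_add ?_ ?_)) ?_)
        · refine (h.abs_coord_third_le _ _ _ _ c).trans ?_
          rw [← hn]
          gcongr
          exact he c
        · refine (h.abs_coord_snd_le _ _ _ c).trans ?_
          gcongr
          · exact h.norm_fderiv_fderiv_inv_le x u u
          · exact he c
        · refine (h.abs_coord_snd_le _ _ _ c).trans ?_
          gcongr
          exact (h.norm_fderiv_fderiv_inv_le _ _ _).trans (by simp [hn])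
    _ = _ := by simp; ring

end BoundedDiffeo

end Diffeo

end

/-! ### Densities with controlled logarithm. -/

section

section Regular

variable {E : Type*} [NormedAddCommGroup E] [NormedSpace ℝ E]

/-- A positive function with upper bound `Q`, logarithmic gradient bound `a` and second-order bounds
`c` for its logarithm and `s` for itself. -/
structure RegularDensity (q : E → ℝ) (Q a c s : ℝ) : Prop where
  pos : ∀ x, 0 < q x
  le : ∀ x, q x ≤ Q
  diff : Differentiable ℝ q
  cont_fderiv : Continuous (fderiv ℝ q)
  grad : ∀ x u, |fderiv ℝ q x u| ≤ a * ‖u‖ * q x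
  taylor : ∀ x u, |q (x + u) - q x - fderiv ℝ q x u| ≤ s / 2 * ‖u‖ ^ 2
  log_taylor : ∀ x u, |Real.log (q (x + u)) - Real.log (q x)
    - fderiv ℝ (fun x => Real.log (q x)) x u| ≤ c / 2 * ‖u‖ ^ 2

/-- A function with a first- and a second-order bound. -/
structure SmoothBounded (G : E → ℝ) (g₁ g₂ : ℝ) : Prop where
  diff : Differentiable ℝ G
  grad : ∀ x u, |fderiv ℝ G x u| ≤ g₁ * ‖u‖
  taylor : ∀ x u, |G (x + u) - G x - fderiv ℝ G x u| ≤ g₂ / 2 * ‖u‖ ^ 2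

/-- For q = exp l one has q' = q l' and q'' = q (l'' + l' ⊗ l'), which is where the constant Q (a² +
c) comes from. -/
theorem regularDensity_exp {l : E → ℝ} (hl : Differentiable ℝ l) (hl2 : Differentiable ℝ (fderiv ℝ l))
    {Q a c : ℝ} (hQ : ∀ x, Real.exp (l x) ≤ Q) (h1 : ∀ x u, |fderiv ℝ l x u| ≤ a * ‖u‖)
    (h2 : ∀ x u, |fderiv ℝ (fderiv ℝ l) x u u| ≤ c * ‖u‖ ^ 2) :
    RegularDensity (fun x => Real.exp (l x)) Q a c (Q * (a ^ 2 + c)) := by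
  have hd : Differentiable ℝ (fun x => Real.exp (l x)) := hl.exp
  have hf : fderiv ℝ (fun x => Real.exp (l x)) = fun x => Real.exp (l x) • fderiv ℝ l x :=
    funext fun x => (hl x).hasFDerivAt.exp.fderiv
  have hf2 : ∀ x, HasFDerivAt (fderiv ℝ (fun x => Real.exp (l x)))
      (Real.exp (l x) • fderiv ℝ (fderiv ℝ l) x
        + (Real.exp (l x) • fderiv ℝ l x).smulRight (fderiv ℝ l x)) x := fun x => by
    rw [hf]
    exact (hl x).hasFDerivAt.exp.smul (hl2 x).hasFDerivAt
  refine ⟨fun x => Real.exp_pos _, hQ, hd,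
    (show Differentiable ℝ _ from fun x => (hf2 x).differentiableAt).continuous, fun x u => ?_,
    fun x u => ?_, fun x u => ?_⟩
  · rw [hf]
    simp only [smul_apply, smul_eq_mul, abs_mul, Real.abs_exp]
    rw [mul_comm]
    gcongr
    exact h1 x u
  · refine norm_sub_sub_fderiv_le hd (fun x => (hf2 x).differentiableAt) (fun x u => ?_) x u
    rw [(hf2 x).fderiv]
    simp only [add_apply, smul_apply, ContinuousLinearMap.smulRight_apply, smul_eq_mul,
      Real.norm_eq_abs]
    have e1 := h1 x u
    have e2 := h2 x u
    have e3 : (fderiv ℝ l x u) ^ 2 ≤ (a * ‖u‖) ^ 2 := sq_le_sq' (by linarith [abs_le.1 e1]) (abs_le.1 e1).2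
    have e0 := Real.exp_pos (l x)
    have : Real.exp (l x) * fderiv ℝ (fderiv ℝ l) x u u
        + Real.exp (l x) * fderiv ℝ l x u * fderiv ℝ l x u
        = Real.exp (l x) * (fderiv ℝ (fderiv ℝ l) x u u + fderiv ℝ l x u ^ 2) := by ring
    rw [this, abs_mul, abs_of_pos e0, mul_assoc]
    have e4 : |fderiv ℝ (fderiv ℝ l) x u u + fderiv ℝ l x u ^ 2| ≤ (a ^ 2 + c) * ‖u‖ ^ 2 := by
      refine (abs_add_le _ _).trans ?_
      rw [abs_of_nonneg (sq_nonneg (fderiv ℝ l x u))]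
      nlinarith
    have e5 := (abs_nonneg _).trans e4
    calc _ ≤ Q * |fderiv ℝ (fderiv ℝ l) x u u + fderiv ℝ l x u ^ 2| := by gcongr; exact hQ x
      _ ≤ _ := by
        have := e0.le.trans (hQ x)
        gcongr
  · simp only [Real.log_exp]
    exact norm_sub_sub_fderiv_le hl hl2 h2 x u

/-- In dimension zero the bounds on the components of `f` are vacuous and their constants may have
any sign; this degenerate case is served by zero constants. -/
theorem regularDensity_of_subsingleton [Subsingleton E] {q : E → ℝ} {Q : ℝ} (h0 : ∀ x, 0 < q x)
    (hQ : ∀ x, q x ≤ Q) : RegularDensity q Q 0 0 0 := by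
  have hc : ∀ x y : E, q x = q y := fun x y => by rw [Subsingleton.elim x y]
  have hu : ∀ u : E, u = 0 := fun u => Subsingleton.elim _ _
  refine ⟨h0, hQ, ?_, ?_, fun x u => ?_, fun x u => ?_, fun x u => ?_⟩
  · rw [show q = fun _ => q 0 from funext fun x => hc x 0]; exact differentiable_const _
  · exact continuous_of_const fun x y => by rw [Subsingleton.elim x y]
  all_goals simp [hu u]

theorem smoothBounded_of_subsingleton [Subsingleton E] (G : E → ℝ) : SmoothBounded G 0 0 := by
  have hc : ∀ x y : E, G x = G y := fun x y => by rw [Subsingleton.elim x y]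
  have hu : ∀ u : E, u = 0 := fun u => Subsingleton.elim _ _
  refine ⟨?_, fun x u => ?_, fun x u => ?_⟩
  · rw [show G = fun _ => G 0 from funext fun x => hc x 0]; exact differentiable_const _
  all_goals simp [hu u]

end Regular

namespace BoundedDiffeo

variable {ι : Type*} [Fintype ι] [DecidableEq ι] {f ψ : EuclideanSpace ℝ ι → EuclideanSpace ℝ ι}
  {b f2 f3 : ℝ}

theorem abs_fderiv_comp_le (h : BoundedDiffeo f ψ b f2 f3) {F : EuclideanSpace ℝ ι → ℝ}
    (hF : Differentiable ℝ F) {c₁ : ℝ} (h1 : ∀ z, ‖fderiv ℝ F z‖ ≤ c₁) (x u : EuclideanSpace ℝ ι) :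
    |fderiv ℝ (fun x => F (ψ x)) x u| ≤ b * c₁ * ‖u‖ := by
  rw [fderiv_comp_eq hF h.inv_diff]
  refine ((fderiv ℝ F (ψ x)).le_of_opNorm_le (h1 _) _).trans ?_
  have := (norm_nonneg _).trans (h1 0)
  calc _ ≤ c₁ * (b * ‖u‖) := by gcongr; exact h.norm_inv_apply_le x u
    _ = _ := by ring

theorem abs_fderiv_fderiv_comp_le [Nonempty ι] (h : BoundedDiffeo f ψ b f2 f3)
    {F : EuclideanSpace ℝ ι → ℝ} (hF : Differentiable ℝ F) (hF2 : Differentiable ℝ (fderiv ℝ F))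
    {c₁ c₂ : ℝ} (h1 : ∀ z, ‖fderiv ℝ F z‖ ≤ c₁) (h2 : ∀ z, ‖fderiv ℝ (fderiv ℝ F) z‖ ≤ c₂)
    (x u : EuclideanSpace ℝ ι) :
    |fderiv ℝ (fderiv ℝ (fun x => F (ψ x))) x u u|
      ≤ (b ^ 2 * c₂ + √(Fintype.card ι) * b ^ 3 * f2 * c₁) * ‖u‖ ^ 2 := by
  rw [fderiv_fderiv_comp hF hF2 h.inv_diff h.inv_diff2]
  have hc1 := (norm_nonneg _).trans (h1 0)
  have hc2 : 0 ≤ c₂ := le_trans (by positivity) (h2 0)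
  have hb := h.b_nonneg
  refine (abs_add_le _ _).trans ?_
  have e1 : |fderiv ℝ (fderiv ℝ F) (ψ x) (fderiv ℝ ψ x u) (fderiv ℝ ψ x u)|
      ≤ c₂ * (b * ‖u‖) * (b * ‖u‖) := by
    refine (ContinuousLinearMap.le_opNorm₂ (fderiv ℝ (fderiv ℝ F) (ψ x)) _ _).trans ?_
    gcongr
    · exact h2 _
    · exact h.norm_inv_apply_le x u
    · exact h.norm_inv_apply_le x u
  have e2 : |fderiv ℝ F (ψ x) (fderiv ℝ (fderiv ℝ ψ) x u u)|
      ≤ c₁ * (√(Fintype.card ι) * b ^ 3 * f2 * ‖u‖ * ‖u‖) := by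
    refine ((fderiv ℝ F (ψ x)).le_of_opNorm_le (h1 _) _).trans ?_
    gcongr
    exact h.norm_fderiv_fderiv_inv_le x u u
  linarith

theorem smoothBounded_comp [Nonempty ι] (h : BoundedDiffeo f ψ b f2 f3)
    {F : EuclideanSpace ℝ ι → ℝ} (hF : Differentiable ℝ F) (hF2 : Differentiable ℝ (fderiv ℝ F))
    {c₁ c₂ : ℝ} (h1 : ∀ z, ‖fderiv ℝ F z‖ ≤ c₁) (h2 : ∀ z, ‖fderiv ℝ (fderiv ℝ F) z‖ ≤ c₂) :
    SmoothBounded (fun x => F (ψ x)) (b * c₁) (b ^ 2 * c₂ + √(Fintype.card ι) * b ^ 3 * f2 * c₁) :=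
  ⟨hF.comp h.inv_diff, h.abs_fderiv_comp_le hF h1,
    norm_sub_sub_fderiv_le (F := fun x => F (ψ x)) (hF.comp h.inv_diff)
      (differentiable_fderiv_comp hF hF2 h.inv_diff h.inv_diff2)
      (h.abs_fderiv_fderiv_comp_le hF hF2 h1 h2)⟩

/-- The density of the image under `f` of a law with density `p`. -/
theorem regularDensity_image [Nonempty ι] (h : BoundedDiffeo f ψ b f2 f3)
    {p : EuclideanSpace ℝ ι → ℝ} (hp : ∀ z, 0 < p z) {P c₁ c₂ : ℝ} (hP : ∀ z, p z ≤ P)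
    (hd : Differentiable ℝ (fun z => Real.log (p z)))
    (hd2 : Differentiable ℝ (fderiv ℝ (fun z => Real.log (p z))))
    (h1 : ∀ z, ‖fderiv ℝ (fun z => Real.log (p z)) z‖ ≤ c₁)
    (h2 : ∀ z, ‖fderiv ℝ (fderiv ℝ (fun z => Real.log (p z))) z‖ ≤ c₂) :
    RegularDensity (fun x => p (ψ x) * |(fderiv ℝ ψ x).det|) (P * b ^ Fintype.card ι)
      (b * c₁ + Fintype.card ι * (b ^ 2 * f2))
      (b ^ 2 * c₂ + √(Fintype.card ι) * b ^ 3 * f2 * c₁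
        + Fintype.card ι * (√(Fintype.card ι) ^ 3 * b ^ 3 * f3
          + 2 * √(Fintype.card ι) * b ^ 4 * f2 ^ 2))
      (P * b ^ Fintype.card ι * ((b * c₁ + Fintype.card ι * (b ^ 2 * f2)) ^ 2
        + (b ^ 2 * c₂ + √(Fintype.card ι) * b ^ 3 * f2 * c₁
        + Fintype.card ι * (√(Fintype.card ι) ^ 3 * b ^ 3 * f3
          + 2 * √(Fintype.card ι) * b ^ 4 * f2 ^ 2)))) := by
  have hc1 := (norm_nonneg _).trans (h1 0)
  have hf2 := h.f2_nonneg
  have hb := h.b_nonneg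
  set A : EuclideanSpace ℝ ι → ℝ := fun x => Real.log (p (ψ x)) with hA
  set D : EuclideanSpace ℝ ι → ℝ := fun x => Real.log (fderiv ℝ f (ψ x)).det with hD
  have hA1 : Differentiable ℝ A := hd.comp h.inv_diff
  have hA2 : Differentiable ℝ (fderiv ℝ A) :=
    differentiable_fderiv_comp (F := fun z => Real.log (p z)) hd hd2 h.inv_diff h.inv_diff2
  have hD1 : Differentiable ℝ D := fun x => (h.hasFDerivAt_log_det x).differentiableAt
  have hD2 : Differentiable ℝ (fderiv ℝ D) := h.differentiable_fderiv_log_det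
  have e1 : fderiv ℝ (A - D) = fderiv ℝ A - fderiv ℝ D := funext fun x => fderiv_sub (hA1 x) (hD1 x)
  have e2 : ∀ x, fderiv ℝ (fderiv ℝ A - fderiv ℝ D) x
      = fderiv ℝ (fderiv ℝ A) x - fderiv ℝ (fderiv ℝ D) x := fun x => fderiv_sub (hA2 x) (hD2 x)
  -- As det Dψ is inverse to det Df at ψ x, the density is exp(log p ∘ ψ − log |det Df ∘ ψ|), and
  -- the two summands of the exponent can be bounded separately.
  have e : (fun x => p (ψ x) * |(fderiv ℝ ψ x).det|) = fun x => Real.exp ((A - D) x) := by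
    funext x
    have h0 := h.det_mul_det x
    have h0' : (fderiv ℝ f (ψ x)).det ≠ 0 := left_ne_zero_of_mul_eq_one h0
    rw [Pi.sub_apply, Real.exp_sub, Real.exp_log (hp _), hD]
    simp only
    rw [Real.exp_log_eq_abs h0', div_eq_mul_inv, ← abs_inv, ← eq_inv_of_mul_eq_one_right h0]
  rw [e]
  refine regularDensity_exp (hA1.sub hD1) ?_ (fun x => ?_) (fun x u => ?_)
    (fun x u => ?_)
  · rw [e1]; exact hA2.sub hD2
  · rw [← congrFun e x]
    have := (hp (ψ x)).le.trans (hP (ψ x))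
    gcongr
    · exact hP _
    · exact (abs_det_le_norm_pow _).trans (by gcongr; exact h.inv_bound x)
  · rw [e1, Pi.sub_apply, sub_apply, add_mul]
    exact (abs_sub _ _).trans
      (add_le_add (h.abs_fderiv_comp_le hd h1 x u) (h.abs_fderiv_log_det_le x u))
  · rw [e1, e2, sub_apply, sub_apply, add_mul]
    exact (abs_sub _ _).trans (add_le_add (h.abs_fderiv_fderiv_comp_le hd hd2 h1 h2 x u)
      (h.abs_fderiv_fderiv_log_det_le x u))

end BoundedDiffeo

end

/-! ### Models seen in the space of `x`, and their uniform constants. -/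

section

variable {dS dV dY : ℕ}

/-- The projection to the semantic factor, as a linear map. -/
def semL : Latent dS dV →L[ℝ] Sem dS :=
  LinearMap.toContinuousLinearMap
    { toFun := sem
      map_add' := fun x y => by ext i; simp [sem]
      map_smul' := fun c x => by ext i; simp [sem] }

theorem continuous_sem : Continuous (sem : Latent dS dV → Sem dS) := (semL (dS := dS)).continuous

theorem sem_sub (z w : Latent dS dV) : sem (z - w) = sem z - sem w := map_sub semL z w

theorem norm_sem_le (z : Latent dS dV) : ‖sem z‖ ≤ ‖z‖ := by
  rw [EuclideanSpace.norm_eq, EuclideanSpace.norm_eq]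
  refine Real.sqrt_le_sqrt ?_
  rw [Fintype.sum_sum_type]
  have : 0 ≤ ∑ a : Fin dV, ‖z (Sum.inr a)‖ ^ 2 := by positivity
  simpa [sem] using this

/-- The density of `f(s, v)`. -/
def Model.obsDens (M : Model dS dV dY) : Obs dS dV → ℝ := pushDensity M.f M.dens

/-- The parameter `g(s)` of the output, as a function of `f(s, v)`. -/
def Model.obsOut (M : Model dS dV dY) (x : Obs dS dV) : Out dY := M.g (sem (M.f.symm x))

theorem Model.Admissible.boundedDiffeo {M : Model dS dV dY} (hM : M.Admissible) {B : Bounds}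
    (hB : M.BoundedBy B) : BoundedDiffeo M.f M.f.symm B.finv1 B.f2 B.f3 :=
  ⟨M.f.apply_symm_apply, M.f.symm_apply_apply, hM.f_diff, hM.f_diff2, hM.f_diff3, hM.finv_diff,
    hM.finv_diff2, hB.finv1, hB.f2, hB.f3⟩

theorem Model.Admissible.differentiable_coord {M : Model dS dV dY} (hM : M.Admissible) (l : Fin dY) :
    Differentiable ℝ (fun t => M.g t l) :=
  differentiable_clm_comp hM.g_diff (EuclideanSpace.proj l : Out dY →L[ℝ] ℝ)

theorem Model.Admissible.differentiable_fderiv_coord {M : Model dS dV dY} (hM : M.Admissible)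
    (l : Fin dY) : Differentiable ℝ (fderiv ℝ (fun t => M.g t l)) := by
  have e := fderiv_clm_comp hM.g_diff (EuclideanSpace.proj l : Out dY →L[ℝ] ℝ)
  have e' : (fun t => M.g t l) = fun t => (EuclideanSpace.proj l : Out dY →L[ℝ] ℝ) (M.g t) := rfl
  rw [e', e]
  exact differentiable_clm_comp hM.g_diff2 _

/-- The projection `sem` is linear and norm-nonincreasing, so g ∘ sem inherits the bounds of g, and
composition with f⁻¹ is covered by `smoothBounded_comp`. -/
theorem Model.Admissible.smoothBounded_obsOut {M : Model dS dV dY} (hM : M.Admissible)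
    {B : Bounds} (hB : M.BoundedBy B) [Nonempty (Fin dS ⊕ Fin dV)] (l : Fin dY) :
    SmoothBounded (fun x => M.obsOut x l) (B.finv1 * B.g1)
      (B.finv1 ^ 2 * B.g2 + √(Fintype.card (Fin dS ⊕ Fin dV)) * B.finv1 ^ 3 * B.f2 * B.g1) := by
  have h := hM.boundedDiffeo hB
  have d1 := hM.differentiable_coord l
  have d2 := hM.differentiable_fderiv_coord l
  have s1 : Differentiable ℝ (sem : Latent dS dV → Sem dS) := (semL (dS := dS)).differentiable
  have s0 : fderiv ℝ (sem : Latent dS dV → Sem dS) = fun _ => semL :=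
    funext fun z => (semL (dS := dS)).hasFDerivAt.fderiv
  have s2 : Differentiable ℝ (fderiv ℝ (sem : Latent dS dV → Sem dS)) := by
    rw [s0]; exact differentiable_const _
  have g1 : 0 ≤ B.g1 := (norm_nonneg _).trans (hB.g1 0 l)
  have g2 : 0 ≤ B.g2 := le_trans (by positivity) (hB.g2 0 l)
  refine h.smoothBounded_comp (F := fun z => M.g (sem z) l) (d1.comp s1)
    (differentiable_fderiv_comp d1 d2 s1 s2) (fun z => ?_) (fun z => ?_)
  · refine ContinuousLinearMap.opNorm_le_bound _ g1 fun u => ?_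
    rw [fderiv_comp_eq d1 s1, s0]
    refine ((fderiv ℝ (fun t => M.g t l) (sem z)).le_of_opNorm_le (hB.g1 _ l) _).trans ?_
    gcongr
    exact norm_sem_le u
  · refine ContinuousLinearMap.opNorm_le_bound₂ _ g2 fun u v => ?_
    rw [fderiv_fderiv_comp d1 d2 s1 s2, s0]
    simp only [fderiv_fun_const, Pi.zero_apply, zero_apply, map_zero, add_zero]
    refine (ContinuousLinearMap.le_opNorm₂ (fderiv ℝ (fderiv ℝ fun t => M.g t l) (sem z)) _ _).trans ?_
    gcongr
    · exact hB.g2 _ l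
    · exact norm_sem_le u
    · exact norm_sem_le v

theorem Model.Admissible.obsDens_pos {M : Model dS dV dY} (hM : M.Admissible)
    {B : Bounds} (hB : M.BoundedBy B) (x : Obs dS dV) : 0 < M.obsDens x :=
  mul_pos (hM.dens_pos _) (abs_pos.2 (right_ne_zero_of_mul_eq_one
    ((hM.boundedDiffeo hB).det_mul_det x)))

theorem Model.Admissible.obsDens_le {M : Model dS dV dY} (hM : M.Admissible)
    {B : Bounds} (hB : M.BoundedBy B) (x : Obs dS dV) :
    M.obsDens x ≤ B.p * B.finv1 ^ (dS + dV) := by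
  have h1 : |(fderiv ℝ M.f.symm x).det| ≤ B.finv1 ^ (dS + dV) := by
    refine (abs_det_le_norm_pow _).trans ?_
    simp only [Fintype.card_sum, Fintype.card_fin]
    gcongr
    exact hB.finv1 x
  have := (hM.dens_pos (M.f.symm x)).le.trans (hB.p _)
  exact mul_le_mul (hB.p _) h1 (abs_nonneg _) this

/-- Constants that control the density and the output parameter of every model bounded by `B`, and
their relation to the intensity threshold. -/
structure Controls (B : Bounds) (dS dV dY : ℕ) (a c s g₁ g₂ : ℝ) : Prop where
  a_nonneg : 0 ≤ a
  c_nonneg : 0 ≤ c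
  s_nonneg : 0 ≤ s
  g₁_nonneg : 0 ≤ g₁
  g₂_nonneg : 0 ≤ g₂
  dens : ∀ M : Model dS dV dY, M.Admissible → M.BoundedBy B →
    RegularDensity M.obsDens (B.p * B.finv1 ^ (dS + dV)) a c s
  out : ∀ M : Model dS dV dY, M.Admissible → M.BoundedBy B → ∀ l,
    SmoothBounded (fun x => M.obsOut x l) g₁ g₂
  s_le : s ≤ √((dS : ℝ) + dV) * B.threshold dS dV
  c_le : B.p * B.finv1 ^ (dS + dV) * c ≤ √((dS : ℝ) + dV) * B.threshold dS dV
  g_le : dY ≠ 0 → a * g₁ + g₂ / 2 ≤ B.threshold dS dV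
  g₂_le : dY ≠ 0 → g₂ ≤ 2 * B.threshold dS dV

/-- The constants depend on `B` alone, so they serve all models bounded by `B` at once. The given
model `M` is needed only to know the signs of the entries of `B`. -/
theorem exists_controls {M : Model dS dV dY} (hM : M.Admissible) {B : Bounds}
    (hB : M.BoundedBy B) : ∃ a c s g₁ g₂, Controls B dS dV dY a c s g₁ g₂ := by
  have hQ0 : 0 ≤ B.p * B.finv1 ^ (dS + dV) :=
    (hM.obsDens_pos hB 0).le.trans (hM.obsDens_le hB 0)
  have hlp1 : 0 ≤ B.lp1 := (norm_nonneg _).trans (hB.lp1 0)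
  have hlp2 : 0 ≤ B.lp2 := le_trans (by positivity) (hB.lp2 0)
  have hb : 0 ≤ B.finv1 := (norm_nonneg _).trans (hB.finv1 0)
  -- For d = 0 the entries `f2`, `f3` may be negative, but they occur in the threshold only with a
  -- factor d or a power of d and vanish; its second branch is then nonnegative.
  rcases isEmpty_or_nonempty (Fin dS ⊕ Fin dV) with he | hne
  · have : Subsingleton (Obs dS dV) := inferInstance
    have hcard : dS + dV = 0 := by
      have := Fintype.card_eq_zero_iff.2 he
      simpa only [Fintype.card_sum, Fintype.card_fin] using this
    have hT : 0 ≤ B.threshold dS dV := by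
      have h1 : dS = 0 := by omega
      have h2 : dV = 0 := by omega
      subst h1 h2
      unfold Bounds.threshold
      refine mul_nonneg (sq_nonneg _) (le_max_of_le_right ?_)
      have : (0 : ℝ) ^ (3 / 2 : ℝ) = 0 := Real.zero_rpow (by norm_num)
      simp [this] at hQ0 ⊢
      positivity
    exact ⟨0, 0, 0, 0, 0, le_rfl, le_rfl, le_rfl, le_rfl, le_rfl,
      fun M' hM' hB' => regularDensity_of_subsingleton (hM'.obsDens_pos hB') (hM'.obsDens_le hB'),
      fun M' _ _ l => smoothBounded_of_subsingleton _, by positivity,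
      by rw [mul_zero]; positivity, by simpa using fun _ => hT, by simpa using fun _ => hT⟩
  · have h := hM.boundedDiffeo hB
    have hf2 := h.f2_nonneg
    have hf3 := h.f3_nonneg
    have hcard : (Fintype.card (Fin dS ⊕ Fin dV) : ℝ) = dS + dV := by simp
    have hcard' : Fintype.card (Fin dS ⊕ Fin dV) = dS + dV := by simp
    -- With n = √d every power of d in the threshold, including d^(3/2), becomes a natural power of
    -- n, and n ≥ 1 makes these powers comparable.
    obtain ⟨n, hn0, hn⟩ : ∃ n : ℝ, 1 ≤ n ∧ n ^ 2 = (dS : ℝ) + dV := by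
      have h1 : (1 : ℝ) ≤ (dS : ℝ) + dV := by
        rw [← hcard]; exact_mod_cast Fintype.card_pos
      exact ⟨√((dS : ℝ) + dV), Real.one_le_sqrt.2 h1, Real.sq_sqrt (by positivity)⟩
    have hsq : √((dS : ℝ) + dV) = n := by rw [← hn, Real.sqrt_sq (by linarith)]
    have hpow : ((dS : ℝ) + dV) ^ (3 / 2 : ℝ) = n ^ 3 := by
      rw [← hn, ← Real.rpow_natCast n 2, ← Real.rpow_mul (by linarith), ← Real.rpow_natCast n 3]
      norm_num
    set b := B.finv1
    set Q := B.p * b ^ (dS + dV) with hQ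
    set a := b * B.lp1 + n ^ 2 * (b ^ 2 * B.f2) with ha
    set c := b ^ 2 * B.lp2 + n * b ^ 3 * B.f2 * B.lp1
      + n ^ 2 * (n ^ 3 * b ^ 3 * B.f3 + 2 * n * b ^ 4 * B.f2 ^ 2) with hc
    have hdens : ∀ M : Model dS dV dY, M.Admissible → M.BoundedBy B →
        RegularDensity M.obsDens Q a c (Q * (a ^ 2 + c)) := fun M' hM' hB' => by
      have := (hM'.boundedDiffeo hB').regularDensity_image hM'.dens_pos hB'.p hM'.logdens_diff
        hM'.logdens_diff2 hB'.lp1 hB'.lp2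
      rw [hcard, hcard', hsq, ← hn] at this
      exact this
    have hT2 : b ^ 2 * (Q * (B.lp1 ^ 2 + B.lp2 + 3 * n ^ 2 * b * B.f2 * B.lp1
      + 3 * n ^ 3 * b ^ 2 * B.f2 ^ 2 + (n ^ 2) ^ 3 * B.f3 * b)) ≤ B.threshold dS dV := by
      unfold Bounds.threshold
      simp only [hpow]
      rw [← hn]
      exact mul_le_mul_of_nonneg_left (le_max_right _ _) (sq_nonneg _)
    have hT1 : b ^ 2 * (B.lp1 * B.g1 + 1 / 2 * B.g2 + 3 / 2 * n ^ 2 * b * B.f2 * B.g1)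
        ≤ B.threshold dS dV := by
      unfold Bounds.threshold
      simp only [hpow]
      rw [← hn]
      exact mul_le_mul_of_nonneg_left (le_max_left _ _) (sq_nonneg _)
    have ha0 : 0 ≤ a := by positivity
    have hc0 : 0 ≤ c := by positivity
    have hT0 : 0 ≤ B.threshold dS dV := le_trans (by positivity) hT2
    -- Expanded in n, both sides are compared monomial by monomial; the extra factor n = √d on the
    -- right is the √d of the estimate for the prior.
    have key : a ^ 2 + c ≤ n * (b ^ 2 * (B.lp1 ^ 2 + B.lp2 + 3 * n ^ 2 * b * B.f2 * B.lp1
      + 3 * n ^ 3 * b ^ 2 * B.f2 ^ 2 + (n ^ 2) ^ 3 * B.f3 * b)) := by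
      have n2 : n ^ 2 ≤ n ^ 3 := pow_le_pow_right₀ hn0 (by norm_num)
      have n1 : n ≤ n ^ 3 := le_self_pow₀ hn0 (by norm_num)
      have n3 : n ^ 3 ≤ n ^ 4 := pow_le_pow_right₀ hn0 (by norm_num)
      have n5 : n ^ 5 ≤ n ^ 7 := pow_le_pow_right₀ hn0 (by norm_num)
      have t1 : b ^ 2 * B.lp1 ^ 2 ≤ n * (b ^ 2 * B.lp1 ^ 2) := le_mul_of_one_le_left (by positivity) hn0
      have t2 : b ^ 2 * B.lp2 ≤ n * (b ^ 2 * B.lp2) := le_mul_of_one_le_left (by positivity) hn0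
      have t3 : (2 * n ^ 2 + n) * (b ^ 3 * B.f2 * B.lp1) ≤ 3 * n ^ 3 * (b ^ 3 * B.f2 * B.lp1) := by
        gcongr; linarith
      have t4 : (n ^ 4 + 2 * n ^ 3) * (b ^ 4 * B.f2 ^ 2) ≤ 3 * n ^ 4 * (b ^ 4 * B.f2 ^ 2) := by
        gcongr; linarith
      have t5 : n ^ 5 * (b ^ 3 * B.f3) ≤ n ^ 7 * (b ^ 3 * B.f3) := by gcongr
      rw [ha, hc]
      linarith
    have hs : Q * (a ^ 2 + c) ≤ n * B.threshold dS dV := by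
      refine (mul_le_mul_of_nonneg_left key hQ0).trans ?_
      refine le_trans (le_of_eq (by ring)) (mul_le_mul_of_nonneg_left hT2 (by linarith))
    have hc' : Q * c ≤ n * B.threshold dS dV := by
      refine le_trans (mul_le_mul_of_nonneg_left ?_ hQ0) hs
      linarith [sq_nonneg a]
    -- Without output coordinates nothing is known about the signs of `g1` and `g2`, so zero
    -- constants are used; the comparisons of the output constants are claimed only for dY ≠ 0.
    rcases Nat.eq_zero_or_pos dY with hY | hY
    · subst hY
      refine ⟨a, c, Q * (a ^ 2 + c), 0, 0, ha0, hc0, by positivity, le_rfl, le_rfl, hdens,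
        fun M' _ _ l => l.elim0, by rw [hsq]; exact hs, by rw [hsq]; exact hc',
        by simp, by simp⟩
    · have g1 : 0 ≤ B.g1 := (norm_nonneg _).trans (hB.g1 0 ⟨0, hY⟩)
      have g2 : 0 ≤ B.g2 := le_trans (by positivity) (hB.g2 0 ⟨0, hY⟩)
      have n1 : n ≤ n ^ 2 := le_self_pow₀ hn0 (by norm_num)
      have t1 : n * (b ^ 3 * B.f2 * B.g1) ≤ n ^ 2 * (b ^ 3 * B.f2 * B.g1) := by gcongr
      have t2 : 0 ≤ b ^ 2 * (B.lp1 * B.g1) := by positivity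
      have t3 : 0 ≤ n ^ 2 * (b ^ 3 * B.f2 * B.g1) := by positivity
      refine ⟨a, c, Q * (a ^ 2 + c), b * B.g1, b ^ 2 * B.g2 + n * b ^ 3 * B.f2 * B.g1,
        ha0, hc0, by positivity, by positivity, by positivity, hdens, fun M' hM' hB' l => ?_,
        by rw [hsq]; exact hs, by rw [hsq]; exact hc', fun _ => ?_, fun _ => ?_⟩
      · have := hM'.smoothBounded_obsOut hB' l
        rw [hcard, hsq] at this
        exact this
      · refine le_trans ?_ hT1
        rw [ha]
        linarith
      · refine le_trans ?_ (mul_le_mul_of_nonneg_left hT1 zero_le_two)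
        linarith

end

/-! ### Output laws: Lipschitz dependence, injectivity and means; tests for weak convergence. -/

section

variable {dS dV dY : ℕ}

theorem measurable_map_add {E : Type*} [NormedAddCommGroup E] [MeasurableSpace E] [BorelSpace E]
    [SecondCountableTopology E] (μ : Measure E) [SFinite μ] :
    Measurable (fun a : E => μ.map (fun u => a + u)) := by
  refine Measure.measurable_of_measurable_coe _ fun s hs => ?_
  have h : ∀ a, (μ.map (fun u => a + u)) s = μ (Prod.mk a ⁻¹' ((fun p : E × E => p.1 + p.2) ⁻¹' s)) :=
    fun a => Measure.map_apply (measurable_const_add a) hs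
  simp_rw [h]
  exact measurable_measure_prodMk_left ((measurable_fst.add measurable_snd) hs)

namespace OutputKind

/-- `OutputKind.law` with parameters in the set `A` consists of probability measures. -/
def Proper (o : OutputKind dY) (A : Set (Out dY)) : Prop :=
  match o with
  | additive ν => IsProbabilityMeasure ν
  | categorical => ∀ a ∈ A, (fun k => a k) ∈ stdSimplex ℝ (Fin dY)

theorem Valid.proper {o : OutputKind dY} {g : Sem dS → Out dY} (h : o.Valid g) :
    o.Proper (Set.range g) := by
  cases o with
  | additive ν => exact h
  | categorical => rintro _ ⟨s, rfl⟩; exact h s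

variable {o : OutputKind dY} {A : Set (Out dY)}

theorem Proper.isProbabilityMeasure (h : o.Proper A) {a : Out dY} (ha : a ∈ A) :
    IsProbabilityMeasure (o.law a) := by
  cases o with
  | additive ν =>
    have : IsProbabilityMeasure ν := h
    exact Measure.isProbabilityMeasure_map (by fun_prop)
  | categorical =>
    have h1 := h a ha
    refine ⟨?_⟩
    simp only [law, Measure.coe_finsetSum, Measure.coe_smul, Finset.sum_apply, Pi.smul_apply,
      measure_univ, smul_eq_mul, mul_one]
    rw [← ENNReal.ofReal_sum_of_nonneg fun k _ => h1.1 k, h1.2, ENNReal.ofReal_one]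

theorem Proper.measurable_law (h : o.Proper A) : Measurable o.law := by
  cases o with
  | additive ν =>
    have : IsProbabilityMeasure ν := h
    exact measurable_map_add ν
  | categorical =>
    refine Measure.measurable_of_measurable_coe _ fun s hs => ?_
    simp only [law, Measure.coe_finsetSum, Measure.coe_smul, Finset.sum_apply, Pi.smul_apply,
      smul_eq_mul]
    have h : ∀ k, Measurable (fun a : Out dY => ENNReal.ofReal (a k)) := fun k =>
      ENNReal.measurable_ofReal.comp (EuclideanSpace.proj k : Out dY →L[ℝ] ℝ).continuous.measurable
    exact Finset.measurable_fun_sum _ fun k _ => (h k).mul_const _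

theorem integral_law_additive (ν : Measure (Out dY)) {h : Out dY → ℝ} (hh : Continuous h)
    (a : Out dY) : ∫ y, h y ∂((additive ν).law a) = ∫ w, h (a + w) ∂ν :=
  integral_map (by fun_prop) hh.aestronglyMeasurable

theorem integral_law_categorical {h : Out dY → ℝ} {a : Out dY} (ha : ∀ k, 0 ≤ a k) :
    ∫ y, h y ∂((categorical : OutputKind dY).law a)
      = ∑ k, a k * h (EuclideanSpace.single k (1 : ℝ)) := by
  have h1 : ∀ k, Integrable h (ENNReal.ofReal (a k) •
      Measure.dirac (EuclideanSpace.single k (1 : ℝ) : Out dY)) := fun k =>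
    (integrable_dirac (by simp)).smul_measure ENNReal.ofReal_ne_top
  simp only [law]
  rw [integral_finsetSum_measure fun k _ => h1 k]
  refine Finset.sum_congr rfl fun k _ => ?_
  rw [integral_smul_measure, integral_dirac, ENNReal.toReal_ofReal (ha k), smul_eq_mul]

/-- Integrals of bounded Lipschitz functions depend in a Lipschitz way on the parameter. -/
theorem Proper.abs_integral_law_sub_le (ho : o.Proper A) {h : Out dY → ℝ} {K : NNReal}
    (hK : LipschitzWith K h) {C : ℝ} (h0 : ∀ y, 0 ≤ h y) (hC : ∀ y, h y ≤ C) {a b : Out dY}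
    (ha : a ∈ A) (hb : b ∈ A) :
    |∫ y, h y ∂(o.law a) - ∫ y, h y ∂(o.law b)| ≤ (K + dY * C) * ‖a - b‖ := by
  have hC0 : 0 ≤ C := (h0 0).trans (hC 0)
  cases o with
  | additive ν =>
    have : IsProbabilityMeasure ν := ho
    have hint : ∀ a, Integrable (fun w => h (a + w)) ν := fun a =>
      Integrable.of_bound (μ := ν) (C := C) (hK.continuous.comp (continuous_const_add a)).aestronglyMeasurable
        (ae_of_all _ fun w => by rw [Real.norm_of_nonneg (h0 _)]; exact hC _)
    rw [integral_law_additive ν hK.continuous, integral_law_additive ν hK.continuous,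
      ← integral_sub (hint a) (hint b)]
    have hb := norm_integral_le_of_norm_le_const (μ := ν) (f := fun w => h (a + w) - h (b + w))
      (C := K * ‖a - b‖) (ae_of_all _ fun w => by
        have := hK.dist_le_mul (a + w) (b + w)
        rwa [dist_add_right, dist_eq_norm, dist_eq_norm] at this)
    refine hb.trans ?_
    rw [probReal_univ, mul_one]
    gcongr
    have : 0 ≤ (dY : ℝ) * C := by positivity
    linarith
  | categorical =>
    rw [integral_law_categorical (ho a ha).1, integral_law_categorical (ho b hb).1,
      ← Finset.sum_sub_distrib]
    calc _ ≤ ∑ _k : Fin dY, ‖a - b‖ * C := by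
          refine (Finset.abs_sum_le_sum_abs _ _).trans (Finset.sum_le_sum fun k _ => ?_)
          rw [← sub_mul, abs_mul, abs_of_nonneg (h0 _)]
          exact mul_le_mul (PiLp.norm_apply_le (a - b) k) (hC _) (h0 _) (norm_nonneg _)
      _ = dY * C * ‖a - b‖ := by simp; ring
      _ ≤ _ := by gcongr; linarith [K.coe_nonneg]

/-- A categorical law has mean a. For additive noise, no moment or nonvanishing assumption is
needed: the characteristic function of ν is nonzero near 0, and there division leaves exp(i⟨a, t⟩) =
exp(i⟨b, t⟩). -/
theorem Proper.law_injOn (ho : o.Proper A) : Set.InjOn o.law A := by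
  intro a ha b hb hab
  cases o with
  | additive ν =>
    have : IsProbabilityMeasure ν := ho
    simp only [law] at hab
    rw [← Measure.dirac_conv, ← Measure.dirac_conv] at hab
    have h1 : ∀ t, charFun (Measure.dirac a) t * charFun ν t
        = charFun (Measure.dirac b) t * charFun ν t := fun t => by
      rw [← charFun_conv, ← charFun_conv, hab]
    by_contra hne
    have hd : 0 < ‖a - b‖ ^ 2 := by
      have := norm_pos_iff.2 (sub_ne_zero.2 hne); positivity
    have h2 : ∀ᶠ s : ℝ in 𝓝 0, charFun ν (s • (a - b)) ≠ 0 := by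
      have hc : ContinuousAt (fun s : ℝ => charFun ν (s • (a - b))) 0 :=
        (continuous_charFun.comp (by fun_prop : Continuous fun s : ℝ => s • (a - b))).continuousAt
      exact hc.eventually_ne (by simp)
    have h3 : ∀ᶠ s : ℝ in 𝓝 0, |s| * ‖a - b‖ ^ 2 < 1 := by
      have hc : ContinuousAt (fun s : ℝ => |s| * ‖a - b‖ ^ 2) 0 := by fun_prop
      exact hc.eventually_lt_const (by simp)
    -- Take t = s(a − b) with s > 0 so small that the phase difference s‖a − b‖² is below 1. It is a
    -- positive multiple of 2π if a ≠ b, a contradiction.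
    obtain ⟨s, ⟨hs2, hs3⟩, hs0⟩ := (((h2.and h3).filter_mono nhdsWithin_le_nhds).and
      (self_mem_nhdsWithin : Set.Ioi (0 : ℝ) ∈ 𝓝[>] 0)).exists
    have h4 := mul_right_cancel₀ hs2 (h1 (s • (a - b)))
    rw [charFun_dirac, charFun_dirac] at h4
    rw [Complex.exp_eq_exp_iff_exists_int] at h4
    obtain ⟨n, hn⟩ := h4
    have h5 : inner ℝ a (s • (a - b)) = inner ℝ b (s • (a - b)) + n * (2 * Real.pi) := by
      have : (inner ℝ a (s • (a - b)) : ℂ) * Complex.I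
          = (inner ℝ b (s • (a - b)) + n * (2 * Real.pi)) * Complex.I := by
        rw [hn]; ring
      exact_mod_cast mul_right_cancel₀ Complex.I_ne_zero this
    have h6 : s * ‖a - b‖ ^ 2 = n * (2 * Real.pi) := by
      rw [← real_inner_self_eq_norm_sq, ← real_inner_smul_right, inner_sub_left]
      linarith
    have hs0 : 0 < s := hs0
    rw [abs_of_pos hs0, h6] at hs3
    have h7 : (0 : ℝ) < n * (2 * Real.pi) := by rw [← h6]; positivity
    have h8 : (0 : ℝ) < n := by
      by_contra hn0
      have := mul_nonpos_of_nonpos_of_nonneg (not_lt.1 hn0) (by positivity : 0 ≤ 2 * Real.pi)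
      linarith
    have h9 : (1 : ℝ) ≤ n := by exact_mod_cast (by exact_mod_cast h8 : (0 : ℤ) < n)
    nlinarith [Real.pi_gt_three]
  | categorical =>
    ext k
    have h1 := integral_law_categorical (h := fun y => y k) (ho a ha).1
    have h2 := integral_law_categorical (h := fun y => y k) (ho b hb).1
    rw [hab, h2] at h1
    simpa [PiLp.single_apply] using h1.symm

theorem mean_additive {ν : Measure (Out dY)} [IsProbabilityMeasure ν]
    (hν : Integrable (fun w => w) ν) (l : Fin dY) (a : Out dY) :
    Integrable (fun y => y l) ((additive ν).law a) ∧
      ∫ y, y l ∂((additive ν).law a) = a l + (∫ w, w ∂ν) l ∧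
      ∫ y, |y l| ∂((additive ν).law a) ≤ |a l| + ∫ w, ‖w‖ ∂ν := by
  have hc : Continuous (fun y : Out dY => y l) :=
    (EuclideanSpace.proj l : Out dY →L[ℝ] ℝ).continuous
  have hl : Integrable (fun w : Out dY => w l) ν :=
    (EuclideanSpace.proj l : Out dY →L[ℝ] ℝ).integrable_comp hν
  refine ⟨?_, ?_, ?_⟩
  · rw [law, integrable_map_measure hc.aestronglyMeasurable (by fun_prop)]
    exact (integrable_const (a l)).add hl
  · rw [integral_law_additive ν hc]
    have e : ∀ w : Out dY, (a + w) l = a l + w l := fun w => rfl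
    simp_rw [e]
    rw [integral_add (integrable_const _) hl]
    have := (EuclideanSpace.proj l : Out dY →L[ℝ] ℝ).integral_comp_comm hν
    simp only [EuclideanSpace.coe_proj] at this
    simp [this]
  · rw [integral_law_additive ν hc.abs]
    have h1 : ∀ w : Out dY, |(a + w) l| ≤ |a l| + ‖w‖ := fun w =>
      (abs_add_le _ _).trans (add_le_add le_rfl (PiLp.norm_apply_le w l))
    refine (integral_mono_of_nonneg (ae_of_all _ fun w => abs_nonneg _)
      ((integrable_const (|a l|)).add hν.norm) (ae_of_all _ h1)).trans_eq ?_
    rw [integral_add' (integrable_const _) hν.norm]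
    simp

theorem mean_categorical (l : Fin dY) {a : Out dY} (ha : ∀ k, 0 ≤ a k) :
    Integrable (fun y => y l) ((categorical : OutputKind dY).law a) ∧
      ∫ y, y l ∂((categorical : OutputKind dY).law a) = a l ∧
      ∫ y, |y l| ∂((categorical : OutputKind dY).law a) ≤ |a l| := by
  refine ⟨?_, ?_, ?_⟩
  · simp only [law]
    refine integrable_finsetSum_measure.2 fun k _ => ?_
    exact (integrable_dirac (by simp)).smul_measure ENNReal.ofReal_ne_top
  · rw [integral_law_categorical ha]
    simp [PiLp.single_apply]
  · rw [integral_law_categorical ha]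
    refine le_of_eq ?_
    simp only [PiLp.single_apply, apply_ite abs]
    simp [abs_of_nonneg (ha l)]

/-- The mean of the output. -/
theorem SameMean.exists_mean {o o' : OutputKind dY} {A A' : Set (Out dY)} (h : o.SameMean o')
    (ho : o.Proper A) (ho' : o'.Proper A') : ∃ (c : Out dY) (K : ℝ), 0 ≤ K ∧ ∀ l,
      (∀ a ∈ A, Integrable (fun y => y l) (o.law a) ∧ ∫ y, y l ∂(o.law a) = a l + c l ∧
        ∫ y, |y l| ∂(o.law a) ≤ |a l| + K) ∧
      (∀ a ∈ A', Integrable (fun y => y l) (o'.law a) ∧ ∫ y, y l ∂(o'.law a) = a l + c l ∧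
        ∫ y, |y l| ∂(o'.law a) ≤ |a l| + K) := by
  cases o with
  | additive ν =>
    cases o' with
    | categorical => exact h.elim
    | additive ν' =>
      have : IsProbabilityMeasure ν := ho
      have : IsProbabilityMeasure ν' := ho'
      obtain ⟨h1, h2, h3⟩ := h
      have k1 : 0 ≤ ∫ w, ‖w‖ ∂ν := integral_nonneg fun _ => norm_nonneg _
      have k2 : 0 ≤ ∫ w, ‖w‖ ∂ν' := integral_nonneg fun _ => norm_nonneg _
      refine ⟨∫ w, w ∂ν, ∫ w, ‖w‖ ∂ν + ∫ w, ‖w‖ ∂ν', by positivity, fun l =>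
        ⟨fun a _ => ?_, fun a _ => ?_⟩⟩
      · obtain ⟨e1, e2, e3⟩ := mean_additive h1 l a
        exact ⟨e1, e2, by linarith⟩
      · obtain ⟨e1, e2, e3⟩ := mean_additive h2 l a
        exact ⟨e1, by rw [h3]; exact e2, by linarith⟩
  | categorical =>
    cases o' with
    | additive ν' => exact h.elim
    | categorical =>
      refine ⟨0, 0, le_rfl, fun l => ⟨fun a ha => ?_, fun a ha => ?_⟩⟩
      · simpa using mean_categorical l (ho a ha).1
      · simpa using mean_categorical l (ho' a ha).1

end OutputKind

/-- Weak convergence of probability measures, tested by nonnegative bounded Lipschitz functions. -/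
theorem tendsto_of_forall_nonneg_lipschitz {γ Ω : Type*} [MeasurableSpace Ω]
    [PseudoMetricSpace Ω] [OpensMeasurableSpace Ω] {F : Filter γ} [F.IsCountablyGenerated]
    {μs : γ → ProbabilityMeasure Ω} {μ : ProbabilityMeasure Ω}
    (H : ∀ (h : Ω → ℝ) (C : ℝ) (K : NNReal), (∀ x, 0 ≤ h x) → (∀ x, h x ≤ C) → LipschitzWith K h →
      Tendsto (fun i => ∫ x, h x ∂(μs i : Measure Ω)) F (𝓝 (∫ x, h x ∂(μ : Measure Ω)))) :
    Tendsto μs F (𝓝 μ) := by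
  rw [tendsto_iff_forall_lipschitz_integral_tendsto]
  rintro f ⟨C, hC⟩ ⟨L, hL⟩
  rcases isEmpty_or_nonempty Ω with he | ⟨⟨x₀⟩⟩
  · simpa [integral_of_isEmpty] using tendsto_const_nhds
  -- A function of oscillation at most C is shifted into [0, 2C]; against probability measures the
  -- shift contributes a constant.
  have h0 : ∀ x, 0 ≤ f x - f x₀ + C ∧ f x - f x₀ + C ≤ 2 * C := fun x => by
    have := abs_le.1 (by simpa [Real.dist_eq] using hC x x₀)
    constructor <;> linarith
  have hLip : LipschitzWith L (fun x => f x - f x₀ + C) := by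
    refine LipschitzWith.of_dist_le_mul fun x y => ?_
    have := hL.dist_le_mul x y
    rw [Real.dist_eq] at this ⊢
    convert this using 2
    ring
  have h1 := H _ _ L (fun x => (h0 x).1) (fun x => (h0 x).2) hLip
  have e : ∀ ν : ProbabilityMeasure Ω, ∫ x, f x ∂(ν : Measure Ω)
      = ∫ x, (f x - f x₀ + C) ∂(ν : Measure Ω) - (C - f x₀) := fun ν => by
    have hi : Integrable f (ν : Measure Ω) := by
      refine Integrable.of_bound (C := |f x₀| + |C|) hL.continuous.aestronglyMeasurable
        (ae_of_all _ fun x => ?_)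
      have h1 := abs_le.1 (by simpa [Real.dist_eq] using hC x x₀)
      rw [Real.norm_eq_abs, abs_le]
      have h3 := le_abs_self C
      have h5 := neg_abs_le (f x₀)
      have h6 := le_abs_self (f x₀)
      constructor <;> linarith
    have h2 : ∀ x, f x - f x₀ + C = f x + (C - f x₀) := fun x => by ring
    simp_rw [h2]
    rw [integral_add hi (integrable_const _)]
    simp
  simp_rw [e]
  exact h1.sub_const _

/-- The constant sequence μ converges weakly to ν, and weak limits are unique. -/
theorem eq_of_forall_nonneg_lipschitz {Ω : Type*} [MeasurableSpace Ω]
    [MetricSpace Ω] [BorelSpace Ω] {μ ν : Measure Ω} [IsProbabilityMeasure μ]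
    [IsProbabilityMeasure ν]
    (H : ∀ (h : Ω → ℝ) (C : ℝ) (K : NNReal), (∀ x, 0 ≤ h x) → (∀ x, h x ≤ C) → LipschitzWith K h →
      ∫ x, h x ∂μ = ∫ x, h x ∂ν) : μ = ν := by
  let μ' : ProbabilityMeasure Ω := ⟨μ, inferInstance⟩
  let ν' : ProbabilityMeasure Ω := ⟨ν, inferInstance⟩
  have : Tendsto (fun _ : ℕ => μ') atTop (𝓝 ν') := by
    refine tendsto_of_forall_nonneg_lipschitz fun h C K h0 hC hK => ?_
    simp only [μ', ν', ProbabilityMeasure.coe_mk, H h C K h0 hC hK]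
    exact tendsto_const_nhds
  exact congrArg Subtype.val (tendsto_nhds_unique tendsto_const_nhds this : μ' = ν')

end

/-! ### The data law as a convolution. -/

section

variable {dS dV dY : ℕ}

section Conv

variable {E : Type*} [NormedAddCommGroup E] [MeasurableSpace E] [BorelSpace E]
  [SecondCountableTopology E] (μ ρ : Measure E)

theorem measurable_lintegral_sub [SFinite μ] {k : E → ENNReal} (hk : Measurable k) :
    Measurable (fun x => ∫⁻ u, k (x - u) ∂μ) :=
  (hk.comp (measurable_fst.sub measurable_snd)).lintegral_prod_right'

/-- Tonelli and translation invariance: averaging over shifts by u is adjoint to averaging over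
shifts by −u. Besides computing densities, this later moves the noise average from the parameters to
the density. -/
theorem lintegral_mul_lintegral_add [SFinite μ] [SFinite ρ] [ρ.IsAddRightInvariant]
    {k g : E → ENNReal} (hk : Measurable k) (hg : Measurable g) :
    ∫⁻ x, k x * ∫⁻ u, g (x + u) ∂μ ∂ρ = ∫⁻ x, g x * ∫⁻ u, k (x - u) ∂μ ∂ρ := by
  calc _ = ∫⁻ x, ∫⁻ u, k x * g (x + u) ∂μ ∂ρ :=
        lintegral_congr fun x => (lintegral_const_mul _ (hg.comp (measurable_const_add x))).symm
    _ = ∫⁻ u, ∫⁻ x, k x * g (x + u) ∂ρ ∂μ :=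
        lintegral_lintegral_swap ((hk.comp measurable_fst).mul
          (hg.comp (measurable_fst.add measurable_snd))).aemeasurable
    _ = ∫⁻ u, ∫⁻ x, g x * k (x - u) ∂ρ ∂μ := by
        refine lintegral_congr fun u => ?_
        rw [← lintegral_add_right_eq_self (fun x => g x * k (x - u)) u]
        simp [mul_comm]
    _ = ∫⁻ x, ∫⁻ u, g x * k (x - u) ∂μ ∂ρ :=
        lintegral_lintegral_swap ((hg.comp measurable_snd).mul
          (hk.comp (measurable_snd.sub measurable_fst))).aemeasurable
    _ = _ :=
        lintegral_congr fun x => lintegral_const_mul _ (hk.comp (measurable_id.const_sub x))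

theorem conv_withDensity [SFinite μ] [SFinite ρ] [ρ.IsAddRightInvariant] {k : E → ENNReal}
    (hk : Measurable k) :
    (ρ.withDensity k).conv μ = ρ.withDensity (fun x => ∫⁻ u, k (x - u) ∂μ) := by
  ext A hA
  have hA' : Measurable (A.indicator (1 : E → ENNReal)) := measurable_one.indicator hA
  have hm : Measurable (fun x => ∫⁻ u, A.indicator (1 : E → ENNReal) (x + u) ∂μ) :=
    (hA'.comp (measurable_fst.add measurable_snd)).lintegral_prod_right'
  rw [← lintegral_indicator_one hA, Measure.lintegral_conv hA',
    lintegral_withDensity_eq_lintegral_mul _ hk hm, withDensity_apply _ hA,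
    ← lintegral_indicator hA]
  refine (lintegral_mul_lintegral_add μ ρ hk hA').trans (lintegral_congr fun x => ?_)
  by_cases hx : x ∈ A <;> simp [hx]

end Conv

/-- The law of the output, as a function of `f(s, v)`. -/
def Model.outLaw (M : Model dS dV dY) (x : Obs dS dV) : Measure (Out dY) := M.out.law (M.obsOut x)

namespace Model.Admissible

variable {M : Model dS dV dY}

theorem continuous_obsOut (hM : M.Admissible) : Continuous M.obsOut :=
  hM.g_diff.continuous.comp (continuous_sem.comp M.f.symm.continuous)

theorem obsOut_mem_range (x : Obs dS dV) : M.obsOut x ∈ Set.range M.g := ⟨_, rfl⟩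

theorem measurable_outLaw (hM : M.Admissible) : Measurable M.outLaw :=
  hM.out_valid.proper.measurable_law.comp hM.continuous_obsOut.measurable

theorem isProbabilityMeasure_outLaw (hM : M.Admissible) (x : Obs dS dV) :
    IsProbabilityMeasure (M.outLaw x) :=
  hM.out_valid.proper.isProbabilityMeasure (obsOut_mem_range x)

theorem continuous_dens (hM : M.Admissible) : Continuous M.dens := by
  have : M.dens = fun z => Real.exp (Real.log (M.dens z)) :=
    funext fun z => (Real.exp_log (hM.dens_pos z)).symm
  rw [this]
  exact Real.continuous_exp.comp hM.logdens_diff.continuous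

theorem continuous_obsDens (hM : M.Admissible) : Continuous M.obsDens := by
  have h1 : Continuous (fderiv ℝ M.f.symm) := hM.finv_diff2.continuous
  exact (hM.continuous_dens.comp M.f.symm.continuous).mul
    (ContinuousLinearMap.continuous_det.comp h1).abs

/-- The change of variables z = f⁻¹(x), whose Jacobian is built into `obsDens`. -/
theorem lintegral_prior (hM : M.Admissible) {k : Obs dS dV → ENNReal} (hk : Measurable k) :
    ∫⁻ z, k (M.f z) ∂M.prior = ∫⁻ x, ENNReal.ofReal (M.obsDens x) * k x := by
  have hd : Measurable (fun z => ENNReal.ofReal (M.dens z)) :=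
    ENNReal.measurable_ofReal.comp hM.continuous_dens.measurable
  have h0 := lintegral_withDensity_eq_lintegral_mul (volume : Measure (Latent dS dV)) hd
    (hk.comp M.f.continuous.measurable)
  refine h0.trans ?_
  have h := lintegral_image_eq_lintegral_abs_det_fderiv_mul (volume : Measure (Obs dS dV))
    MeasurableSet.univ (fun x _ => (hM.finv_diff x).hasFDerivAt.hasFDerivWithinAt)
    M.f.symm.injective.injOn
    ((fun z => ENNReal.ofReal (M.dens z)) * fun z => k (M.f z))
  rw [Set.image_univ, M.f.symm.surjective.range_eq, Measure.restrict_univ] at h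
  refine h.trans (lintegral_congr fun x => ?_)
  simp only [Pi.mul_apply, M.f.apply_symm_apply]
  rw [← mul_assoc, ← ENNReal.ofReal_mul (abs_nonneg _), mul_comm |_|]
  rfl

/-- The two mechanisms are Markov kernels in z, and so is their product; this makes the `bind` in
the data law computable. -/
theorem measurable_mech (hM : M.Admissible) (μ : Measure (Obs dS dV)) [IsProbabilityMeasure μ] :
    Measurable (fun z => ((M.toCSG μ).mechX z).prod ((M.toCSG μ).mechY (sem z))) := by
  have h1 : Measurable (M.toCSG μ).mechX :=
    (measurable_map_add μ).comp M.f.continuous.measurable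
  have h2 : Measurable (fun z : Latent dS dV => (M.toCSG μ).mechY (sem z)) :=
    hM.out_valid.proper.measurable_law.comp
      (hM.g_diff.continuous.comp continuous_sem).measurable
  let κ₁ : ProbabilityTheory.Kernel (Latent dS dV) (Obs dS dV) := ⟨_, h1⟩
  let κ₂ : ProbabilityTheory.Kernel (Latent dS dV) (Out dY) := ⟨_, h2⟩
  have : ProbabilityTheory.IsMarkovKernel κ₁ :=
    ⟨fun z => Measure.isProbabilityMeasure_map (by fun_prop)⟩
  have : ProbabilityTheory.IsMarkovKernel κ₂ :=
    ⟨fun z => hM.out_valid.proper.isProbabilityMeasure ⟨_, rfl⟩⟩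
  have e : (fun z => ((M.toCSG μ).mechX z).prod ((M.toCSG μ).mechY (sem z)))
      = (ProbabilityTheory.Kernel.prod κ₁ κ₂) :=
    funext fun z => (ProbabilityTheory.Kernel.prod_apply κ₁ κ₂ z).symm
  rw [e]
  exact (ProbabilityTheory.Kernel.prod κ₁ κ₂).measurable

theorem measurable_lintegral_outLaw (hM : M.Admissible) {h : Out dY → ENNReal} (hh : Measurable h) :
    Measurable (fun x => ∫⁻ y, h y ∂M.outLaw x) :=
  (Measure.measurable_lintegral hh).comp hM.measurable_outLaw

/-- The density of `h(y) p(dx, dy)`, integrated over `y`. -/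
theorem lintegral_dataLaw (hM : M.Admissible) (μ : Measure (Obs dS dV)) [IsProbabilityMeasure μ]
    {h : Out dY → ENNReal} (hh : Measurable h) {A : Set (Obs dS dV)} (hA : MeasurableSet A) :
    ∫⁻ p, A.indicator (1 : Obs dS dV → ENNReal) p.1 * h p.2 ∂(M.toCSG μ).dataLaw
      = ∫⁻ x in A, ∫⁻ u, ENNReal.ofReal (M.obsDens (x - u)) * ∫⁻ y, h y ∂M.outLaw (x - u) ∂μ := by
  have hA' : Measurable (A.indicator (1 : Obs dS dV → ENNReal)) := measurable_one.indicator hA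
  have hk : Measurable (fun p : Obs dS dV × Out dY => A.indicator (1 : Obs dS dV → ENNReal) p.1 * h p.2) :=
    (hA'.comp measurable_fst).mul (hh.comp measurable_snd)
  have hH := hM.measurable_lintegral_outLaw hh
  have hq : Measurable (fun x => ENNReal.ofReal (M.obsDens x)) :=
    ENNReal.measurable_ofReal.comp hM.continuous_obsDens.measurable
  have hqH := hq.mul hH
  rw [CSG.dataLaw, Measure.lintegral_bind (hM.measurable_mech μ).aemeasurable hk.aemeasurable]
  have e1 : ∀ z, ∫⁻ p, A.indicator (1 : Obs dS dV → ENNReal) p.1 * h p.2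
      ∂(((M.toCSG μ).mechX z).prod ((M.toCSG μ).mechY (sem z)))
      = (∫⁻ u, A.indicator (1 : Obs dS dV → ENNReal) (M.f z + u) ∂μ) * ∫⁻ y, h y ∂M.outLaw (M.f z) := fun z => by
    have : IsProbabilityMeasure ((M.toCSG μ).mechY (sem z)) :=
      hM.out_valid.proper.isProbabilityMeasure ⟨_, rfl⟩
    rw [lintegral_prod_mul hA'.aemeasurable hh.aemeasurable]
    congr 1
    · exact lintegral_map hA' (measurable_const_add _)
    · simp [outLaw, obsOut, toCSG]
  have hAu : Measurable (fun x => ∫⁻ u, A.indicator (1 : Obs dS dV → ENNReal) (x + u) ∂μ) :=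
    (hA'.comp (measurable_fst.add measurable_snd)).lintegral_prod_right'
  simp_rw [e1]
  have e2 := hM.lintegral_prior (k := fun x => (∫⁻ u, A.indicator (1 : Obs dS dV → ENNReal) (x + u) ∂μ) *
    ∫⁻ y, h y ∂M.outLaw x) (hAu.mul hH)
  refine e2.trans ?_
  have e3 := lintegral_mul_lintegral_add μ volume hqH hA'
  rw [← lintegral_indicator hA]
  refine Eq.trans (lintegral_congr fun x => ?_) (e3.trans (lintegral_congr fun x => ?_))
  · simp only [Pi.mul_apply]
    ring
  · by_cases hx : x ∈ A <;> simp [hx]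

end Model.Admissible

/-- Equal data laws have equal partial densities. -/
theorem ae_eq_of_dataLaw_eq {M M' : Model dS dV dY} (hM : M.Admissible) (hM' : M'.Admissible)
    {μ μ' : Measure (Obs dS dV)} [IsProbabilityMeasure μ] [IsProbabilityMeasure μ']
    (he : (M.toCSG μ).dataLaw = (M'.toCSG μ').dataLaw) {h : Out dY → ENNReal} (hh : Measurable h) :
    (fun x => ∫⁻ u, ENNReal.ofReal (M.obsDens (x - u)) * ∫⁻ y, h y ∂M.outLaw (x - u) ∂μ)
      =ᵐ[volume]
    fun x => ∫⁻ u, ENNReal.ofReal (M'.obsDens (x - u)) * ∫⁻ y, h y ∂M'.outLaw (x - u) ∂μ' := by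
  have hq : Measurable (fun x => ENNReal.ofReal (M.obsDens x) * ∫⁻ y, h y ∂M.outLaw x) :=
    (ENNReal.measurable_ofReal.comp hM.continuous_obsDens.measurable).mul
      (hM.measurable_lintegral_outLaw hh)
  have hq' : Measurable (fun x => ENNReal.ofReal (M'.obsDens x) * ∫⁻ y, h y ∂M'.outLaw x) :=
    (ENNReal.measurable_ofReal.comp hM'.continuous_obsDens.measurable).mul
      (hM'.measurable_lintegral_outLaw hh)
  refine ae_eq_of_forall_setLIntegral_eq_of_sigmaFinite (measurable_lintegral_sub μ hq)
    (measurable_lintegral_sub μ' hq') fun A hA _ => ?_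
  rw [← hM.lintegral_dataLaw μ hh hA, ← hM'.lintegral_dataLaw μ' hh hA, he]

end

/-! ### Exact identification by deconvolution. -/

section

variable {dS dV dY : ℕ}

theorem apply_reparam (M M' : Model dS dV dY) (z : Latent dS dV) :
    M'.f (reparam M M' z) = M.f z := by
  simp [reparam]

theorem mechX_reparam (M M' : Model dS dV dY) (μ : Measure (Obs dS dV)) (z : Latent dS dV) :
    (M'.toCSG μ).mechX (reparam M M' z) = (M.toCSG μ).mechX z := by
  simp only [Model.toCSG, apply_reparam]

theorem obsOut_apply (M : Model dS dV dY) (z : Latent dS dV) : M.obsOut (M.f z) = M.g (sem z) := by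
  simp [Model.obsOut]

theorem obsOut_reparam (M M' : Model dS dV dY) (z : Latent dS dV) :
    M'.obsOut (M.f z) = M'.g (sem (reparam M M' z)) := by
  rw [← apply_reparam M M', obsOut_apply]

/-- The integral of a function of the output. -/
def Model.outInt (M : Model dS dV dY) (h : Out dY → ℝ) (x : Obs dS dV) : ℝ := ∫ y, h y ∂M.outLaw x

namespace Model.Admissible

variable {M : Model dS dV dY}

theorem lintegral_obsDens (hM : M.Admissible) : ∫⁻ x, ENNReal.ofReal (M.obsDens x) = 1 := by
  have h := hM.lintegral_prior (k := 1) measurable_one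
  have := hM.prior_prob
  simpa using h.symm

theorem map_prior (hM : M.Admissible) :
    M.prior.map M.f = volume.withDensity (fun x => ENNReal.ofReal (M.obsDens x)) := by
  ext A hA
  have hA' : Measurable (A.indicator (1 : Obs dS dV → ENNReal)) := measurable_one.indicator hA
  rw [← lintegral_indicator_one hA, lintegral_map hA' M.f.continuous.measurable,
    hM.lintegral_prior hA', withDensity_apply _ hA, ← lintegral_indicator hA]
  refine lintegral_congr fun x => ?_
  by_cases hx : x ∈ A <;> simp [hx]

theorem map_prior_reparam {M' : Model dS dV dY} :
    M.prior.map (reparam M M') = (M.prior.map M.f).map M'.f.symm := by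
  rw [Measure.map_map M'.f.symm.continuous.measurable M.f.continuous.measurable]
  rfl

theorem map_map_prior : (M.prior.map M.f).map M.f.symm = M.prior := by
  rw [Measure.map_map M.f.symm.continuous.measurable M.f.continuous.measurable]
  simp

variable {h : Out dY → ℝ} {K : NNReal} {C : ℝ}

theorem abs_outInt_sub_le (hM : M.Admissible) (hK : LipschitzWith K h) (h0 : ∀ y, 0 ≤ h y)
    (hC : ∀ y, h y ≤ C) (x y : Obs dS dV) :
    |M.outInt h x - M.outInt h y| ≤ (K + dY * C) * ‖M.obsOut x - M.obsOut y‖ :=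
  hM.out_valid.proper.abs_integral_law_sub_le hK h0 hC (obsOut_mem_range x) (obsOut_mem_range y)

theorem continuous_outInt (hM : M.Admissible) (hK : LipschitzWith K h) (h0 : ∀ y, 0 ≤ h y)
    (hC : ∀ y, h y ≤ C) : Continuous (M.outInt h) := by
  refine continuous_iff_continuousAt.2 fun x => tendsto_iff_dist_tendsto_zero.2 ?_
  refine squeeze_zero (fun _ => dist_nonneg) (fun y => hM.abs_outInt_sub_le hK h0 hC y x) ?_
  have hc : Continuous (fun y => (K + dY * C) * ‖M.obsOut y - M.obsOut x‖) := by
    have := hM.continuous_obsOut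
    fun_prop
  simpa using hc.tendsto x

theorem integrable_outLaw (hM : M.Admissible) (hK : LipschitzWith K h) (h0 : ∀ y, 0 ≤ h y)
    (hC : ∀ y, h y ≤ C) (x : Obs dS dV) : Integrable h (M.outLaw x) := by
  have := hM.isProbabilityMeasure_outLaw x
  exact Integrable.of_bound (C := C) hK.continuous.aestronglyMeasurable
    (ae_of_all _ fun y => by rw [Real.norm_of_nonneg (h0 y)]; exact hC y)

theorem lintegral_outLaw (hM : M.Admissible) (hK : LipschitzWith K h) (h0 : ∀ y, 0 ≤ h y)
    (hC : ∀ y, h y ≤ C) (x : Obs dS dV) :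
    ∫⁻ y, ENNReal.ofReal (h y) ∂M.outLaw x = ENNReal.ofReal (M.outInt h x) :=
  (ofReal_integral_eq_lintegral_ofReal (hM.integrable_outLaw hK h0 hC x)
    (ae_of_all _ h0)).symm

theorem outInt_nonneg (h0 : ∀ y, 0 ≤ h y) (x : Obs dS dV) : 0 ≤ M.outInt h x :=
  integral_nonneg h0

theorem outInt_le (hM : M.Admissible) (hK : LipschitzWith K h) (h0 : ∀ y, 0 ≤ h y)
    (hC : ∀ y, h y ≤ C) (x : Obs dS dV) : M.outInt h x ≤ C := by
  have := hM.isProbabilityMeasure_outLaw x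
  have h1 := integral_mono (hM.integrable_outLaw hK h0 hC x) (integrable_const C) hC
  rw [integral_const, probReal_univ, one_smul] at h1
  exact h1

theorem outInt_one (hM : M.Admissible) (x : Obs dS dV) : M.outInt (fun _ => 1) x = 1 := by
  have := hM.isProbabilityMeasure_outLaw x
  simp [outInt]

end Model.Admissible

/-- Equal data laws: the partial densities tested by a function of the output. -/
theorem ae_eq_outInt_of_dataLaw_eq {M M' : Model dS dV dY} (hM : M.Admissible)
    (hM' : M'.Admissible) {μ μ' : Measure (Obs dS dV)} [IsProbabilityMeasure μ]
    [IsProbabilityMeasure μ'] (he : (M.toCSG μ).dataLaw = (M'.toCSG μ').dataLaw)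
    {h : Out dY → ℝ} {K : NNReal} {C : ℝ} (hK : LipschitzWith K h) (h0 : ∀ y, 0 ≤ h y)
    (hC : ∀ y, h y ≤ C) :
    (fun x => ∫⁻ u, ENNReal.ofReal (M.obsDens (x - u) * M.outInt h (x - u)) ∂μ) =ᵐ[volume]
    fun x => ∫⁻ u, ENNReal.ofReal (M'.obsDens (x - u) * M'.outInt h (x - u)) ∂μ' := by
  have h1 := ae_eq_of_dataLaw_eq hM hM' he (h := fun y => ENNReal.ofReal (h y))
    (ENNReal.measurable_ofReal.comp hK.continuous.measurable)
  simp_rw [hM.lintegral_outLaw hK h0 hC, hM'.lintegral_outLaw hK h0 hC] at h1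
  have e : ∀ N : Model dS dV dY, ∀ x, ENNReal.ofReal (N.obsDens x) * ENNReal.ofReal (N.outInt h x)
      = ENNReal.ofReal (N.obsDens x * N.outInt h x) := fun N x =>
    (ENNReal.ofReal_mul' (Model.Admissible.outInt_nonneg h0 x)).symm
  simpa only [e] using h1

/-- Deconvolution by a law whose characteristic function is a.e. nonzero. -/
theorem ae_eq_of_conv_ae_eq {E : Type*} [NormedAddCommGroup E] [InnerProductSpace ℝ E]
    [FiniteDimensional ℝ E] [MeasurableSpace E] [BorelSpace E] {μ : Measure E}
    [IsProbabilityMeasure μ] (hμ : ∀ᵐ t ∂(volume : Measure E), charFun μ t ≠ 0)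
    {k k' : E → ENNReal} (hk : Measurable k) (hk' : Measurable k') (hf : ∫⁻ x, k x ≠ ⊤)
    (hf' : ∫⁻ x, k' x ≠ ⊤)
    (he : (fun x => ∫⁻ u, k (x - u) ∂μ) =ᵐ[volume] fun x => ∫⁻ u, k' (x - u) ∂μ) :
    k =ᵐ[volume] k' := by
  have : IsFiniteMeasure (volume.withDensity k) := isFiniteMeasure_withDensity hf
  have : IsFiniteMeasure (volume.withDensity k') := isFiniteMeasure_withDensity hf'
  have h1 : ((volume : Measure E).withDensity k).conv μ = (volume.withDensity k').conv μ := by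
    rw [conv_withDensity μ volume hk, conv_withDensity μ volume hk', withDensity_congr_ae he]
  have h2 : charFun ((volume : Measure E).withDensity k) =ᵐ[volume]
      charFun (volume.withDensity k') := by
    filter_upwards [hμ] with t ht
    refine mul_right_cancel₀ ht ?_
    rw [← charFun_conv, ← charFun_conv, h1]
  -- Both characteristic functions are continuous, so the null set where that of μ vanishes is
  -- harmless.
  have h3 := (continuous_charFun.ae_eq_iff_eq volume continuous_charFun).1 h2
  exact (withDensity_eq_iff hk.aemeasurable hk'.aemeasurable hf).1 (Measure.ext_of_charFun h3)

/-- Deconvolve qH for each Lipschitz test function h. The finite mass of q makes characteristic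
functions available, continuity upgrades a.e. equality to equality, h = 1 isolates q, and division
by q > 0 leaves the output laws. -/
theorem exact_identification {M M' : Model dS dV dY} (hM : M.Admissible) (hM' : M'.Admissible)
    {B : Bounds} (hB : M.BoundedBy B) (hB' : M'.BoundedBy B)
    {μ : Measure (Obs dS dV)} [IsProbabilityMeasure μ]
    (hμ : ∀ᵐ t ∂(volume : Measure (Obs dS dV)), charFun μ t ≠ 0)
    (he : (M.toCSG μ).dataLaw = (M'.toCSG μ).dataLaw) :
    M.obsDens = M'.obsDens ∧ M.outLaw = M'.outLaw := by
  have key : ∀ (h : Out dY → ℝ) (C : ℝ) (K : NNReal), (∀ x, 0 ≤ h x) → (∀ x, h x ≤ C) →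
      LipschitzWith K h → ∀ x, M.obsDens x * M.outInt h x = M'.obsDens x * M'.outInt h x := by
    intro h C K h0 hC hK
    have hC0 : 0 ≤ C := (h0 0).trans (hC 0)
    have cont : ∀ N : Model dS dV dY, N.Admissible →
        Continuous (fun x => N.obsDens x * N.outInt h x) := fun N hN =>
      hN.continuous_obsDens.mul (hN.continuous_outInt hK h0 hC)
    have fin : ∀ N : Model dS dV dY, N.Admissible → N.BoundedBy B →
        ∫⁻ x, ENNReal.ofReal (N.obsDens x * N.outInt h x) ≠ ⊤ := fun N hN hNB => by
      refine ne_top_of_le_ne_top (ENNReal.ofReal_ne_top (r := C)) ?_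
      calc _ ≤ ∫⁻ x, ENNReal.ofReal (N.obsDens x) * ENNReal.ofReal C := by
            refine lintegral_mono fun x => ?_
            rw [← ENNReal.ofReal_mul' hC0]
            exact ENNReal.ofReal_le_ofReal (mul_le_mul_of_nonneg_left
              (hN.outInt_le hK h0 hC x) (hN.obsDens_pos hNB x).le)
        _ = _ := by
            have hm : Measurable (fun x => ENNReal.ofReal (N.obsDens x)) :=
              ENNReal.measurable_ofReal.comp hN.continuous_obsDens.measurable
            rw [lintegral_mul_const _ hm, hN.lintegral_obsDens, one_mul]
    have h1 := ae_eq_of_conv_ae_eq hμ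
      (ENNReal.measurable_ofReal.comp (cont M hM).measurable)
      (ENNReal.measurable_ofReal.comp (cont M' hM').measurable) (fin M hM hB) (fin M' hM' hB')
      (ae_eq_outInt_of_dataLaw_eq hM hM' he hK h0 hC)
    have h2 : (fun x => M.obsDens x * M.outInt h x) =ᵐ[volume]
        fun x => M'.obsDens x * M'.outInt h x := by
      filter_upwards [h1] with x hx
      exact (ENNReal.ofReal_eq_ofReal_iff
        (mul_nonneg (hM.obsDens_pos hB x).le (Model.Admissible.outInt_nonneg h0 x))
        (mul_nonneg (hM'.obsDens_pos hB' x).le (Model.Admissible.outInt_nonneg h0 x))).1 hx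
    exact congrFun (((cont M hM).ae_eq_iff_eq volume (cont M' hM')).1 h2)
  have hq : ∀ x, M.obsDens x = M'.obsDens x := fun x => by
    have := key (fun _ => 1) 1 0 (fun _ => zero_le_one) (fun _ => le_rfl)
      (LipschitzWith.const 1) x
    simpa [hM.outInt_one, hM'.outInt_one] using this
  refine ⟨funext hq, funext fun x => ?_⟩
  have := hM.isProbabilityMeasure_outLaw x
  have := hM'.isProbabilityMeasure_outLaw x
  refine eq_of_forall_nonneg_lipschitz fun h C K h0 hC hK => ?_
  have h1 := key h C K h0 hC hK x
  rw [hq x] at h1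
  exact mul_left_cancel₀ (hM'.obsDens_pos hB' x).ne' h1

/-- Φ sends z to the point with the same x, so equalities between functions of x turn into the four
conditions on Φ. -/
theorem isSemanticReparam_of_identification {M M' : Model dS dV dY} (hM : M.Admissible)
    (hM' : M'.Admissible) (μ : Measure (Obs dS dV)) (hq : M.obsDens = M'.obsDens)
    (hl : M.outLaw = M'.outLaw) :
    IsSemanticReparam (M.toCSG μ) (M'.toCSG μ) (reparam M M') := by
  have hlaw : ∀ z, M.out.law (M.g (sem z)) = M'.out.law (M'.g (sem (reparam M M' z))) := fun z => by
    have := congrFun hl (M.f z)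
    rwa [Model.outLaw, Model.outLaw, obsOut_apply, obsOut_reparam] at this
  refine ⟨fun z₁ z₂ h => hM'.g_inj ?_, ?_, fun z => (mechX_reparam M M' μ z).symm, hlaw⟩
  · refine hM'.out_valid.proper.law_injOn ⟨_, rfl⟩ ⟨_, rfl⟩ ?_
    rw [← hlaw, ← hlaw, h]
  · change M.prior.map _ = M'.prior
    rw [Model.Admissible.map_prior_reparam, hM.map_prior, hq, ← hM'.map_prior,
      Model.Admissible.map_map_prior]

end

/-! ### Second-order effect of a centred noise. -/

section

section Noise

set_option linter.unusedSectionVars false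

variable {E : Type*} [NormedAddCommGroup E] [NormedSpace ℝ E] [FiniteDimensional ℝ E]
  [MeasurableSpace E] [BorelSpace E]

/-- A centred noise law with second moment at most `σ2`. -/
structure CentredNoise (μ : Measure E) (σ2 : ℝ) : Prop where
  prob : IsProbabilityMeasure μ
  sq_int : Integrable (fun u => ‖u‖ ^ 2) μ
  mean : ∫ u, u ∂μ = 0
  sq_le : ∫ u, ‖u‖ ^ 2 ∂μ ≤ σ2

theorem integrable_norm_of_sq {μ : Measure E} [IsProbabilityMeasure μ]
    (h : Integrable (fun u => ‖u‖ ^ 2) μ) : Integrable (fun u => ‖u‖) μ :=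
  ((integrable_const (1 : ℝ)).add h).mono' continuous_norm.aestronglyMeasurable
    (ae_of_all _ fun u => by
      rw [norm_norm, Pi.add_apply]
      nlinarith [sq_nonneg (‖u‖ - 1), norm_nonneg u])

/-- The variance of ‖u‖ is nonnegative. -/
theorem integral_norm_le_sqrt {μ : Measure E} [IsProbabilityMeasure μ]
    (h : Integrable (fun u => ‖u‖ ^ 2) μ) {σ2 : ℝ} (hσ : ∫ u, ‖u‖ ^ 2 ∂μ ≤ σ2) :
    ∫ u, ‖u‖ ∂μ ≤ √σ2 := by
  have h1 := integrable_norm_of_sq h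
  refine Real.le_sqrt_of_sq_le ?_
  set m := ∫ u, ‖u‖ ∂μ
  have h2 : 0 ≤ ∫ u, (‖u‖ ^ 2 - 2 * m * ‖u‖ + m ^ 2) ∂μ :=
    integral_nonneg fun u => by
      have : ‖u‖ ^ 2 - 2 * m * ‖u‖ + m ^ 2 = (‖u‖ - m) ^ 2 := by ring
      rw [this]
      positivity
  have h3 : Integrable (fun u => ‖u‖ ^ 2 - 2 * m * ‖u‖) μ := h.sub (h1.const_mul (2 * m))
  rw [integral_add h3 (integrable_const _), integral_sub h (h1.const_mul (2 * m)), integral_const_mul] at h2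
  simp only [integral_const, probReal_univ, one_smul] at h2
  change 0 ≤ _ - 2 * m * m + m ^ 2 at h2
  linarith

variable {μ : Measure E} {σ2 : ℝ}

namespace CentredNoise

theorem integrable_id (hμ : CentredNoise μ σ2) : Integrable (fun u => u) μ := by
  have := hμ.prob
  exact (integrable_norm_iff continuous_id.aestronglyMeasurable).1 (integrable_norm_of_sq hμ.sq_int)

theorem integrable_norm (hμ : CentredNoise μ σ2) : Integrable (fun u => ‖u‖) μ :=
  hμ.integrable_id.norm

theorem integral_clm (hμ : CentredNoise μ σ2) (L : E →L[ℝ] ℝ) :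
    Integrable (fun u => L u) μ ∧ ∫ u, L u ∂μ = 0 :=
  ⟨L.integrable_comp hμ.integrable_id, by
    rw [L.integral_comp_comm hμ.integrable_id, hμ.mean, map_zero]⟩

/-- Averaging a function with a second-order expansion over a centred noise. -/
theorem abs_integral_sub_le (hμ : CentredNoise μ σ2) {F : E → ℝ} (hF : Continuous F) {b : ℝ}
    {L : E →L[ℝ] ℝ} {e : ℝ} (he : 0 ≤ e) (h : ∀ u, |F u - b - L u| ≤ e * ‖u‖ ^ 2) :
    Integrable F μ ∧ |∫ u, F u ∂μ - b| ≤ e * σ2 := by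
  have := hμ.prob
  obtain ⟨hL, hL0⟩ := hμ.integral_clm L
  have h1 : Integrable (fun u => F u - b - L u) μ :=
    (hμ.sq_int.const_mul e).mono' (by fun_prop) (ae_of_all _ h)
  have hF' : Integrable F μ := by
    have := (h1.add hL).add (integrable_const b)
    refine this.congr (ae_of_all _ fun u => ?_)
    simp
  refine ⟨hF', ?_⟩
  have h2 : ∫ u, F u ∂μ - b = ∫ u, (F u - b - L u) ∂μ := by
    have h3 : Integrable (fun u => F u - b) μ := hF'.sub (integrable_const b)
    rw [integral_sub h3 hL, integral_sub hF' (integrable_const b), hL0]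
    simp
  rw [h2, ← Real.norm_eq_abs]
  calc _ ≤ ∫ u, e * ‖u‖ ^ 2 ∂μ :=
        norm_integral_le_of_norm_le (hμ.sq_int.const_mul e) (ae_of_all _ h)
    _ = e * ∫ u, ‖u‖ ^ 2 ∂μ := integral_const_mul _ _
    _ ≤ _ := mul_le_mul_of_nonneg_left hμ.sq_le he

theorem sq_nonneg (hμ : CentredNoise μ σ2) : 0 ≤ σ2 :=
  (integral_nonneg fun _ => by positivity).trans hμ.sq_le

end CentredNoise

variable {q : E → ℝ} {Q a c s : ℝ}

namespace RegularDensity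

theorem nonneg (hq : RegularDensity q Q a c s) (x : E) : 0 ≤ q x := (hq.pos x).le

theorem sup_nonneg (hq : RegularDensity q Q a c s) : 0 ≤ Q := (hq.nonneg 0).trans (hq.le 0)

theorem integrable_sub (hq : RegularDensity q Q a c s) (μ : Measure E) [IsProbabilityMeasure μ]
    (x : E) : Integrable (fun u => q (x - u)) μ :=
  Integrable.of_bound (C := Q)
    (hq.diff.continuous.comp (continuous_const.sub continuous_id)).aestronglyMeasurable
    (ae_of_all _ fun u => by rw [Real.norm_of_nonneg (hq.nonneg _)]; exact hq.le _)

theorem abs_sub_le (hq : RegularDensity q Q a c s) (ha : 0 ≤ a) (x y : E) :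
    |q x - q y| ≤ a * Q * ‖x - y‖ := by
  have hb : ∀ z, ‖fderiv ℝ q z‖ ≤ a * Q := fun z => by
    refine ContinuousLinearMap.opNorm_le_bound _ (mul_nonneg ha hq.sup_nonneg) fun u => ?_
    refine (hq.grad z u).trans ?_
    calc _ ≤ a * ‖u‖ * Q := by gcongr; exact hq.le z
      _ = _ := by ring
  exact convex_univ.norm_image_sub_le_of_norm_fderiv_le (fun z _ => hq.diff z)
    (fun z _ => hb z) (Set.mem_univ y) (Set.mem_univ x)

theorem abs_conv_sub_le (hq : RegularDensity q Q a c s) (hs : 0 ≤ s) (hμ : CentredNoise μ σ2)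
    (x : E) : |∫ u, q (x - u) ∂μ - q x| ≤ s / 2 * σ2 :=
  (hμ.abs_integral_sub_le (hq.diff.continuous.comp (continuous_const.sub continuous_id))
    (L := -fderiv ℝ q x) (by positivity) fun u => by
      have := hq.taylor x (-u)
      rw [norm_neg] at this
      convert this using 2
      simp [sub_eq_add_neg]).2

/-- Jensen: the average of q is at least the exponential of the average of log q, and the latter
differs from log q(x) by at most cσ²/2, the noise being centred. The lower bound is thus relative to
q(x), which an additive error would not give. -/
theorem mul_exp_le_conv (hq : RegularDensity q Q a c s) (hc : 0 ≤ c) (hμ : CentredNoise μ σ2)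
    (x : E) : q x * Real.exp (-(c / 2 * σ2)) ≤ ∫ u, q (x - u) ∂μ := by
  have := hμ.prob
  have hlog : Continuous (fun x => Real.log (q x)) :=
    hq.diff.continuous.log fun x => (hq.pos x).ne'
  obtain ⟨h1, h2⟩ := hμ.abs_integral_sub_le (F := fun u => Real.log (q (x - u)))
    (hlog.comp (continuous_const.sub continuous_id)) (b := Real.log (q x))
    (L := -fderiv ℝ (fun x => Real.log (q x)) x) (e := c / 2) (by positivity) fun u => by
      have := hq.log_taylor x (-u)
      rw [norm_neg] at this
      convert this using 2
      simp [sub_eq_add_neg]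
  have h3 : ∀ u, Real.exp (Real.log (q (x - u))) = q (x - u) := fun u => Real.exp_log (hq.pos _)
  have h4 := convexOn_exp.map_integral_le (μ := μ) (f := fun u => Real.log (q (x - u)))
    Real.continuous_exp.continuousOn isClosed_univ (ae_of_all _ fun _ => Set.mem_univ _) h1
    (by simpa only [Function.comp_def, h3] using hq.integrable_sub μ x)
  simp only [h3] at h4
  refine le_trans ?_ h4
  calc _ = Real.exp (Real.log (q x) + -(c / 2 * σ2)) := by
        rw [Real.exp_add, Real.exp_log (hq.pos x)]
    _ ≤ _ := Real.exp_le_exp.2 (by linarith [(abs_le.1 h2).1])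

variable {ρ : Measure E} [ρ.IsAddHaarMeasure]

/-- Integrate the derivative along the segment from x to x + w and swap the integrals. Since |Dq w|
≤ a‖w‖q and q has mass one, no factor `Q` appears, unlike in the pointwise estimate. -/
theorem lintegral_abs_sub_le (hq : RegularDensity q Q a c s) (ha : 0 ≤ a)
    (h1 : ∫⁻ x, ENNReal.ofReal (q x) ∂ρ = 1) (w : E) :
    ∫⁻ x, ENNReal.ofReal |q (x + w) - q x| ∂ρ ≤ ENNReal.ofReal (a * ‖w‖) := by
  have hqm : Measurable (fun x => ENNReal.ofReal (q x)) :=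
    ENNReal.measurable_ofReal.comp hq.diff.continuous.measurable
  have hp : ∀ x, ENNReal.ofReal |q (x + w) - q x|
      ≤ ∫⁻ t in Set.Ioc (0 : ℝ) 1, ENNReal.ofReal (a * ‖w‖) * ENNReal.ofReal (q (x + t • w)) := by
    intro x
    have hd : ∀ t ∈ Set.uIcc (0 : ℝ) 1,
        HasDerivAt (fun t : ℝ => q (x + t • w)) (fderiv ℝ q (x + t • w) w) t := fun t _ => by
      have hline : HasDerivAt (fun t : ℝ => x + t • w) w t := by
        simpa using ((hasDerivAt_id t).smul_const w).const_add x
      exact HasFDerivAt.comp_hasDerivAt t (hq.diff (x + t • w)).hasFDerivAt hline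
    have hc : Continuous (fun t : ℝ => fderiv ℝ q (x + t • w) w) :=
      (hq.cont_fderiv.comp (by fun_prop : Continuous fun t : ℝ => x + t • w)).clm_apply
        continuous_const
    have h2 := intervalIntegral.integral_eq_sub_of_hasDerivAt hd (hc.intervalIntegrable 0 1)
    simp only [one_smul, zero_smul, add_zero] at h2
    rw [← h2, intervalIntegral.integral_of_le zero_le_one, ← Real.enorm_eq_ofReal_abs]
    refine (enorm_integral_le_lintegral_enorm _).trans (lintegral_mono fun t => ?_)
    rw [← ENNReal.ofReal_mul (by positivity), Real.enorm_eq_ofReal_abs]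
    exact ENNReal.ofReal_le_ofReal (hq.grad _ _)
  have hm2 : Measurable (fun p : E × ℝ => ENNReal.ofReal (q (p.1 + p.2 • w))) :=
    hqm.comp (by fun_prop : Continuous fun p : E × ℝ => p.1 + p.2 • w).measurable
  calc _ ≤ ∫⁻ x, (∫⁻ t in Set.Ioc (0 : ℝ) 1,
          ENNReal.ofReal (a * ‖w‖) * ENNReal.ofReal (q (x + t • w))) ∂ρ := lintegral_mono hp
    _ = ∫⁻ t in Set.Ioc (0 : ℝ) 1, (∫⁻ x,
          ENNReal.ofReal (a * ‖w‖) * ENNReal.ofReal (q (x + t • w)) ∂ρ) :=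
        lintegral_lintegral_swap (hm2.const_mul _).aemeasurable
    _ = ∫⁻ _t in Set.Ioc (0 : ℝ) 1, ENNReal.ofReal (a * ‖w‖) := by
        refine lintegral_congr fun t => ?_
        have hm : Measurable (fun x => ENNReal.ofReal (q (x + t • w))) :=
          hqm.comp (measurable_add_const (t • w))
        rw [lintegral_const_mul _ hm, lintegral_add_right_eq_self (fun x => ENNReal.ofReal (q x)), h1, mul_one]
    _ = _ := by simp

end RegularDensity

variable {G : E → ℝ} {g₁ g₂ : ℝ}

namespace SmoothBounded

theorem abs_sub_le (hG : SmoothBounded G g₁ g₂) (hg : 0 ≤ g₁) (x y : E) :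
    |G x - G y| ≤ g₁ * ‖x - y‖ :=
  convex_univ.norm_image_sub_le_of_norm_fderiv_le (fun z _ => hG.diff z)
    (fun z _ => ContinuousLinearMap.opNorm_le_bound _ hg (hG.grad z)) (Set.mem_univ y)
    (Set.mem_univ x)

theorem integrable_sub (hG : SmoothBounded G g₁ g₂) (hg : 0 ≤ g₁) (hμ : CentredNoise μ σ2) (x : E) :
    Integrable (fun u => G (x - u)) μ := by
  have := hμ.prob
  refine ((integrable_const |G x|).add (hμ.integrable_norm.const_mul g₁)).mono'
    (hG.diff.continuous.comp (continuous_const.sub continuous_id)).aestronglyMeasurable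
    (ae_of_all _ fun u => ?_)
  have h1 := hG.abs_sub_le hg (x - u) x
  rw [sub_sub_cancel_left, norm_neg] at h1
  rw [Real.norm_eq_abs, Pi.add_apply]
  have := abs_sub_abs_le_abs_sub (G (x - u)) (G x)
  linarith

end SmoothBounded

/-- The commutator of a convolution with the multiplication by a smooth function. -/
theorem abs_conv_mul_sub_le (hq : RegularDensity q Q a c s) (ha : 0 ≤ a)
    (hG : SmoothBounded G g₁ g₂) (hg₁ : 0 ≤ g₁) (hg₂ : 0 ≤ g₂) (hμ : CentredNoise μ σ2) (x : E) :
    Integrable (fun u => g₂ / 2 * ‖u‖ ^ 2 * q (x - u) + g₁ * ‖u‖ * |q (x - u) - q x|) μ ∧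
    |∫ u, q (x - u) * G (x - u) ∂μ - G x * ∫ u, q (x - u) ∂μ|
      ≤ ∫ u, (g₂ / 2 * ‖u‖ ^ 2 * q (x - u) + g₁ * ‖u‖ * |q (x - u) - q x|) ∂μ := by
  have := hμ.prob
  have cq : Continuous (fun u => q (x - u)) :=
    hq.diff.continuous.comp (continuous_const.sub continuous_id)
  have cG : Continuous (fun u => G (x - u)) :=
    hG.diff.continuous.comp (continuous_const.sub continuous_id)
  have hQ := hq.sup_nonneg
  have i1 : Integrable (fun u => g₂ / 2 * ‖u‖ ^ 2 * q (x - u) + g₁ * ‖u‖ * |q (x - u) - q x|) μ := by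
    have hc : Continuous (fun u => g₂ / 2 * ‖u‖ ^ 2 * q (x - u)
        + g₁ * ‖u‖ * |q (x - u) - q x|) :=
      ((continuous_const.mul (continuous_norm.pow 2)).mul cq).add
        ((continuous_const.mul continuous_norm).mul (cq.sub continuous_const).abs)
    refine (hμ.sq_int.const_mul (g₂ / 2 * Q + g₁ * (a * Q))).mono' hc.aestronglyMeasurable
      (ae_of_all _ fun u => ?_)
    have h1 := hq.abs_sub_le ha (x - u) x
    rw [sub_sub_cancel_left, norm_neg] at h1
    have h2 := hq.le (x - u)
    have h3 := hq.nonneg (x - u)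
    rw [Real.norm_of_nonneg (by positivity)]
    calc _ ≤ g₂ / 2 * ‖u‖ ^ 2 * Q + g₁ * ‖u‖ * (a * Q * ‖u‖) := by gcongr
      _ = _ := by ring
  refine ⟨i1, ?_⟩
  have iq := hq.integrable_sub μ x
  have iG := hG.integrable_sub hg₁ hμ x
  have iqG : Integrable (fun u => q (x - u) * G (x - u)) μ := by
    refine (iG.norm.const_mul Q).mono' (cq.mul cG).aestronglyMeasurable (ae_of_all _ fun u => ?_)
    rw [norm_mul, Real.norm_of_nonneg (hq.nonneg _)]
    exact mul_le_mul_of_nonneg_right (hq.le _) (norm_nonneg _)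
  obtain ⟨iL, hL0⟩ := hμ.integral_clm (fderiv ℝ G x)
  -- The term q(x) DG(x)u has mean zero and is inserted to cancel the first-order part. What remains
  -- is q(x − u) times the Taylor remainder of G, minus (q(x − u) − q(x)) DG(x)u, and both are of
  -- second order.
  have e : ∫ u, q (x - u) * G (x - u) ∂μ - G x * ∫ u, q (x - u) ∂μ
      = ∫ u, (q (x - u) * G (x - u) - G x * q (x - u) + q x * fderiv ℝ G x u) ∂μ := by
    have i2 : Integrable (fun u => q (x - u) * G (x - u) - G x * q (x - u)) μ :=
      iqG.sub (iq.const_mul _)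
    rw [integral_add i2 (iL.const_mul _), integral_sub iqG (iq.const_mul _), integral_const_mul, integral_const_mul, hL0]
    ring
  rw [e, ← Real.norm_eq_abs]
  refine norm_integral_le_of_norm_le i1 (ae_of_all _ fun u => ?_)
  have e2 : q (x - u) * G (x - u) - G x * q (x - u) + q x * fderiv ℝ G x u
      = q (x - u) * (G (x - u) - G x + fderiv ℝ G x u)
        - (q (x - u) - q x) * fderiv ℝ G x u := by ring
  have h1 : |G (x - u) - G x + fderiv ℝ G x u| ≤ g₂ / 2 * ‖u‖ ^ 2 := by
    have := hG.taylor x (-u)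
    rw [norm_neg, map_neg, sub_neg_eq_add] at this
    rwa [sub_eq_add_neg x u]
  rw [e2, Real.norm_eq_abs]
  refine (abs_sub _ _).trans ?_
  rw [abs_mul, abs_mul, abs_of_nonneg (hq.nonneg (x - u))]
  have h2 := hG.grad x u
  have h3 := mul_le_mul_of_nonneg_left h1 (hq.nonneg (x - u))
  have h4 := mul_le_mul_of_nonneg_left h2 (abs_nonneg (q (x - u) - q x))
  linarith

theorem abs_conv_mul_sub_le_sup (hq : RegularDensity q Q a c s) (ha : 0 ≤ a)
    (hG : SmoothBounded G g₁ g₂) (hg₁ : 0 ≤ g₁) (hg₂ : 0 ≤ g₂) (hμ : CentredNoise μ σ2) (x : E) :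
    |∫ u, q (x - u) * G (x - u) ∂μ - G x * ∫ u, q (x - u) ∂μ| ≤ Q * ((a * g₁ + g₂ / 2) * σ2) := by
  obtain ⟨h1, h2⟩ := abs_conv_mul_sub_le hq ha hG hg₁ hg₂ hμ x
  have hQ := hq.sup_nonneg
  refine h2.trans ?_
  calc _ ≤ ∫ u, Q * (a * g₁ + g₂ / 2) * ‖u‖ ^ 2 ∂μ := by
        refine integral_mono h1 (hμ.sq_int.const_mul _) fun u => ?_
        have h3 := hq.abs_sub_le ha (x - u) x
        rw [sub_sub_cancel_left, norm_neg] at h3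
        have h4 := hq.le (x - u)
        dsimp only
        calc _ ≤ g₂ / 2 * ‖u‖ ^ 2 * Q + g₁ * ‖u‖ * (a * Q * ‖u‖) := by gcongr
          _ = _ := by ring
    _ = Q * (a * g₁ + g₂ / 2) * ∫ u, ‖u‖ ^ 2 ∂μ := integral_const_mul _ _
    _ ≤ Q * (a * g₁ + g₂ / 2) * σ2 := mul_le_mul_of_nonneg_left hμ.sq_le (by positivity)
    _ = _ := by ring

/-- The pointwise commutator bound is integrated in x first: q has mass one and its L¹-modulus is
a‖u‖, so the sup bound `Q` disappears. -/
theorem lintegral_conv_mul_sub_le {ρ : Measure E} [ρ.IsAddHaarMeasure]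
    (hq : RegularDensity q Q a c s) (ha : 0 ≤ a) (h1 : ∫⁻ x, ENNReal.ofReal (q x) ∂ρ = 1)
    (hG : SmoothBounded G g₁ g₂) (hg₁ : 0 ≤ g₁) (hg₂ : 0 ≤ g₂) (hμ : CentredNoise μ σ2) :
    ∫⁻ x, ENNReal.ofReal |∫ u, q (x - u) * G (x - u) ∂μ - G x * ∫ u, q (x - u) ∂μ| ∂ρ
      ≤ ENNReal.ofReal ((a * g₁ + g₂ / 2) * σ2) := by
  have := hμ.prob
  have cq := hq.diff.continuous
  have hm : Continuous (fun p : E × E => g₂ / 2 * ‖p.2‖ ^ 2 * q (p.1 - p.2)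
      + g₁ * ‖p.2‖ * |q (p.1 - p.2) - q p.1|) := by fun_prop
  have m1 : ∀ u, Measurable (fun x => ENNReal.ofReal (q (x - u))) := fun u =>
    ENNReal.measurable_ofReal.comp (cq.comp (continuous_id.sub continuous_const)).measurable
  have m2 : ∀ u, Measurable (fun x => ENNReal.ofReal |q (x - u) - q x|) := fun u =>
    ENNReal.measurable_ofReal.comp
      ((cq.comp (continuous_id.sub continuous_const)).sub cq).abs.measurable
  calc _ ≤ ∫⁻ x, ∫⁻ u, ENNReal.ofReal (g₂ / 2 * ‖u‖ ^ 2 * q (x - u)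
          + g₁ * ‖u‖ * |q (x - u) - q x|) ∂μ ∂ρ := by
        refine lintegral_mono fun x => ?_
        obtain ⟨e1, e2⟩ := abs_conv_mul_sub_le hq ha hG hg₁ hg₂ hμ x
        rw [← ofReal_integral_eq_lintegral_ofReal e1 (ae_of_all _ fun u => by
          have := hq.nonneg (x - u)
          positivity)]
        exact ENNReal.ofReal_le_ofReal e2
    _ = ∫⁻ u, ∫⁻ x, ENNReal.ofReal (g₂ / 2 * ‖u‖ ^ 2 * q (x - u)
          + g₁ * ‖u‖ * |q (x - u) - q x|) ∂ρ ∂μ :=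
        lintegral_lintegral_swap (ENNReal.measurable_ofReal.comp hm.measurable).aemeasurable
    _ ≤ ∫⁻ u, ENNReal.ofReal ((a * g₁ + g₂ / 2) * ‖u‖ ^ 2) ∂μ := by
        refine lintegral_mono fun u => ?_
        have e : ∀ x, ENNReal.ofReal (g₂ / 2 * ‖u‖ ^ 2 * q (x - u)
          + g₁ * ‖u‖ * |q (x - u) - q x|) = ENNReal.ofReal (g₂ / 2 * ‖u‖ ^ 2)
            * ENNReal.ofReal (q (x - u))
            + ENNReal.ofReal (g₁ * ‖u‖) * ENNReal.ofReal |q (x - u) - q x| := fun x => by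
          have := hq.nonneg (x - u)
          rw [ENNReal.ofReal_add (by positivity) (by positivity),
            ← ENNReal.ofReal_mul (by positivity), ← ENNReal.ofReal_mul (by positivity)]
        simp_rw [e]
        rw [lintegral_add_left ((m1 u).const_mul _), lintegral_const_mul _ (m1 u),
          lintegral_const_mul _ (m2 u), lintegral_sub_right_eq_self (fun x => ENNReal.ofReal (q x)),
          h1, mul_one]
        have h3 := hq.lintegral_abs_sub_le ha h1 (-u)
        simp only [← sub_eq_add_neg, norm_neg] at h3
        calc _ ≤ ENNReal.ofReal (g₂ / 2 * ‖u‖ ^ 2)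
              + ENNReal.ofReal (g₁ * ‖u‖) * ENNReal.ofReal (a * ‖u‖) := by gcongr
          _ = _ := by
            rw [← ENNReal.ofReal_mul (by positivity),
              ← ENNReal.ofReal_add (by positivity) (by positivity)]
            congr 1
            ring
    _ = ENNReal.ofReal (∫ u, (a * g₁ + g₂ / 2) * ‖u‖ ^ 2 ∂μ) :=
        (ofReal_integral_eq_lintegral_ofReal (hμ.sq_int.const_mul _)
          (ae_of_all _ fun u => by positivity)).symm
    _ ≤ _ := by
        rw [integral_const_mul]
        exact ENNReal.ofReal_le_ofReal (mul_le_mul_of_nonneg_left hμ.sq_le (by positivity))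

end Noise

end

/-! ### Centring the noises and comparing two densities and parameters. -/

section

/-- Both sides are translated by the same m. Since the two noises have equal means, a single m will
centre them both without spoiling the identity. -/
theorem ae_eq_conv_centred {E : Type*} [NormedAddCommGroup E] [NormedSpace ℝ E]
    [FiniteDimensional ℝ E] [MeasurableSpace E] [BorelSpace E] {μ μ' ρ : Measure E}
    [ρ.IsAddHaarMeasure] {k k' : E → ENNReal}
    (hk : Measurable k) (hk' : Measurable k') (m : E)
    (h : (fun x => ∫⁻ u, k (x - u) ∂μ) =ᵐ[ρ] fun x => ∫⁻ u, k' (x - u) ∂μ') :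
    (fun x => ∫⁻ u, k (x - u) ∂(μ.map (fun u => u - m)))
      =ᵐ[ρ] fun x => ∫⁻ u, k' (x - u) ∂(μ'.map (fun u => u - m)) := by
  have h1 := (measurePreserving_add_right ρ m).quasiMeasurePreserving.ae h
  filter_upwards [h1] with x hx
  have e : ∀ u, x - (u - m) = x + m - u := fun u => by abel
  have hm : Measurable (fun u : E => u - m) := measurable_id.sub_const m
  have hkx : Measurable (fun u => k (x - u)) := hk.comp (measurable_id.const_sub x)
  have hkx' : Measurable (fun u => k' (x - u)) := hk'.comp (measurable_id.const_sub x)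
  rw [lintegral_map hkx hm, lintegral_map hkx' hm]
  simpa only [e] using hx

/-- Centring subtracts ‖m‖² from the second moment, so the bound `σ2` persists. -/
theorem centredNoise_map {E : Type*} [NormedAddCommGroup E] [InnerProductSpace ℝ E]
    [FiniteDimensional ℝ E] [MeasurableSpace E] [BorelSpace E] {μ : Measure E}
    [IsProbabilityMeasure μ] (h : Integrable (fun u => ‖u‖ ^ 2) μ) {σ2 : ℝ}
    (hσ : ∫ u, ‖u‖ ^ 2 ∂μ ≤ σ2) :
    CentredNoise (μ.map (fun u => u - ∫ w, w ∂μ)) σ2 := by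
  set m := ∫ w, w ∂μ with hm
  have hi : Integrable (fun u => u) μ :=
    (integrable_norm_iff continuous_id.aestronglyMeasurable).1 (integrable_norm_of_sq h)
  have hmeas : Measurable (fun u : E => u - m) := measurable_id.sub_const m
  have e : ∀ u, ‖u - m‖ ^ 2 = ‖u‖ ^ 2 - 2 * inner ℝ m u + ‖m‖ ^ 2 := fun u => by
    rw [norm_sub_sq_real, real_inner_comm]
  have hin : Integrable (fun u => 2 * inner ℝ m u) μ := (hi.const_inner m).const_mul 2
  have hs : Integrable (fun u => ‖u‖ ^ 2 - 2 * inner ℝ m u) μ := h.sub hin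
  have hsq : Continuous (fun u : E => ‖u‖ ^ 2) := by fun_prop
  refine ⟨Measure.isProbabilityMeasure_map hmeas.aemeasurable, ?_, ?_, ?_⟩
  · rw [integrable_map_measure hsq.aestronglyMeasurable hmeas.aemeasurable]
    simp only [Function.comp_def, e]
    exact hs.add (integrable_const _)
  · have hid : AEStronglyMeasurable (fun u : E => u) (μ.map (fun u => u - m)) :=
      continuous_id.aestronglyMeasurable
    rw [integral_map hmeas.aemeasurable hid, integral_sub hi (integrable_const m)]
    simp [hm]
  · rw [integral_map hmeas.aemeasurable hsq.aestronglyMeasurable]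
    simp only [e]
    rw [integral_add hs (integrable_const _), integral_sub h hin, integral_const_mul,
      integral_inner hi]
    simp only [integral_const, probReal_univ, one_smul, ← hm, real_inner_self_eq_norm_sq]
    nlinarith [sq_nonneg ‖m‖]

theorem forall_le_of_ae_le {E : Type*} [TopologicalSpace E] [MeasurableSpace E] {ρ : Measure E}
    [ρ.IsOpenPosMeasure] {F : E → ℝ} (hF : Continuous F) {C : ℝ} (h : ∀ᵐ x ∂ρ, F x ≤ C) (x : E) :
    F x ≤ C := by
  have h1 : Dense {x | F x ≤ C} := Measure.dense_of_ae h
  have h2 : IsClosed {x | F x ≤ C} := isClosed_le hF continuous_const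
  have h3 := h1 x
  rw [h2.closure_eq] at h3
  exact h3

section Near

variable {E : Type*} [NormedAddCommGroup E] [NormedSpace ℝ E] [FiniteDimensional ℝ E]
  [MeasurableSpace E] [BorelSpace E] {μ μ' ρ : Measure E} [ρ.IsAddHaarMeasure] {σ2 : ℝ}
  {q q' G G' : E → ℝ} {Q a c s g₁ g₂ : ℝ}

/-- Each density is within sσ²/2 of its convolution, and the convolutions agree. -/
theorem RegularDensity.abs_sub_le_of_conv_ae_eq (hq : RegularDensity q Q a c s)
    (hq' : RegularDensity q' Q a c s) (hs : 0 ≤ s) (hμ : CentredNoise μ σ2)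
    (hμ' : CentredNoise μ' σ2)
    (h : ∀ᵐ x ∂ρ, ∫ u, q (x - u) ∂μ = ∫ u, q' (x - u) ∂μ') (x : E) : |q x - q' x| ≤ s * σ2 := by
  have hF : Continuous (fun x => |q x - q' x|) :=
    (hq.diff.continuous.sub hq'.diff.continuous).abs
  refine forall_le_of_ae_le (ρ := ρ) hF ?_ x
  filter_upwards [h] with x hx
  have h1 := abs_le.1 (hq.abs_conv_sub_le hs hμ x)
  have h2 := abs_le.1 (hq'.abs_conv_sub_le hs hμ' x)
  rw [hx] at h1
  rw [abs_le]
  constructor <;> linarith [h1.1, h1.2, h2.1, h2.2]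

/-- With μ ∗ q = μ' ∗ q' and μ ∗ (qG) = μ' ∗ (q'G'), the product (μ ∗ q)(G − G') is a difference of
the two commutators. -/
theorem conv_mul_abs_sub_le (hq : RegularDensity q Q a c s) {x : E}
    (h1 : ∫ u, q (x - u) ∂μ = ∫ u, q' (x - u) ∂μ')
    (h2 : ∫ u, q (x - u) * G (x - u) ∂μ = ∫ u, q' (x - u) * G' (x - u) ∂μ') :
    (∫ u, q (x - u) ∂μ) * |G x - G' x|
      ≤ |∫ u, q (x - u) * G (x - u) ∂μ - G x * ∫ u, q (x - u) ∂μ|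
        + |∫ u, q' (x - u) * G' (x - u) ∂μ' - G' x * ∫ u, q' (x - u) ∂μ'| := by
  have h0 : 0 ≤ ∫ u, q (x - u) ∂μ := integral_nonneg fun u => hq.nonneg _
  rw [← h1, ← h2]
  calc _ = |(∫ u, q (x - u) ∂μ) * (G x - G' x)| := by rw [abs_mul, abs_of_nonneg h0]
    _ = |(∫ u, q (x - u) * G (x - u) ∂μ - G' x * ∫ u, q (x - u) ∂μ)
          - (∫ u, q (x - u) * G (x - u) ∂μ - G x * ∫ u, q (x - u) ∂μ)| := by congr 1; ring
    _ ≤ _ := (abs_sub _ _).trans_eq (add_comm _ _)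

/-- The sup bounds of the commutators control (μ ∗ q)|G − G'|; the Jensen lower bound replaces μ ∗ q
by q at the price of the exponential. -/
theorem mul_abs_sub_le_of_conv_ae_eq (hq : RegularDensity q Q a c s)
    (hq' : RegularDensity q' Q a c s) (ha : 0 ≤ a) (hc : 0 ≤ c)
    (hG : SmoothBounded G g₁ g₂) (hG' : SmoothBounded G' g₁ g₂) (hg₁ : 0 ≤ g₁) (hg₂ : 0 ≤ g₂)
    (hμ : CentredNoise μ σ2) (hμ' : CentredNoise μ' σ2)
    (h1 : ∀ᵐ x ∂ρ, ∫ u, q (x - u) ∂μ = ∫ u, q' (x - u) ∂μ')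
    (h2 : ∀ᵐ x ∂ρ, ∫ u, q (x - u) * G (x - u) ∂μ = ∫ u, q' (x - u) * G' (x - u) ∂μ') (x : E) :
    q x * |G x - G' x| ≤ 2 * Q * ((a * g₁ + g₂ / 2) * σ2) * Real.exp (c / 2 * σ2) := by
  have hF : Continuous (fun x => q x * |G x - G' x|) := hq.diff.continuous.mul
    (hG.diff.continuous.sub hG'.diff.continuous).abs
  refine forall_le_of_ae_le (ρ := ρ) hF ?_ x
  filter_upwards [h1, h2] with x hx1 hx2
  have e1 := conv_mul_abs_sub_le hq hx1 hx2
  have e2 := abs_conv_mul_sub_le_sup hq ha hG hg₁ hg₂ hμ x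
  have e3 := abs_conv_mul_sub_le_sup hq' ha hG' hg₁ hg₂ hμ' x
  have e4 := mul_le_mul_of_nonneg_right (hq.mul_exp_le_conv hc hμ x) (abs_nonneg (G x - G' x))
  have e5 : q x * |G x - G' x| * Real.exp (-(c / 2 * σ2))
      ≤ 2 * Q * ((a * g₁ + g₂ / 2) * σ2) := by linarith
  rw [Real.exp_neg] at e5
  exact (mul_inv_le_iff₀ (Real.exp_pos _)).1 e5

/-- The L¹ commutator bounds control the average of |G − G'| against μ ∗ q, whereas q is wanted. The
passage costs g₂σ² through the Taylor expansion of G − G', without the exponential factor of the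
pointwise bound. -/
theorem lintegral_mul_abs_sub_le_of_conv_ae_eq (hq : RegularDensity q Q a c s)
    (hq' : RegularDensity q' Q a c s) (ha : 0 ≤ a)
    (hq1 : ∫⁻ x, ENNReal.ofReal (q x) ∂ρ = 1) (hq1' : ∫⁻ x, ENNReal.ofReal (q' x) ∂ρ = 1)
    (hG : SmoothBounded G g₁ g₂) (hG' : SmoothBounded G' g₁ g₂) (hg₁ : 0 ≤ g₁) (hg₂ : 0 ≤ g₂)
    (hμ : CentredNoise μ σ2) (hμ' : CentredNoise μ' σ2)
    (h1 : ∀ᵐ x ∂ρ, ∫ u, q (x - u) ∂μ = ∫ u, q' (x - u) ∂μ')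
    (h2 : ∀ᵐ x ∂ρ, ∫ u, q (x - u) * G (x - u) ∂μ = ∫ u, q' (x - u) * G' (x - u) ∂μ') :
    ∫⁻ x, ENNReal.ofReal (q x) * ENNReal.ofReal |G x - G' x| ∂ρ
      ≤ ENNReal.ofReal (2 * ((a * g₁ + g₂ / 2) * σ2) + g₂ * σ2) := by
  have := hμ.prob
  have hσ := hμ.sq_nonneg
  have cq := hq.diff.continuous
  have cD : Continuous (fun x => G x - G' x) := hG.diff.continuous.sub hG'.diff.continuous
  have mq : Measurable (fun x => ENNReal.ofReal (q x)) :=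
    ENNReal.measurable_ofReal.comp cq.measurable
  have mD : Measurable (fun x => ENNReal.ofReal |G x - G' x|) :=
    ENNReal.measurable_ofReal.comp cD.abs.measurable
  -- Each of G and G' has Taylor remainder at most g₂‖u‖²/2, so their difference has at most g₂‖u‖².
  have hDi : ∀ x, Integrable (fun u => G (x + u) - G' (x + u)) μ ∧
      |∫ u, (G (x + u) - G' (x + u)) ∂μ - (G x - G' x)| ≤ g₂ * σ2 := fun x => by
    refine hμ.abs_integral_sub_le (F := fun u => G (x + u) - G' (x + u))
      (cD.comp (continuous_const.add continuous_id))
      (L := fderiv ℝ G x - fderiv ℝ G' x) hg₂ fun u => ?_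
    have e1 := abs_le.1 (hG.taylor x u)
    have e2 := abs_le.1 (hG'.taylor x u)
    rw [sub_apply, abs_le]
    constructor <;> linarith [e1.1, e1.2, e2.1, e2.2]
  have hD : ∀ x, ENNReal.ofReal |G x - G' x|
      ≤ ∫⁻ u, ENNReal.ofReal |G (x + u) - G' (x + u)| ∂μ + ENNReal.ofReal (g₂ * σ2) := fun x => by
    obtain ⟨e1, e2⟩ := hDi x
    rw [← ofReal_integral_eq_lintegral_ofReal e1.abs (ae_of_all _ fun u => abs_nonneg _),
      ← ENNReal.ofReal_add (integral_nonneg fun u => abs_nonneg _) (by positivity)]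
    refine ENNReal.ofReal_le_ofReal ?_
    have e3 : |∫ u, (G (x + u) - G' (x + u)) ∂μ| ≤ ∫ u, |G (x + u) - G' (x + u)| ∂μ :=
      abs_integral_le_integral_abs
    have e4 := abs_sub_abs_le_abs_sub (G x - G' x) (∫ u, (G (x + u) - G' (x + u)) ∂μ)
    rw [abs_sub_comm] at e2
    linarith
  have hp : ∀ᵐ x ∂ρ, ENNReal.ofReal |G x - G' x| * ∫⁻ u, ENNReal.ofReal (q (x - u)) ∂μ
      ≤ ENNReal.ofReal |∫ u, q (x - u) * G (x - u) ∂μ - G x * ∫ u, q (x - u) ∂μ|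
        + ENNReal.ofReal |∫ u, q' (x - u) * G' (x - u) ∂μ' - G' x * ∫ u, q' (x - u) ∂μ'| := by
    filter_upwards [h1, h2] with x hx1 hx2
    rw [← ofReal_integral_eq_lintegral_ofReal (hq.integrable_sub μ x)
      (ae_of_all _ fun u => hq.nonneg _), ← ENNReal.ofReal_mul (abs_nonneg _),
      ← ENNReal.ofReal_add (abs_nonneg _) (abs_nonneg _), mul_comm]
    exact ENNReal.ofReal_le_ofReal (conv_mul_abs_sub_le hq hx1 hx2)
  have hmeas : AEMeasurable (fun x => ENNReal.ofReal
      |∫ u, q (x - u) * G (x - u) ∂μ - G x * ∫ u, q (x - u) ∂μ|) ρ := by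
    have m1 : StronglyMeasurable (fun x => ∫ u, q (x - u) * G (x - u) ∂μ) :=
      StronglyMeasurable.integral_prod_right' (f := fun p : E × E => q (p.1 - p.2) * G (p.1 - p.2))
        ((cq.mul hG.diff.continuous).comp (continuous_fst.sub continuous_snd)).stronglyMeasurable
    have m2 : StronglyMeasurable (fun x => ∫ u, q (x - u) ∂μ) :=
      StronglyMeasurable.integral_prod_right' (f := fun p : E × E => q (p.1 - p.2))
        (cq.comp (continuous_fst.sub continuous_snd)).stronglyMeasurable
    exact (ENNReal.measurable_ofReal.comp (measurable_norm.comp (m1.measurable.sub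
      (hG.diff.continuous.measurable.mul m2.measurable)))).aemeasurable
  have hT : 0 ≤ (a * g₁ + g₂ / 2) * σ2 := by positivity
  calc _ ≤ ∫⁻ x, (ENNReal.ofReal (q x) * ∫⁻ u, ENNReal.ofReal |G (x + u) - G' (x + u)| ∂μ
          + ENNReal.ofReal (q x) * ENNReal.ofReal (g₂ * σ2)) ∂ρ :=
        lintegral_mono fun x => by rw [← mul_add]; exact mul_le_mul_right (hD x) _
    _ = ∫⁻ x, ENNReal.ofReal (q x) * ∫⁻ u, ENNReal.ofReal |G (x + u) - G' (x + u)| ∂μ ∂ρ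
          + ENNReal.ofReal (g₂ * σ2) := by
        rw [lintegral_add_right _ (mq.mul_const _), lintegral_mul_const _ mq, hq1, one_mul]
    -- By adjointness the shift moves from |G − G'| onto q, where it forms the convolution
    -- controlled by `hp`.
    _ = ∫⁻ x, ENNReal.ofReal |G x - G' x| * ∫⁻ u, ENNReal.ofReal (q (x - u)) ∂μ ∂ρ
          + ENNReal.ofReal (g₂ * σ2) := by
        rw [lintegral_mul_lintegral_add μ ρ mq mD]
    _ ≤ ENNReal.ofReal ((a * g₁ + g₂ / 2) * σ2) + ENNReal.ofReal ((a * g₁ + g₂ / 2) * σ2)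
          + ENNReal.ofReal (g₂ * σ2) := by
        gcongr
        refine (lintegral_mono_ae hp).trans ?_
        rw [lintegral_add_left' hmeas]
        exact add_le_add (lintegral_conv_mul_sub_le hq ha hq1 hG hg₁ hg₂ hμ)
          (lintegral_conv_mul_sub_le hq' ha hq1' hG' hg₁ hg₂ hμ')
    _ = _ := by
        rw [← ENNReal.ofReal_add hT hT, ← ENNReal.ofReal_add (by positivity) (by positivity)]
        congr 1
        ring

end Near

end

/-! ### Equivalence up to a small error. -/

section

variable {dS dV dY : ℕ}

section Densities

variable {M M' : Model dS dV dY} {B : Bounds}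

/-- Together with `dens_eq` this exhibits both latent densities as densities in the space of `x`
times the same Jacobian |det Df'|, which is why that factor appears in the estimates for the prior.
-/
theorem pushDensity_reparam (hM : M.Admissible) (hM' : M'.Admissible) (z : Latent dS dV) :
    pushDensity (reparam M M') M.dens z = M.obsDens (M'.f z) * |(fderiv ℝ M'.f z).det| := by
  have e : ⇑(reparam M M').symm = fun w => M.f.symm (M'.f w) := rfl
  have h := ((hM.finv_diff (M'.f z)).hasFDerivAt.comp z (hM'.f_diff z).hasFDerivAt).fderiv
  have h' : fderiv ℝ (reparam M M').symm z
      = (fderiv ℝ M.f.symm (M'.f z)).comp (fderiv ℝ M'.f z) := h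
  rw [pushDensity, h', Model.obsDens, pushDensity, mul_assoc, ← abs_mul]
  congr 2
  exact LinearMap.det_comp _ _

theorem dens_eq (hM' : M'.Admissible) (hB' : M'.BoundedBy B) (z : Latent dS dV) :
    M'.dens z = M'.obsDens (M'.f z) * |(fderiv ℝ M'.f z).det| := by
  have h := (hM'.boundedDiffeo hB').det_mul_det (M'.f z)
  rw [M'.f.symm_apply_apply] at h
  rw [Model.obsDens, pushDensity, mul_assoc, ← abs_mul, mul_comm (ContinuousLinearMap.det _), h,
    M'.f.symm_apply_apply, abs_one, mul_one]

theorem abs_pushDensity_sub_dens (hM : M.Admissible) (hM' : M'.Admissible) (hB' : M'.BoundedBy B)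
    (z : Latent dS dV) : |pushDensity (reparam M M') M.dens z - M'.dens z|
      = |M.obsDens (M'.f z) - M'.obsDens (M'.f z)| * |(fderiv ℝ M'.f z).det| := by
  rw [pushDensity_reparam hM hM', dens_eq hM' hB' z, ← sub_mul, abs_mul, abs_abs]

end Densities

section Mean

variable {M M' : Model dS dV dY} {μ μ' : Measure (Obs dS dV)} {Q a c s g₁ g₂ σ2 : ℝ} {l : Fin dY}

/-- The identities for data laws test only nonnegative functions of y, while a coordinate y_l is
signed and unbounded. It is split into positive and negative parts, with absolute moments under
control, and the common mean `m` of the output noise is subtracted. -/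
theorem conv_mul_obsOut_eq (hM : M.Admissible) (hq : RegularDensity M.obsDens Q a c s)
    (hG : SmoothBounded (fun x => M.obsOut x l) g₁ g₂) (hg₁ : 0 ≤ g₁) (hμ : CentredNoise μ σ2)
    {m K : ℝ} (hK : 0 ≤ K) (hmean : ∀ a ∈ Set.range M.g, Integrable (fun y => y l) (M.out.law a) ∧
      ∫ y, y l ∂(M.out.law a) = a l + m ∧ ∫ y, |y l| ∂(M.out.law a) ≤ |a l| + K)
    (x : Obs dS dV) :
    ∫ u, M.obsDens (x - u) * M.obsOut (x - u) l ∂μ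
      = (∫⁻ u, ENNReal.ofReal (M.obsDens (x - u))
            * ∫⁻ y, ENNReal.ofReal (y l) ∂M.outLaw (x - u) ∂μ).toReal
        - (∫⁻ u, ENNReal.ofReal (M.obsDens (x - u))
            * ∫⁻ y, ENNReal.ofReal (-y l) ∂M.outLaw (x - u) ∂μ).toReal
        - m * ∫ u, M.obsDens (x - u) ∂μ := by
  have := hμ.prob
  have hQ := hq.sup_nonneg
  have hsub : Measurable (fun u : Obs dS dV => x - u) := measurable_id.const_sub x
  have hy : Measurable (fun y : Out dY => y l) :=
    (EuclideanSpace.proj l : Out dY →L[ℝ] ℝ).continuous.measurable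
  have iq := hq.integrable_sub μ x
  have iG := hG.integrable_sub hg₁ hμ x
  have main : ∀ w : Out dY → ℝ, Measurable w → (∀ y, |w y| = |y l|) →
      Integrable (fun u => M.obsDens (x - u) *
        (∫⁻ y, ENNReal.ofReal (w y) ∂M.outLaw (x - u)).toReal) μ ∧
      (∫⁻ u, ENNReal.ofReal (M.obsDens (x - u))
            * ∫⁻ y, ENNReal.ofReal (w y) ∂M.outLaw (x - u) ∂μ).toReal
        = ∫ u, M.obsDens (x - u) *
          (∫⁻ y, ENNReal.ofReal (w y) ∂M.outLaw (x - u)).toReal ∂μ := by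
    intro w hw hwl
    have hle : ∀ x, ∫⁻ y, ENNReal.ofReal (w y) ∂M.outLaw x
        ≤ ENNReal.ofReal (|M.obsOut x l| + K) := fun x => by
      obtain ⟨h1, -, h3⟩ := hmean _ (Model.Admissible.obsOut_mem_range x)
      calc _ ≤ ∫⁻ y, ENNReal.ofReal |y l| ∂M.outLaw x := lintegral_mono fun y =>
            ENNReal.ofReal_le_ofReal ((le_abs_self _).trans_eq (hwl y))
        _ = ENNReal.ofReal (∫ y, |y l| ∂M.outLaw x) :=
            (ofReal_integral_eq_lintegral_ofReal h1.abs (ae_of_all _ fun y => abs_nonneg _)).symm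
        _ ≤ _ := ENNReal.ofReal_le_ofReal h3
    have hm : Measurable (fun u => (∫⁻ y, ENNReal.ofReal (w y) ∂M.outLaw (x - u)).toReal) :=
      ENNReal.measurable_toReal.comp ((hM.measurable_lintegral_outLaw
        (ENNReal.measurable_ofReal.comp hw)).comp hsub)
    have hP : Integrable (fun u => M.obsDens (x - u) *
        (∫⁻ y, ENNReal.ofReal (w y) ∂M.outLaw (x - u)).toReal) μ := by
      refine ((iG.abs.add (integrable_const K)).const_mul Q).mono'
        ((hq.diff.continuous.measurable.comp hsub).mul hm).aestronglyMeasurable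
        (ae_of_all _ fun u => ?_)
      rw [norm_mul, Real.norm_of_nonneg (hq.nonneg _), Real.norm_of_nonneg ENNReal.toReal_nonneg]
      refine mul_le_mul (hq.le _) ?_ ENNReal.toReal_nonneg hQ
      exact ENNReal.toReal_le_of_le_ofReal (add_nonneg (abs_nonneg _) hK) (hle (x - u))
    refine ⟨hP, ?_⟩
    rw [integral_eq_lintegral_of_nonneg_ae (ae_of_all _ fun u =>
      mul_nonneg (hq.nonneg _) ENNReal.toReal_nonneg) hP.aestronglyMeasurable]
    congr 1
    refine lintegral_congr fun u => ?_
    rw [ENNReal.ofReal_mul (hq.nonneg _), ENNReal.ofReal_toReal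
      (ne_top_of_le_ne_top ENNReal.ofReal_ne_top (hle _))]
  obtain ⟨i1, e1⟩ := main (fun y => y l) hy fun y => rfl
  obtain ⟨i2, e2⟩ := main (fun y => -y l) hy.neg fun y => abs_neg _
  have i3 : Integrable (fun u => M.obsDens (x - u) *
        (∫⁻ y, ENNReal.ofReal (y l) ∂M.outLaw (x - u)).toReal - M.obsDens (x - u) *
        (∫⁻ y, ENNReal.ofReal (-y l) ∂M.outLaw (x - u)).toReal) μ := i1.sub i2
  rw [e1, e2, ← integral_sub i1 i2, ← integral_const_mul, ← integral_sub i3 (iq.const_mul m)]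
  refine integral_congr_ae (ae_of_all _ fun u => ?_)
  obtain ⟨h1, h2, -⟩ := hmean _ (Model.Admissible.obsOut_mem_range (M := M) (x - u))
  have h3 := integral_eq_lintegral_pos_part_sub_lintegral_neg_part h1
  have h4 : M.obsOut (x - u) l = (∫⁻ y, ENNReal.ofReal (y l) ∂M.outLaw (x - u)).toReal
      - (∫⁻ y, ENNReal.ofReal (-y l) ∂M.outLaw (x - u)).toReal - m := by
    rw [Model.outLaw, ← h3, h2]
    ring
  dsimp only
  rw [h4]
  ring

end Mean

section Near

variable {M M' : Model dS dV dY} {B : Bounds} {μ μ' : Measure (Obs dS dV)} {σ2 ε : ℝ}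

/-- Both laws are centred around the same point f(z), and each is compared with the Dirac mass
there. -/
theorem mechX_near (hμ : IsProbabilityMeasure μ) (hμ' : IsProbabilityMeasure μ')
    (hi : Integrable (fun u => ‖u‖ ^ 2) μ) (hi' : Integrable (fun u => ‖u‖ ^ 2) μ')
    (hσ : ∫ u, ‖u‖ ^ 2 ∂μ ≤ σ2) (hσ' : ∫ u, ‖u‖ ^ 2 ∂μ' ≤ σ2) (z : Latent dS dV) (K : NNReal)
    (h : Obs dS dV → ℝ) (hK : LipschitzWith K h) :
    |∫ x, h x ∂((M.toCSG μ).mechX z) - ∫ x, h x ∂((M'.toCSG μ').mechX (reparam M M' z))|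
      ≤ 2 * K * √σ2 := by
  rw [mechX_reparam]
  have main : ∀ ρ : Measure (Obs dS dV), IsProbabilityMeasure ρ → Integrable (fun u => ‖u‖ ^ 2) ρ →
      ∫ u, ‖u‖ ^ 2 ∂ρ ≤ σ2 → |∫ x, h x ∂((M.toCSG ρ).mechX z) - h (M.f z)| ≤ K * √σ2 := by
    intro ρ _ i1 i2
    have e : ∫ x, h x ∂((M.toCSG ρ).mechX z) = ∫ u, h (M.f z + u) ∂ρ :=
      integral_map (by fun_prop) hK.continuous.aestronglyMeasurable
    have hb : ∀ u, |h (M.f z + u) - h (M.f z)| ≤ K * ‖u‖ := fun u => by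
      have := hK.dist_le_mul (M.f z + u) (M.f z)
      rwa [Real.dist_eq, dist_self_add_left] at this
    have i0 := (integrable_norm_of_sq i1).const_mul (K : ℝ)
    have hc : Continuous (fun u => h (M.f z + u)) := hK.continuous.comp (by fun_prop)
    have i3 : Integrable (fun u => h (M.f z + u) - h (M.f z)) ρ :=
      i0.mono' (hc.sub continuous_const).aestronglyMeasurable (ae_of_all _ hb)
    have i4 : Integrable (fun u => h (M.f z + u)) ρ := by
      refine (i3.add (integrable_const (h (M.f z)))).congr (ae_of_all _ fun u => ?_)
      simp
    have e2 : ∫ u, h (M.f z + u) ∂ρ - h (M.f z) = ∫ u, (h (M.f z + u) - h (M.f z)) ∂ρ := by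
      rw [integral_sub i4 (integrable_const _)]
      simp
    rw [e, e2, ← Real.norm_eq_abs]
    calc _ ≤ ∫ u, K * ‖u‖ ∂ρ := norm_integral_le_of_norm_le i0 (ae_of_all _ hb)
      _ = K * ∫ u, ‖u‖ ∂ρ := integral_const_mul _ _
      _ ≤ _ := mul_le_mul_of_nonneg_left (integral_norm_le_sqrt i1 i2) K.2
  have h1 := abs_le.1 (main μ hμ hi hσ)
  have h2 := abs_le.1 (main μ' hμ' hi' hσ')
  rw [abs_le]
  constructor <;> linarith [h1.1, h1.2, h2.1, h2.2]

theorem nearSemanticEquivalent (hM : M.Admissible) (hM' : M'.Admissible) (hB : M.BoundedBy B)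
    (hB' : M'.BoundedBy B) (hout : M.out.SameMean M'.out) (hμ : IsProbabilityMeasure μ)
    (hμ' : IsProbabilityMeasure μ') (hi : Integrable (fun u => ‖u‖ ^ 2) μ)
    (hi' : Integrable (fun u => ‖u‖ ^ 2) μ') (hm : ∫ u, u ∂μ = ∫ u, u ∂μ')
    (hσ : ∫ u, ‖u‖ ^ 2 ∂μ ≤ σ2) (hσ' : ∫ u, ‖u‖ ^ 2 ∂μ' ≤ σ2)
    (hε : σ2 * B.threshold dS dV ≤ ε) (he : (M.toCSG μ).dataLaw = (M'.toCSG μ').dataLaw) :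
    NearSemanticEquivalent M M' μ μ' B σ2 ε := by
  obtain ⟨a, c, s, g₁, g₂, hC⟩ := exists_controls hM hB
  have hq := hC.dens M hM hB
  have hq' := hC.dens M' hM' hB'
  have hn := centredNoise_map hi hσ
  have hn' := centredNoise_map hi' hσ'
  rw [← hm] at hn'
  have hp := hn.prob
  have hp' := hn'.prob
  have hσ0 := hn.sq_nonneg
  set μ₀ := μ.map (fun u => u - ∫ w, w ∂μ)
  set μ₀' := μ'.map (fun u => u - ∫ w, w ∂μ)
  set Q := B.p * B.finv1 ^ (dS + dV) with hQ
  set T := B.threshold dS dV with hT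
  set n := √((dS : ℝ) + dV) with hn0
  have hn0' : 0 ≤ n := Real.sqrt_nonneg _
  have hQpos : 0 < Q := (hq.pos 0).trans_le (hq.le 0)
  have hconv : ∀ {w : Out dY → ENNReal}, Measurable w →
      (fun x => ∫⁻ u, ENNReal.ofReal (M.obsDens (x - u)) * ∫⁻ y, w y ∂M.outLaw (x - u) ∂μ₀)
        =ᵐ[volume]
      fun x => ∫⁻ u, ENNReal.ofReal (M'.obsDens (x - u)) * ∫⁻ y, w y ∂M'.outLaw (x - u) ∂μ₀' := by
    intro w hw
    refine ae_eq_conv_centred (k := fun x => ENNReal.ofReal (M.obsDens x) * ∫⁻ y, w y ∂M.outLaw x)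
      (k' := fun x => ENNReal.ofReal (M'.obsDens x) * ∫⁻ y, w y ∂M'.outLaw x) ?_ ?_ _
      (ae_eq_of_dataLaw_eq hM hM' he hw)
    · exact (ENNReal.measurable_ofReal.comp hM.continuous_obsDens.measurable).mul
        (hM.measurable_lintegral_outLaw hw)
    · exact (ENNReal.measurable_ofReal.comp hM'.continuous_obsDens.measurable).mul
        (hM'.measurable_lintegral_outLaw hw)
  have h1 : ∀ᵐ x, ∫ u, M.obsDens (x - u) ∂μ₀ = ∫ u, M'.obsDens (x - u) ∂μ₀' := by
    filter_upwards [hconv (w := fun _ => 1) measurable_const] with x hx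
    have e := fun x => hM.isProbabilityMeasure_outLaw x
    have e' := fun x => hM'.isProbabilityMeasure_outLaw x
    simp only [lintegral_const, measure_univ, mul_one] at hx
    rw [integral_eq_lintegral_of_nonneg_ae (ae_of_all _ fun u => hq.nonneg _)
      (hq.integrable_sub μ₀ x).aestronglyMeasurable, hx,
      integral_eq_lintegral_of_nonneg_ae (ae_of_all _ fun u => hq'.nonneg _)
      (hq'.integrable_sub μ₀' x).aestronglyMeasurable]
  obtain ⟨m, K, hK0, hmean⟩ := hout.exists_mean hM.out_valid.proper hM'.out_valid.proper
  have h2 : ∀ l, ∀ᵐ x, ∫ u, M.obsDens (x - u) * M.obsOut (x - u) l ∂μ₀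
      = ∫ u, M'.obsDens (x - u) * M'.obsOut (x - u) l ∂μ₀' := by
    intro l
    have hy : Measurable (fun y : Out dY => y l) :=
      (EuclideanSpace.proj l : Out dY →L[ℝ] ℝ).continuous.measurable
    filter_upwards [h1, hconv (ENNReal.measurable_ofReal.comp hy),
      hconv (ENNReal.measurable_ofReal.comp hy.neg)] with x hx1 hx2 hx3
    rw [conv_mul_obsOut_eq hM hq (hC.out M hM hB l) hC.g₁_nonneg hn hK0 (hmean l).1,
      conv_mul_obsOut_eq hM' hq' (hC.out M' hM' hB' l) hC.g₁_nonneg hn' hK0 (hmean l).2, hx1]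
    simp only [Function.comp_apply, Pi.neg_apply] at hx2 hx3
    rw [hx2, hx3]
  have hsup := fun x => hq.abs_sub_le_of_conv_ae_eq hq' hC.s_nonneg hn hn' h1 x
  have hTε : T * σ2 ≤ ε := by rw [mul_comm]; exact hε
  have hgnear : ∀ l z, |M.g (sem z) l - M'.g (sem (reparam M M' z)) l|
      ≤ 2 * ε * Real.exp (n * ε / (2 * Q)) * (Q / pushDensity M.f M.dens (M.f z)) := by
    intro l z
    have hY : dY ≠ 0 := fun h => by subst h; exact l.elim0
    have e := mul_abs_sub_le_of_conv_ae_eq hq hq' hC.a_nonneg hC.c_nonneg (hC.out M hM hB l)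
      (hC.out M' hM' hB' l) hC.g₁_nonneg hC.g₂_nonneg hn hn' h1 (h2 l) (M.f z)
    rw [obsOut_apply, obsOut_reparam] at e
    change _ ≤ _ * (Q / M.obsDens (M.f z))
    have hqz := hq.pos (M.f z)
    rw [← mul_div_assoc, le_div_iff₀ hqz, mul_comm]
    refine e.trans ?_
    have e1 : (a * g₁ + g₂ / 2) * σ2 ≤ ε :=
      (mul_le_mul_of_nonneg_right (hC.g_le hY) hσ0).trans hTε
    -- This is Qc ≤ √d T from the controls, multiplied by σ² and divided by 2Q.
    have e2 : c / 2 * σ2 ≤ n * ε / (2 * Q) := by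
      rw [le_div_iff₀ (by positivity)]
      calc _ = Q * c * σ2 := by ring
        _ ≤ n * T * σ2 := mul_le_mul_of_nonneg_right hC.c_le hσ0
        _ = n * (T * σ2) := by ring
        _ ≤ _ := mul_le_mul_of_nonneg_left hTε hn0'
    have e3 : 0 ≤ (a * g₁ + g₂ / 2) * σ2 := by
      have := hC.a_nonneg
      have := hC.g₁_nonneg
      have := hC.g₂_nonneg
      positivity
    have e4 : 0 ≤ ε := e3.trans e1
    calc _ ≤ 2 * Q * ε * Real.exp (n * ε / (2 * Q)) := by gcongr
      _ = _ := by ring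
  refine ⟨fun h z => ?_, mechX_near hμ hμ' hi hi' hσ hσ', fun z => ?_, fun l => ?_, hgnear,
    fun l z₁ z₂ h => ?_⟩
  · rw [mechX_reparam, h]
  · rw [abs_pushDensity_sub_dens hM hM' hB']
    refine mul_le_mul_of_nonneg_right ((hsup _).trans ?_) (abs_nonneg _)
    calc _ ≤ n * T * σ2 := mul_le_mul_of_nonneg_right hC.s_le hσ0
      _ = n * (T * σ2) := by ring
      _ ≤ _ := mul_le_mul_of_nonneg_left hTε hn0'
  · have hY : dY ≠ 0 := fun h => by subst h; exact l.elim0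
    have e := lintegral_mul_abs_sub_le_of_conv_ae_eq hq hq' hC.a_nonneg hM.lintegral_obsDens
      hM'.lintegral_obsDens (hC.out M hM hB l) (hC.out M' hM' hB' l) hC.g₁_nonneg hC.g₂_nonneg
      hn hn' h1 (h2 l)
    have hmD : Measurable (fun x => ENNReal.ofReal |M.obsOut x l - M'.obsOut x l|) :=
      ENNReal.measurable_ofReal.comp ((hC.out M hM hB l).diff.continuous.sub
        (hC.out M' hM' hB' l).diff.continuous).abs.measurable
    rw [← hM.lintegral_prior hmD] at e
    simp only [obsOut_apply, obsOut_reparam] at e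
    refine e.trans (ENNReal.ofReal_le_ofReal ?_)
    -- The constant 4 is 2 + 2: two commutators of size ε each, and g₂σ² ≤ 2ε from the change of
    -- weight.
    have e1 : (a * g₁ + g₂ / 2) * σ2 ≤ ε :=
      (mul_le_mul_of_nonneg_right (hC.g_le hY) hσ0).trans hTε
    have e2 := mul_le_mul_of_nonneg_right (hC.g₂_le hY) hσ0
    linarith
  · have e1 := abs_le.1 (hgnear l z₁)
    have e2 := abs_le.1 (hgnear l z₂)
    rw [← h] at e2
    rw [mul_add, abs_le]
    constructor <;> linarith [e1.1, e1.2, e2.1, e2.2]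

end Near

end

/-! ### Vanishing noise: uniform rates and weak limits. -/

section

/-- Joint convergence in (n, w) also controls the limit function near z: g(w) is a limit of F n w,
hence close to g(z). -/
theorem tendstoLocallyUniformly_of_tendsto_prod {X : Type*} [TopologicalSpace X] {F : ℕ → X → ℝ}
    {g : X → ℝ} (h : ∀ z, Tendsto (fun p : ℕ × X => F p.1 p.2) (atTop ×ˢ 𝓝 z) (𝓝 (g z))) :
    TendstoLocallyUniformly F g atTop := by
  have hp : ∀ z, Tendsto (fun n => F n z) atTop (𝓝 (g z)) := fun z =>
    (h z).comp (tendsto_id.prodMk (tendsto_const_pure.mono_right (pure_le_nhds z)))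
  rw [Metric.tendstoLocallyUniformly_iff]
  intro ε hε z
  have h1 := (h z).eventually (Metric.ball_mem_nhds _ (by positivity : 0 < ε / 3))
  obtain ⟨pa, ha, pb, hb, hab⟩ := eventually_prod_iff.1 h1
  refine ⟨{w | pb w}, hb, ?_⟩
  filter_upwards [ha] with n hn w hw
  have h2 : dist (g w) (g z) ≤ ε / 3 :=
    le_of_tendsto ((hp w).dist tendsto_const_nhds) (ha.mono fun m hm => (hab hm hw).le)
  have h3 : dist (F n w) (g z) < ε / 3 := hab hn hw
  have h4 := dist_triangle_right (g w) (F n w) (g z)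
  linarith

section Noise

variable {E : Type*} [NormedAddCommGroup E] [MeasurableSpace E]

/-- A first-order estimate: a Lipschitz function changes under noise by at most L times the first
moment. No centring is needed, which is why no equality of means is assumed in the asymptotic
statement. -/
theorem abs_toReal_lintegral_sub_le {k : E → ℝ} (h0 : ∀ x, 0 ≤ k x) {L : ℝ}
    (hk : ∀ x y, |k x - k y| ≤ L * ‖x - y‖) {μ : Measure E} [IsProbabilityMeasure μ]
    (hμ : Integrable (fun u => ‖u‖) μ) (hcu : ∀ x : E, AEStronglyMeasurable (fun u => k (x - u)) μ)
    (x : E) : |(∫⁻ u, ENNReal.ofReal (k (x - u)) ∂μ).toReal - k x| ≤ L * ∫ u, ‖u‖ ∂μ := by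
  have hb : ∀ u, |k (x - u) - k x| ≤ L * ‖u‖ := fun u => by
    have := hk (x - u) x
    rwa [sub_sub_cancel_left, norm_neg] at this
  have i1 : Integrable (fun u => k (x - u) - k x) μ :=
    (hμ.const_mul L).mono' ((hcu x).sub aestronglyMeasurable_const) (ae_of_all _ hb)
  have i2 : Integrable (fun u => k (x - u)) μ := by
    refine (i1.add (integrable_const (k x))).congr (ae_of_all _ fun u => ?_)
    simp
  rw [← integral_eq_lintegral_of_nonneg_ae (ae_of_all _ fun u => h0 _) i2.aestronglyMeasurable]
  have e : ∫ u, k (x - u) ∂μ - k x = ∫ u, (k (x - u) - k x) ∂μ := by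
    rw [integral_sub i2 (integrable_const _)]
    simp
  rw [e, ← Real.norm_eq_abs, ← integral_const_mul]
  exact norm_integral_le_of_norm_le (hμ.const_mul L) (ae_of_all _ hb)

theorem abs_sub_le_of_lintegral_ae_eq [NormedSpace ℝ E] [BorelSpace E] [FiniteDimensional ℝ E] {ρ : Measure E}
    [ρ.IsAddHaarMeasure] {k k' : E → ℝ} (h0 : ∀ x, 0 ≤ k x)
    (h0' : ∀ x, 0 ≤ k' x) (hc : Continuous k) (hc' : Continuous k') {L : ℝ}
    (hk : ∀ x y, |k x - k y| ≤ L * ‖x - y‖) (hk' : ∀ x y, |k' x - k' y| ≤ L * ‖x - y‖)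
    {μ μ' : Measure E} [IsProbabilityMeasure μ] [IsProbabilityMeasure μ']
    (hμ : Integrable (fun u => ‖u‖) μ) (hμ' : Integrable (fun u => ‖u‖) μ')
    (h : (fun x => ∫⁻ u, ENNReal.ofReal (k (x - u)) ∂μ) =ᵐ[ρ]
      fun x => ∫⁻ u, ENNReal.ofReal (k' (x - u)) ∂μ') (x : E) :
    |k x - k' x| ≤ L * (∫ u, ‖u‖ ∂μ + ∫ u, ‖u‖ ∂μ') := by
  have hF : Continuous (fun x => |k x - k' x|) := (hc.sub hc').abs
  refine forall_le_of_ae_le (ρ := ρ) hF ?_ x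
  filter_upwards [h] with x hx
  have e1 := abs_le.1 (abs_toReal_lintegral_sub_le h0 hk hμ (fun x =>
    (hc.comp (continuous_const.sub continuous_id)).aestronglyMeasurable) x)
  have e2 := abs_le.1 (abs_toReal_lintegral_sub_le h0' hk' hμ' (fun x =>
    (hc'.comp (continuous_const.sub continuous_id)).aestronglyMeasurable) x)
  rw [hx] at e1
  rw [abs_le]
  constructor <;> linarith [e1.1, e1.2, e2.1, e2.2]

/-- Scheffé's lemma. -/
theorem tendsto_integral_abs_sub {α : Type*} [MeasurableSpace α] {ρ : Measure α} {q : α → ℝ}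
    {q' : ℕ → α → ℝ} (h0 : ∀ x, 0 ≤ q x) (h0' : ∀ n x, 0 ≤ q' n x) (hi : Integrable q ρ)
    (hi' : ∀ n, Integrable (q' n) ρ) (h1 : ∀ n, ∫ x, q' n x ∂ρ = ∫ x, q x ∂ρ)
    (hl : ∀ x, Tendsto (fun n => q' n x) atTop (𝓝 (q x))) :
    Tendsto (fun n => ∫ x, |q x - q' n x| ∂ρ) atTop (𝓝 0) := by
  have hd : ∀ n, Integrable (fun x => q x - q' n x) ρ := fun n => hi.sub (hi' n)
  -- |t| = 2t⁺ − t, and the integral of q − q'ₙ vanishes. The positive part is dominated by q, so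
  -- dominated convergence applies to it.
  have e : ∀ n, ∫ x, |q x - q' n x| ∂ρ = 2 * ∫ x, max (q x - q' n x) 0 ∂ρ := fun n => by
    have e1 : ∀ x, |q x - q' n x| = 2 * max (q x - q' n x) 0 - (q x - q' n x) := fun x => by
      rcases le_total (q x - q' n x) 0 with h | h
      · rw [abs_of_nonpos h, max_eq_right h]; ring
      · rw [abs_of_nonneg h, max_eq_left h]; ring
    have i1 : Integrable (fun x => 2 * max (q x - q' n x) 0) ρ := (hd n).pos_part.const_mul 2
    simp_rw [e1]
    rw [integral_sub i1 (hd n), integral_sub hi (hi' n), h1 n, sub_self, sub_zero,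
      integral_const_mul]
  simp_rw [e]
  have h2 : Tendsto (fun n => ∫ x, max (q x - q' n x) 0 ∂ρ) atTop (𝓝 (∫ _x, (0 : ℝ) ∂ρ)) := by
    refine tendsto_integral_of_dominated_convergence q
      (fun n => (hd n).pos_part.aestronglyMeasurable) hi (fun n => ae_of_all _ fun x => ?_)
      (ae_of_all _ fun x => ?_)
    · rw [Real.norm_of_nonneg (le_max_right _ _)]
      exact max_le (by linarith [h0' n x]) (h0 x)
    · have := ((tendsto_const_nhds (x := q x)).sub (hl x)).max (tendsto_const_nhds (x := (0 : ℝ)))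
      simpa using this
  simpa using h2.const_mul 2

end Noise

variable {dS dV dY : ℕ}

section Modulus

variable {B : Bounds} {a c s g₁ g₂ : ℝ} {h : Out dY → ℝ} {K : NNReal} {C : ℝ}

theorem Controls.norm_obsOut_sub_le (hC : Controls B dS dV dY a c s g₁ g₂)
    {M : Model dS dV dY} (hM : M.Admissible) (hB : M.BoundedBy B) (x y : Obs dS dV) :
    ‖M.obsOut x - M.obsOut y‖ ≤ √dY * g₁ * ‖x - y‖ := by
  have := euclidean_norm_le (x := M.obsOut x - M.obsOut y) (a := g₁ * ‖x - y‖)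
    (mul_nonneg hC.g₁_nonneg (norm_nonneg _)) fun l => (hC.out M hM hB l).abs_sub_le hC.g₁_nonneg x y
  rwa [Fintype.card_fin, ← mul_assoc] at this

theorem Controls.abs_obsDens_mul_outInt_sub_le (hC : Controls B dS dV dY a c s g₁ g₂)
    (hK : LipschitzWith K h) (h0 : ∀ y, 0 ≤ h y) (hh : ∀ y, h y ≤ C) {M : Model dS dV dY}
    (hM : M.Admissible) (hB : M.BoundedBy B) (x y : Obs dS dV) :
    |M.obsDens x * M.outInt h x - M.obsDens y * M.outInt h y|
      ≤ (B.p * B.finv1 ^ (dS + dV) * ((K + dY * C) * (√dY * g₁))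
        + a * (B.p * B.finv1 ^ (dS + dV)) * C) * ‖x - y‖ := by
  have hC0 : 0 ≤ C := (h0 0).trans (hh 0)
  have hq := hC.dens M hM hB
  have e : M.obsDens x * M.outInt h x - M.obsDens y * M.outInt h y
      = M.obsDens x * (M.outInt h x - M.outInt h y)
        + (M.obsDens x - M.obsDens y) * M.outInt h y := by ring
  rw [e]
  refine (abs_add_le _ _).trans ?_
  rw [abs_mul, abs_mul, abs_of_nonneg (hq.nonneg x),
    abs_of_nonneg (Model.Admissible.outInt_nonneg h0 y)]
  have e1 := hM.abs_outInt_sub_le hK h0 hh x y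
  have e2 := hC.norm_obsOut_sub_le hM hB x y
  have e3 := hq.abs_sub_le hC.a_nonneg x y
  have e4 := hM.outInt_le hK h0 hh y
  have e5 := hq.le x
  have e6 := hq.sup_nonneg
  have e7 := hC.a_nonneg
  have e8 : 0 ≤ M.outInt h y := Model.Admissible.outInt_nonneg h0 y
  set Q := B.p * B.finv1 ^ (dS + dV)
  calc _ ≤ Q * ((K + dY * C) * (√dY * g₁ * ‖x - y‖)) + a * Q * ‖x - y‖ * C := by
        gcongr
        exact e1.trans (by gcongr)
    _ = _ := by ring

theorem Controls.abs_obsDens_mul_outInt_sub_le_of_dataLaw_eq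
    (hC : Controls B dS dV dY a c s g₁ g₂)
    (hK : LipschitzWith K h) (h0 : ∀ y, 0 ≤ h y) (hh : ∀ y, h y ≤ C) {M M' : Model dS dV dY}
    (hM : M.Admissible) (hM' : M'.Admissible) (hB : M.BoundedBy B) (hB' : M'.BoundedBy B)
    {μ μ' : Measure (Obs dS dV)} [IsProbabilityMeasure μ] [IsProbabilityMeasure μ']
    (hμ : Integrable (fun u => ‖u‖) μ) (hμ' : Integrable (fun u => ‖u‖) μ')
    (he : (M.toCSG μ).dataLaw = (M'.toCSG μ').dataLaw) (x : Obs dS dV) :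
    |M.obsDens x * M.outInt h x - M'.obsDens x * M'.outInt h x|
      ≤ (B.p * B.finv1 ^ (dS + dV) * ((K + dY * C) * (√dY * g₁))
        + a * (B.p * B.finv1 ^ (dS + dV)) * C) * (∫ u, ‖u‖ ∂μ + ∫ u, ‖u‖ ∂μ') :=
  abs_sub_le_of_lintegral_ae_eq (k := fun x => M.obsDens x * M.outInt h x)
    (k' := fun x => M'.obsDens x * M'.outInt h x)
    (fun x => mul_nonneg (hM.obsDens_pos hB x).le (Model.Admissible.outInt_nonneg h0 x))
    (fun x => mul_nonneg (hM'.obsDens_pos hB' x).le (Model.Admissible.outInt_nonneg h0 x))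
    (hM.continuous_obsDens.mul (hM.continuous_outInt hK h0 hh))
    (hM'.continuous_obsDens.mul (hM'.continuous_outInt hK h0 hh))
    (hC.abs_obsDens_mul_outInt_sub_le hK h0 hh hM hB)
    (hC.abs_obsDens_mul_outInt_sub_le hK h0 hh hM' hB') hμ hμ'
    (ae_eq_outInt_of_dataLaw_eq hM hM' he hK h0 hh) x

end Modulus

/-- A sequence of pairs of models with equal data laws and vanishing noises. -/
structure VanishingNoise (M : Model dS dV dY) (B : Bounds) (μ : ℕ → Measure (Obs dS dV))
    (M' : ℕ → Model dS dV dY) (μ' : ℕ → Measure (Obs dS dV)) : Prop where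
  adm : M.Admissible
  bdd : M.BoundedBy B
  adm' : ∀ n, (M' n).Admissible
  bdd' : ∀ n, (M' n).BoundedBy B
  prob : ∀ n, IsProbabilityMeasure (μ n)
  prob' : ∀ n, IsProbabilityMeasure (μ' n)
  int : ∀ n, Integrable (fun u => ‖u‖) (μ n)
  int' : ∀ n, Integrable (fun u => ‖u‖) (μ' n)
  lim : Tendsto (fun n => ∫ u, ‖u‖ ∂μ n) atTop (𝓝 0)
  lim' : Tendsto (fun n => ∫ u, ‖u‖ ∂μ' n) atTop (𝓝 0)
  law_eq : ∀ n, (M.toCSG (μ n)).dataLaw = ((M' n).toCSG (μ' n)).dataLaw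

theorem tendsto_integral_norm_of_sq {E : Type*} [NormedAddCommGroup E] [NormedSpace ℝ E]
    [FiniteDimensional ℝ E] [MeasurableSpace E] [BorelSpace E] {μ : ℕ → Measure E}
    (hμ : ∀ n, IsProbabilityMeasure (μ n) ∧ Integrable (fun u => ‖u‖ ^ 2) (μ n))
    (h : Tendsto (fun n => ∫ u, ‖u‖ ^ 2 ∂(μ n)) atTop (𝓝 0)) :
    Tendsto (fun n => ∫ u, ‖u‖ ∂(μ n)) atTop (𝓝 0) := by
  refine squeeze_zero (fun n => integral_nonneg fun _ => norm_nonneg _) (fun n => ?_)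
    (by simpa using h.sqrt)
  have := (hμ n).1
  exact integral_norm_le_sqrt (hμ n).2 le_rfl

namespace VanishingNoise

variable {M : Model dS dV dY} {B : Bounds} {μ : ℕ → Measure (Obs dS dV)} {M' : ℕ → Model dS dV dY}
  {μ' : ℕ → Measure (Obs dS dV)}

theorem exists_rate (V : VanishingNoise M B μ M' μ') {h : Out dY → ℝ} {K : NNReal} {C : ℝ}
    (hK : LipschitzWith K h) (h0 : ∀ y, 0 ≤ h y) (hh : ∀ y, h y ≤ C) :
    ∃ r : ℕ → ℝ, Tendsto r atTop (𝓝 0) ∧ ∀ n x,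
      |M.obsDens x * M.outInt h x - (M' n).obsDens x * (M' n).outInt h x| ≤ r n := by
  obtain ⟨a, c, s, g₁, g₂, hC⟩ := exists_controls V.adm V.bdd
  refine ⟨fun n => (B.p * B.finv1 ^ (dS + dV) * ((K + dY * C) * (√dY * g₁))
    + a * (B.p * B.finv1 ^ (dS + dV)) * C) * (∫ u, ‖u‖ ∂μ n + ∫ u, ‖u‖ ∂μ' n), ?_, fun n x => ?_⟩
  · have := (V.lim.add V.lim').const_mul (B.p * B.finv1 ^ (dS + dV) * ((K + dY * C) * (√dY * g₁))
      + a * (B.p * B.finv1 ^ (dS + dV)) * C)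
    rwa [add_zero, mul_zero] at this
  · have := V.prob n
    have := V.prob' n
    exact hC.abs_obsDens_mul_outInt_sub_le_of_dataLaw_eq hK h0 hh V.adm (V.adm' n) V.bdd (V.bdd' n)
      (V.int n) (V.int' n) (V.law_eq n) x

theorem exists_rate_obsDens (V : VanishingNoise M B μ M' μ') :
    ∃ r : ℕ → ℝ, Tendsto r atTop (𝓝 0) ∧ ∀ n x, |M.obsDens x - (M' n).obsDens x| ≤ r n := by
  obtain ⟨r, hr, h⟩ := V.exists_rate (h := fun _ => 1) (LipschitzWith.const 1)
    (fun _ => zero_le_one) (fun _ => le_rfl)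
  refine ⟨r, hr, fun n x => ?_⟩
  have := h n x
  rwa [V.adm.outInt_one, (V.adm' n).outInt_one, mul_one, mul_one] at this

theorem tendsto_obsDens (V : VanishingNoise M B μ M' μ') (x : Obs dS dV) :
    Tendsto (fun n => (M' n).obsDens x) atTop (𝓝 (M.obsDens x)) := by
  obtain ⟨r, hr, h⟩ := V.exists_rate_obsDens
  refine tendsto_iff_dist_tendsto_zero.2 (squeeze_zero (fun _ => dist_nonneg) (fun n => ?_) hr)
  rw [dist_comm, Real.dist_eq]
  exact h n x

/-- Convergence of qH and of q gives that of H after division by q, which stays away from 0 near x₀.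
The general filter allows moving points (for locally uniform limits) and limits along ultrafilters.
-/
theorem tendsto_outInt (V : VanishingNoise M B μ M' μ') {h : Out dY → ℝ} {K : NNReal} {C : ℝ}
    (hK : LipschitzWith K h) (h0 : ∀ y, 0 ≤ h y) (hh : ∀ y, h y ≤ C) {γ : Type*} {F : Filter γ}
    {i : γ → ℕ} {x : γ → Obs dS dV} {x₀ : Obs dS dV} (hi : Tendsto i F atTop)
    (hx : Tendsto x F (𝓝 x₀)) :
    Tendsto (fun p => (M' (i p)).outInt h (x p)) F (𝓝 (M.outInt h x₀)) := by
  obtain ⟨r, hr, h1⟩ := V.exists_rate hK h0 hh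
  obtain ⟨r', hr', h2⟩ := V.exists_rate_obsDens
  have hC0 : 0 ≤ C := (h0 0).trans (hh 0)
  have hH : Tendsto (fun p => M.outInt h (x p)) F (𝓝 (M.outInt h x₀)) :=
    ((V.adm.continuous_outInt hK h0 hh).tendsto x₀).comp hx
  have hq : Tendsto (fun p => M.obsDens (x p)) F (𝓝 (M.obsDens x₀)) :=
    (V.adm.continuous_obsDens.tendsto x₀).comp hx
  have hb : ∀ p, |M.outInt h (x p) - (M' (i p)).outInt h (x p)|
      ≤ (r (i p) + r' (i p) * C) / M.obsDens (x p) := fun p => by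
    have hq0 := V.adm.obsDens_pos V.bdd (x p)
    rw [le_div_iff₀ hq0]
    have e : (M.outInt h (x p) - (M' (i p)).outInt h (x p)) * M.obsDens (x p)
        = (M.obsDens (x p) * M.outInt h (x p) - (M' (i p)).obsDens (x p) * (M' (i p)).outInt h (x p))
          - (M.obsDens (x p) - (M' (i p)).obsDens (x p)) * (M' (i p)).outInt h (x p) := by ring
    have e0 : |M.outInt h (x p) - (M' (i p)).outInt h (x p)| * M.obsDens (x p)
        = |(M.outInt h (x p) - (M' (i p)).outInt h (x p)) * M.obsDens (x p)| := by
      rw [abs_mul, abs_of_pos hq0]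
    rw [e0, e]
    refine (abs_sub _ _).trans (add_le_add (h1 _ _) ?_)
    rw [abs_mul, abs_of_nonneg (Model.Admissible.outInt_nonneg h0 (x p))]
    exact mul_le_mul (h2 _ _) ((V.adm' _).outInt_le hK h0 hh _)
      (Model.Admissible.outInt_nonneg h0 _) ((abs_nonneg _).trans (h2 (i p) (x p)))
  have hr0 : Tendsto (fun p => (r (i p) + r' (i p) * C) / M.obsDens (x p)) F (𝓝 0) := by
    have := ((hr.comp hi).add ((hr'.comp hi).mul_const C)).div hq (V.adm.obsDens_pos V.bdd x₀).ne'
    rwa [zero_mul, add_zero, zero_div] at this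
  have h3 : Tendsto (fun p => M.outInt h (x p) - (M' (i p)).outInt h (x p)) F (𝓝 0) :=
    squeeze_zero_norm hb hr0
  simpa using hH.sub h3

theorem mechY_lim (V : VanishingNoise M B μ M' μ') (h : BoundedContinuousFunction (Out dY) ℝ) :
    TendstoLocallyUniformly (fun (n : ℕ) (z : Latent dS dV) =>
      ∫ y, h y ∂((M' n).out.law ((M' n).g (sem (reparam M (M' n) z)))))
    (fun z => ∫ y, h y ∂(M.out.law (M.g (sem z)))) atTop := by
  refine tendstoLocallyUniformly_of_tendsto_prod fun z => ?_
  let P : ℕ × Latent dS dV → ProbabilityMeasure (Out dY) := fun p =>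
    ⟨(M' p.1).outLaw (M.f p.2), (V.adm' p.1).isProbabilityMeasure_outLaw _⟩
  let P₀ : ProbabilityMeasure (Out dY) :=
    ⟨M.outLaw (M.f z), V.adm.isProbabilityMeasure_outLaw _⟩
  have hP : Tendsto P (atTop ×ˢ 𝓝 z) (𝓝 P₀) :=
    tendsto_of_forall_nonneg_lipschitz fun h C K h0 hh hK =>
      V.tendsto_outInt hK h0 hh (x := fun p : ℕ × Latent dS dV => M.f p.2) tendsto_fst
        ((M.f.continuous.tendsto z).comp tendsto_snd)
  have e := ProbabilityMeasure.tendsto_iff_forall_integral_tendsto.1 hP h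
  simp only [P, P₀, ProbabilityMeasure.coe_mk, Model.outLaw, obsOut_apply, obsOut_reparam] at e
  exact e

theorem prior_dens (V : VanishingNoise M B μ M' μ') (ε : ℝ) (hε : 0 < ε) :
    ∀ᶠ n in atTop, ∀ z : Latent dS dV,
      |pushDensity (reparam M (M' n)) M.dens z - (M' n).dens z|
        ≤ ε * |(fderiv ℝ (M' n).f z).det| := by
  obtain ⟨r, hr, h⟩ := V.exists_rate_obsDens
  filter_upwards [hr.eventually (ge_mem_nhds hε)] with n hn z
  rw [abs_pushDensity_sub_dens V.adm (V.adm' n) (V.bdd' n)]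
  exact mul_le_mul_of_nonneg_right ((h n _).trans hn) (abs_nonneg _)

end VanishingNoise

theorem integrable_obsDens {N : Model dS dV dY} (hN : N.Admissible) {B : Bounds}
    (hB : N.BoundedBy B) : Integrable N.obsDens ∧ ∫ x, N.obsDens x = 1 := by
  have h0 : ∀ x, 0 ≤ N.obsDens x := fun x => (hN.obsDens_pos hB x).le
  refine ⟨(lintegral_ofReal_ne_top_iff_integrable hN.continuous_obsDens.aestronglyMeasurable
    (ae_of_all _ h0)).1 (by rw [hN.lintegral_obsDens]; exact ENNReal.one_ne_top), ?_⟩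
  rw [integral_eq_lintegral_of_nonneg_ae (ae_of_all _ h0)
    hN.continuous_obsDens.aestronglyMeasurable, hN.lintegral_obsDens, ENNReal.toReal_one]

theorem real_map_prior {N : Model dS dV dY} (hN : N.Admissible) {B : Bounds}
    (hB : N.BoundedBy B) {A : Set (Obs dS dV)} (hA : MeasurableSet A) :
    (N.prior.map N.f).real A = ∫ x in A, N.obsDens x := by
  rw [hN.map_prior, measureReal_def, withDensity_apply _ hA,
    integral_eq_lintegral_of_nonneg_ae (ae_of_all _ fun x => (hN.obsDens_pos hB x).le)
    hN.continuous_obsDens.aestronglyMeasurable]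

namespace VanishingNoise

variable {M : Model dS dV dY} {B : Bounds} {μ : ℕ → Measure (Obs dS dV)} {M' : ℕ → Model dS dV dY}
  {μ' : ℕ → Measure (Obs dS dV)}

/-- Both measures are images under f'ₙ⁻¹ of laws in the space of `x`, and an image does not increase
total variation; Scheffé's lemma applies to the densities there. -/
theorem prior_tv (V : VanishingNoise M B μ M' μ') (ε : ℝ) (hε : 0 < ε) :
    ∀ᶠ n in atTop, ∀ A : Set (Latent dS dV), MeasurableSet A →
      |(M.prior.map (reparam M (M' n))).real A - (M' n).prior.real A| ≤ ε := by
  obtain ⟨i1, e1⟩ := integrable_obsDens V.adm V.bdd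
  have i2 := fun n => integrable_obsDens (V.adm' n) (V.bdd' n)
  have h1 := tendsto_integral_abs_sub (fun x => (V.adm.obsDens_pos V.bdd x).le)
    (fun n x => ((V.adm' n).obsDens_pos (V.bdd' n) x).le) i1 (fun n => (i2 n).1)
    (fun n => by rw [e1, (i2 n).2]) V.tendsto_obsDens
  filter_upwards [h1.eventually (ge_mem_nhds hε)] with n hn A hA
  have hm : Measurable (M' n).f.symm := (M' n).f.symm.continuous.measurable
  have hA' : MeasurableSet ((M' n).f.symm ⁻¹' A) := hm hA
  have e2 : (M' n).prior.real A = (((M' n).prior.map (M' n).f).map (M' n).f.symm).real A := by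
    rw [Model.Admissible.map_map_prior]
  rw [Model.Admissible.map_prior_reparam, e2, map_measureReal_apply hm hA,
    map_measureReal_apply hm hA, real_map_prior V.adm V.bdd hA',
    real_map_prior (V.adm' n) (V.bdd' n) hA',
    ← integral_sub i1.integrableOn (i2 n).1.integrableOn]
  have i3 : Integrable (fun x => |M.obsDens x - (M' n).obsDens x|) := (i1.sub (i2 n).1).abs
  refine abs_integral_le_integral_abs.trans (le_trans ?_ hn)
  exact setIntegral_le_integral i3 (ae_of_all _ fun x => abs_nonneg _)

/-- Both mechanisms converge, jointly in (n, z), to the Dirac mass at f(z). -/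
theorem mechX_lim (V : VanishingNoise M B μ M' μ') (h : BoundedContinuousFunction (Obs dS dV) ℝ) :
    TendstoLocallyUniformly
      (fun (n : ℕ) (z : Latent dS dV) => ∫ x, h x ∂((M.toCSG (μ n)).mechX z)
        - ∫ x, h x ∂(((M' n).toCSG (μ' n)).mechX (reparam M (M' n) z))) (fun _ => 0) atTop := by
  refine tendstoLocallyUniformly_of_tendsto_prod fun z => ?_
  simp only [mechX_reparam]
  have main : ∀ ρ : ℕ → Measure (Obs dS dV), (∀ n, IsProbabilityMeasure (ρ n)) →
      (∀ n, Integrable (fun u => ‖u‖) (ρ n)) → Tendsto (fun n => ∫ u, ‖u‖ ∂ρ n) atTop (𝓝 0) →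
      Tendsto (fun p : ℕ × Latent dS dV => ∫ x, h x ∂((M.toCSG (ρ p.1)).mechX p.2))
        (atTop ×ˢ 𝓝 z) (𝓝 (h (M.f z))) := by
    intro ρ hρ hi hl
    have hprob : ∀ p : ℕ × Latent dS dV,
        IsProbabilityMeasure ((M.toCSG (ρ p.1)).mechX p.2) := fun p =>
      have := hρ p.1
      Measure.isProbabilityMeasure_map (by fun_prop)
    let P : ℕ × Latent dS dV → ProbabilityMeasure (Obs dS dV) := fun p =>
      ⟨(M.toCSG (ρ p.1)).mechX p.2, hprob p⟩
    let P₀ : ProbabilityMeasure (Obs dS dV) := ⟨Measure.dirac (M.f z), inferInstance⟩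
    have hP : Tendsto P (atTop ×ˢ 𝓝 z) (𝓝 P₀) := by
      refine tendsto_of_forall_nonneg_lipschitz fun h C K h0 hh hK => ?_
      change Tendsto (fun p : ℕ × Latent dS dV => ∫ x, h x ∂((M.toCSG (ρ p.1)).mechX p.2)) _
        (𝓝 (∫ x, h x ∂Measure.dirac (M.f z)))
      rw [integral_dirac]
      have hb : ∀ p : ℕ × Latent dS dV, ‖∫ x, h x ∂((M.toCSG (ρ p.1)).mechX p.2) - h (M.f z)‖
          ≤ K * ‖M.f p.2 - M.f z‖ + K * ∫ u, ‖u‖ ∂ρ p.1 := by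
        intro p
        have := hρ p.1
        have e : ∫ x, h x ∂((M.toCSG (ρ p.1)).mechX p.2) = ∫ u, h (M.f p.2 + u) ∂ρ p.1 :=
          integral_map (by fun_prop) hK.continuous.aestronglyMeasurable
        have hc : Continuous (fun u => h (M.f p.2 + u)) := hK.continuous.comp (by fun_prop)
        have i1 : Integrable (fun u => h (M.f p.2 + u)) (ρ p.1) :=
          Integrable.of_bound (C := C) hc.aestronglyMeasurable
            (ae_of_all _ fun u => by rw [Real.norm_of_nonneg (h0 _)]; exact hh _)
        have e2 : ∫ u, h (M.f p.2 + u) ∂ρ p.1 - h (M.f z)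
            = ∫ u, (h (M.f p.2 + u) - h (M.f z)) ∂ρ p.1 := by
          rw [integral_sub i1 (integrable_const _)]
          simp
        have i2 : Integrable (fun u => K * ‖M.f p.2 - M.f z‖ + K * ‖u‖) (ρ p.1) :=
          (integrable_const _).add ((hi p.1).const_mul _)
        rw [e, e2]
        refine (norm_integral_le_of_norm_le i2 (ae_of_all _ fun u => ?_)).trans_eq ?_
        · rw [← dist_eq_norm, ← mul_add]
          refine (hK.dist_le_mul _ _).trans (mul_le_mul_of_nonneg_left ?_ K.2)
          rw [dist_eq_norm, add_sub_right_comm]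
          exact norm_add_le _ _
        · rw [integral_add (integrable_const _) ((hi p.1).const_mul _), integral_const_mul, integral_const_mul]
          simp
      have h1 : Tendsto (fun p : ℕ × Latent dS dV => ‖M.f p.2 - M.f z‖) (atTop ×ˢ 𝓝 z) (𝓝 0) := by
        have : Continuous (fun w => ‖M.f w - M.f z‖) := by fun_prop
        have := (this.tendsto z).comp (tendsto_snd (f := (atTop : Filter ℕ)))
        rwa [sub_self, norm_zero] at this
      have h2 := squeeze_zero_norm hb (by
        simpa using (h1.const_mul (K : ℝ)).add ((hl.comp tendsto_fst).const_mul (K : ℝ)))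
      simpa using h2.add_const (h (M.f z))
    have := ProbabilityMeasure.tendsto_iff_forall_integral_tendsto.1 hP h
    simp only [P, P₀, ProbabilityMeasure.coe_mk, integral_dirac] at this
    exact this
  simpa using (main μ V.prob V.int V.lim).sub (main μ' V.prob' V.int' V.lim')

end VanishingNoise

end

/-! ### Limits of the inverse mechanisms and transfer of fibres. -/

section

section Limits

variable {E F : Type*} [NormedAddCommGroup E] [NormedSpace ℝ E] [FiniteDimensional ℝ E]
  [NormedAddCommGroup F] [NormedSpace ℝ F]

/-- A map between fibred spaces that locally inverts into the fibres of a second map. -/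
theorem fibre_constant (P : E →L[ℝ] F) {φ ψ f : E → E} {A : E → E →L[ℝ] E}
    (hφ : ∀ x, HasStrictFDerivAt φ (A x) x) (hA : ∀ x, (A x).det ≠ 0)
    (hψ : Differentiable ℝ ψ) (hf : Differentiable ℝ f) (hl : ∀ x, f (ψ x) = x)
    (hr : ∀ z, ψ (f z) = z) (h : ∀ x y, P (φ x) = P (φ y) → P (ψ x) = P (ψ y)) {z w : E}
    (hzw : P z = P w) : P (φ (f z)) = P (φ (f w)) := by
  have hinv : ∀ x v, fderiv ℝ f (ψ x) (fderiv ℝ ψ x v) = v := fun x v => by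
    have h1 : HasFDerivAt (fun x => f (ψ x)) ((fderiv ℝ f (ψ x)).comp (fderiv ℝ ψ x)) x :=
      (hf (ψ x)).hasFDerivAt.comp x (hψ x).hasFDerivAt
    have h2 : HasFDerivAt (fun x => f (ψ x)) (ContinuousLinearMap.id ℝ E) x :=
      (hasFDerivAt_id x).congr_of_eventuallyEq (Eventually.of_forall hl)
    exact DFunLike.congr_fun (h1.unique h2) v
  have hinv' : ∀ z v, fderiv ℝ ψ (f z) (fderiv ℝ f z v) = v := fun z v => by
    have h1 : HasFDerivAt (fun z => ψ (f z)) ((fderiv ℝ ψ (f z)).comp (fderiv ℝ f z)) z :=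
      (hψ (f z)).hasFDerivAt.comp z (hf z).hasFDerivAt
    have h2 : HasFDerivAt (fun z => ψ (f z)) (ContinuousLinearMap.id ℝ E) z :=
      (hasFDerivAt_id z).congr_of_eventuallyEq (Eventually.of_forall hr)
    exact DFunLike.congr_fun (h1.unique h2) v
  have step : ∀ z v, P v = 0 → P (A (f z) (fderiv ℝ f z v)) = 0 := by
    intro z
    set x := f z
    set e := (A x).toContinuousLinearEquivOfDetNeZero (hA x)
    have he : (e : E →L[ℝ] E) = A x := ContinuousLinearMap.coe_toContinuousLinearEquivOfDetNeZero _ _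
    have hs : HasStrictFDerivAt φ (e : E →L[ℝ] E) x := by rw [he]; exact hφ x
    set T : E →L[ℝ] E := (fderiv ℝ ψ x).comp (e.symm : E →L[ℝ] E) with hT
    -- Along t ↦ φ x + t v with P v = 0, the local inverse of φ draws a curve on which P ∘ φ is
    -- constant. By hypothesis P ∘ ψ is constant there too, and differentiating at 0 shows that ψ' ∘
    -- A⁻¹ preserves ker P.
    have hker : ∀ v ∈ (P : E →ₗ[ℝ] F).ker, (T : E →ₗ[ℝ] E) v ∈ (P : E →ₗ[ℝ] F).ker := by
      intro v hv
      have hv' : P v = 0 := hv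
      change P (fderiv ℝ ψ x (e.symm v)) = 0
      have hline : HasDerivAt (fun t : ℝ => φ x + t • v) v 0 := by
        simpa using ((hasDerivAt_id (0 : ℝ)).smul_const v).const_add (φ x)
      have h0 : φ x + (0 : ℝ) • v = φ x := by simp
      set θ := hs.localInverse φ e x
      have hθ : HasFDerivAt θ (e.symm : E →L[ℝ] E) (φ x + (0 : ℝ) • v) := by
        rw [h0]; exact hs.to_localInverse.hasFDerivAt
      have hθx : θ (φ x + (0 : ℝ) • v) = x := by rw [h0]; exact hs.localInverse_apply_image
      have h1 : HasDerivAt (fun t : ℝ => θ (φ x + t • v)) ((e.symm : E →L[ℝ] E) v) 0 :=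
        hθ.comp_hasDerivAt 0 hline
      have h2 : HasDerivAt (fun t : ℝ => ψ (θ (φ x + t • v))) (fderiv ℝ ψ x (e.symm v)) 0 := by
        have : HasFDerivAt ψ (fderiv ℝ ψ x) (θ (φ x + (0 : ℝ) • v)) := by
          rw [hθx]; exact (hψ x).hasFDerivAt
        exact this.comp_hasDerivAt 0 h1
      have h3 : HasDerivAt (fun t : ℝ => P (ψ (θ (φ x + t • v)))) (P (fderiv ℝ ψ x (e.symm v))) 0 :=
        P.hasFDerivAt.comp_hasDerivAt 0 h2
      have h4 : (fun t : ℝ => P (ψ (θ (φ x + t • v)))) =ᶠ[𝓝 0] fun _ => P (ψ x) := by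
        have hc : Tendsto (fun t : ℝ => φ x + t • v) (𝓝 0) (𝓝 (φ x)) := by
          have := hline.continuousAt.tendsto
          rwa [h0] at this
        filter_upwards [hc.eventually hs.eventually_right_inverse] with t ht
        refine h _ _ ?_
        rw [ht, map_add, map_smul, hv', smul_zero, add_zero]
      exact h3.unique ((hasDerivAt_const (0 : ℝ) (P (ψ x))).congr_of_eventuallyEq h4)
    have hinj : Set.InjOn (T : E →ₗ[ℝ] E) ((P : E →ₗ[ℝ] F).ker : Set E) := by
      intro u _ v _ huv
      have huv' : fderiv ℝ ψ x (e.symm u) = fderiv ℝ ψ x (e.symm v) := huv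
      have := congrArg (fderiv ℝ f (ψ x)) huv'
      rw [hinv, hinv] at this
      exact e.symm.injective this
    -- An injective endomorphism of the finite-dimensional space ker P is onto. This reverses the
    -- inclusion of kernels.
    have hsurj := (LinearMap.injOn_iff_surjOn hker).1 hinj
    intro v hv
    obtain ⟨u, hu, huv⟩ := hsurj (show v ∈ ((P : E →ₗ[ℝ] F).ker : Set E) from hv)
    have h1 : fderiv ℝ ψ x (e.symm u) = v := huv
    have h2 : fderiv ℝ f z v = e.symm u := by
      rw [← h1]
      have := hinv x (e.symm u)
      rwa [hr z] at this
    rw [h2, ← he]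
    change P (e (e.symm u)) = 0
    rw [e.apply_symm_apply]
    exact hu
  -- The fibres of P are affine, so the segment from z to w stays in one fibre and P ∘ φ ∘ f has
  -- zero derivative along it.
  have hd : ∀ t : ℝ, HasDerivAt (fun t : ℝ => P (φ (f (z + t • (w - z))))) 0 t := fun t => by
    have hline : HasDerivAt (fun t : ℝ => z + t • (w - z)) (w - z) t := by
      simpa using ((hasDerivAt_id t).smul_const (w - z)).const_add z
    have h1 : HasDerivAt (fun t : ℝ => f (z + t • (w - z))) (fderiv ℝ f (z + t • (w - z)) (w - z)) t :=
      (hf _).hasFDerivAt.comp_hasDerivAt t hline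
    have h2 := P.hasFDerivAt.comp_hasDerivAt t ((hφ _).hasFDerivAt.comp_hasDerivAt t h1)
    rw [step (z + t • (w - z)) (w - z) (by rw [map_sub, hzw, sub_self])] at h2
    exact h2
  have := is_const_of_deriv_eq_zero (fun t => (hd t).differentiableAt) (fun t => (hd t).deriv) 0 1
  simpa using this

/-- Limits along an ultrafilter of maps with bounded first and second derivatives. -/
theorem exists_ultrafilter_limit {γ : Type*} (U : Ultrafilter γ) {φ : γ → E → E} {b κ : ℝ}
    (h0 : ∀ n, φ n 0 = 0) (hd : ∀ n, Differentiable ℝ (φ n)) (hb : ∀ n x, ‖fderiv ℝ (φ n) x‖ ≤ b)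
    (hκ : ∀ n x y, ‖fderiv ℝ (φ n) x - fderiv ℝ (φ n) y‖ ≤ κ * ‖x - y‖)
    (ht : ∀ n x u, ‖φ n (x + u) - φ n x - fderiv ℝ (φ n) x u‖ ≤ κ / 2 * ‖u‖ ^ 2) :
    ∃ (φ₀ : E → E) (A : E → E →L[ℝ] E), (∀ x, HasStrictFDerivAt φ₀ (A x) x) ∧
      (∀ x, Tendsto (fun n => fderiv ℝ (φ n) x) U (𝓝 (A x))) ∧
      ∀ (x : γ → E) (x₀ : E), Tendsto x U (𝓝 x₀) → Tendsto (fun n => φ n (x n)) U (𝓝 (φ₀ x₀)) := by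
  have hlip : ∀ n x y, ‖φ n x - φ n y‖ ≤ b * ‖x - y‖ := fun n x y =>
    convex_univ.norm_image_sub_le_of_norm_fderiv_le (fun z _ => hd n z) (fun z _ => hb n z)
      (Set.mem_univ y) (Set.mem_univ x)
  -- The normalization at 0 and the Lipschitz bound keep the values in a fixed ball; by compactness
  -- the ultrafilter gives limits at all points simultaneously, without extracting subsequences.
  have hex : ∀ x, ∃ y, Tendsto (fun n => φ n x) U (𝓝 y) := fun x => by
    have hK : IsCompact (Metric.closedBall (0 : E) (b * ‖x‖)) := isCompact_closedBall _ _
    obtain ⟨y, -, hy⟩ := hK.ultrafilter_le_nhds (U.map fun n => φ n x) (by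
      rw [le_principal_iff]
      change ∀ᶠ n in (U : Filter γ), φ n x ∈ Metric.closedBall (0 : E) (b * ‖x‖)
      refine Eventually.of_forall fun n => ?_
      have := hlip n x 0
      rw [h0, sub_zero, sub_zero] at this
      simpa using this)
    exact ⟨y, hy⟩
  have hex' : ∀ x, ∃ y, Tendsto (fun n => fderiv ℝ (φ n) x) U (𝓝 y) := fun x => by
    have hK : IsCompact (Metric.closedBall (0 : E →L[ℝ] E) b) := isCompact_closedBall _ _
    obtain ⟨y, -, hy⟩ := hK.ultrafilter_le_nhds (U.map fun n => fderiv ℝ (φ n) x) (by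
      rw [le_principal_iff]
      change ∀ᶠ n in (U : Filter γ), fderiv ℝ (φ n) x ∈ Metric.closedBall (0 : E →L[ℝ] E) b
      refine Eventually.of_forall fun n => ?_
      simpa using hb n x)
    exact ⟨y, hy⟩
  choose φ₀ hφ₀ using hex
  choose A hA using hex'
  refine ⟨φ₀, A, fun x => ?_, hA, fun x x₀ hx => ?_⟩
  -- The Lipschitz bound for the derivatives and the Taylor bound are closed conditions, so they
  -- pass to the limit. They make A the derivative of φ₀ and continuous, whence strict
  -- differentiability.
  · have hAκ : ∀ x y, ‖A x - A y‖ ≤ κ * ‖x - y‖ := fun x y =>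
      le_of_tendsto ((hA x).sub (hA y)).norm (Eventually.of_forall fun n => hκ n x y)
    have hAu : ∀ x u, Tendsto (fun n => fderiv ℝ (φ n) x u) U (𝓝 (A x u)) := fun x u =>
      ((ContinuousLinearMap.apply ℝ E u).continuous.tendsto (A x)).comp (hA x)
    have hAt : ∀ x u, ‖φ₀ (x + u) - φ₀ x - A x u‖ ≤ κ / 2 * ‖u‖ ^ 2 := fun x u =>
      le_of_tendsto ((((hφ₀ (x + u)).sub (hφ₀ x)).sub (hAu x u))).norm
        (Eventually.of_forall fun n => ht n x u)
    have hF : ∀ x, HasFDerivAt φ₀ (A x) x := fun x => by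
      rw [hasFDerivAt_iff_isLittleO_nhds_zero]
      refine Asymptotics.IsBigO.trans_isLittleO (g := fun u : E => ‖u‖ ^ 2) ?_ ?_
      · refine Asymptotics.IsBigO.of_bound (κ / 2) (Eventually.of_forall fun u => ?_)
        rw [norm_pow, norm_norm]
        exact hAt x u
      · exact Asymptotics.isLittleO_norm_pow_id one_lt_two
    refine hasStrictFDerivAt_of_hasFDerivAt_of_continuousAt (Eventually.of_forall hF) ?_
    refine tendsto_iff_norm_sub_tendsto_zero.2 (squeeze_zero (fun _ => norm_nonneg _)
      (fun y => hAκ y x) ?_)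
    have hc : Continuous (fun y => κ * ‖y - x‖) := by fun_prop
    simpa using hc.tendsto x
  · have h1 : Tendsto (fun n => φ n (x n) - φ n x₀) U (𝓝 0) := by
      have h2 : Tendsto (fun n => b * ‖x n - x₀‖) U (𝓝 0) := by
        have := (tendsto_iff_norm_sub_tendsto_zero.1 hx).const_mul b
        rwa [mul_zero] at this
      exact squeeze_zero_norm (fun n => hlip n (x n) x₀) h2
    simpa using h1.add (hφ₀ x₀)

end Limits

end

/-! ### Asymptotic constancy of the semantic factor. -/

section

variable {dS dV dY : ℕ}

theorem norm_out_sub_le {N : Model dS dV dY} (hN : N.Admissible) {B : Bounds} (hB : N.BoundedBy B)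
    (s t : Sem dS) : ‖N.g s - N.g t‖ ≤ √dY * |B.g1| * ‖s - t‖ := by
  have := euclidean_norm_le (x := N.g s - N.g t) (a := |B.g1| * ‖s - t‖) (by positivity)
    fun l => convex_univ.norm_image_sub_le_of_norm_fderiv_le
      (fun z _ => hN.differentiable_coord l z)
      (fun z _ => (hB.g1 z l).trans (le_abs_self _)) (Set.mem_univ t) (Set.mem_univ s)
  rwa [Fintype.card_fin, ← mul_assoc] at this

/-- Read as a lower bound for the Jacobian of f⁻¹, this prevents the limit of the inverse mechanisms
from degenerating. -/
theorem obsDens_le_mul_abs_det {N : Model dS dV dY} {B : Bounds} (hB : N.BoundedBy B)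
    (x : Obs dS dV) : N.obsDens x ≤ B.p * |(fderiv ℝ N.f.symm x).det| :=
  mul_le_mul_of_nonneg_right (hB.p _) (abs_nonneg _)

namespace VanishingNoise

variable {M : Model dS dV dY} {B : Bounds} {μ : ℕ → Measure (Obs dS dV)} {M' : ℕ → Model dS dV dY}
  {μ' : ℕ → Measure (Obs dS dV)}

/-- Points that cannot be distinguished by the limit of the inverse mechanisms have the same
semantic factor. -/
theorem sem_eq_of_tendsto (V : VanishingNoise M B μ M' μ') {U : Filter ℕ} [U.NeBot]
    (hU : U ≤ atTop) {x y : Obs dS dV}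
    (h : Tendsto (fun n => sem ((M' n).f.symm x) - sem ((M' n).f.symm y)) U (𝓝 0)) :
    sem (M.f.symm x) = sem (M.f.symm y) := by
  refine V.adm.g_inj (V.adm.out_valid.proper.law_injOn ⟨_, rfl⟩ ⟨_, rfl⟩ ?_)
  change M.outLaw x = M.outLaw y
  have := V.adm.isProbabilityMeasure_outLaw x
  have := V.adm.isProbabilityMeasure_outLaw y
  refine eq_of_forall_nonneg_lipschitz fun h' C K h0 hh hK => ?_
  have hC0 : 0 ≤ C := (h0 0).trans (hh 0)
  have hi : Tendsto (fun n : ℕ => n) U atTop := hU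
  have e1 := V.tendsto_outInt hK h0 hh hi (tendsto_const_nhds (x := x))
  have e2 := V.tendsto_outInt hK h0 hh hi (tendsto_const_nhds (x := y))
  have e3 : Tendsto (fun n => (M' n).outInt h' x - (M' n).outInt h' y) U (𝓝 0) := by
    have e4 := h.norm.const_mul ((K + dY * C) * (√dY * |B.g1|))
    rw [norm_zero, mul_zero] at e4
    refine squeeze_zero_norm (fun n => ?_) e4
    refine ((V.adm' n).abs_outInt_sub_le hK h0 hh x y).trans ?_
    rw [mul_assoc]
    exact mul_le_mul_of_nonneg_left (norm_out_sub_le (V.adm' n) (V.bdd' n) _ _) (by positivity)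
  exact sub_eq_zero.1 (tendsto_nhds_unique (e1.sub e2) e3)

/-- By contradiction and compactness: bad pairs of points, occurring for infinitely many n, converge
along an ultrafilter to a pair in one fibre of `sem`, on which the limit of the inverse mechanisms
has equal semantic factors. -/
theorem sem_const (V : VanishingNoise M B μ M' μ') (K : Set (Latent dS dV)) (hK : IsCompact K)
    (ε : ℝ) (hε : 0 < ε) : ∀ᶠ n in atTop, ∀ z₁ ∈ K, ∀ z₂ ∈ K, sem z₁ = sem z₂ →
      dist (sem (reparam M (M' n) z₁)) (sem (reparam M (M' n) z₂)) ≤ ε := by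
  rcases isEmpty_or_nonempty (Fin dS ⊕ Fin dV) with he | hne
  · refine Eventually.of_forall fun n z₁ _ z₂ _ _ => ?_
    rw [Subsingleton.elim z₁ z₂, dist_self]
    exact hε.le
  by_contra hnot
  set S : Set ℕ := {n | ∃ p : Latent dS dV × Latent dS dV, p.1 ∈ K ∧ p.2 ∈ K ∧ sem p.1 = sem p.2 ∧
    ε < dist (sem (reparam M (M' n) p.1)) (sem (reparam M (M' n) p.2))} with hS
  have hfreq : ∃ᶠ n in atTop, n ∈ S := by
    refine (not_eventually.1 hnot).mono fun n hn => ?_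
    push Not at hn
    obtain ⟨z₁, h1, z₂, h2, h3, h4⟩ := hn
    exact ⟨(z₁, z₂), h1, h2, h3, h4⟩
  have hne' : (atTop ⊓ 𝓟 S : Filter ℕ).NeBot := frequently_mem_iff_neBot.1 hfreq
  set U := Ultrafilter.of (atTop ⊓ 𝓟 S : Filter ℕ)
  have hU : (U : Filter ℕ) ≤ atTop := (Ultrafilter.of_le _).trans inf_le_left
  have hUS : ∀ᶠ n in (U : Filter ℕ), n ∈ S := le_principal_iff.1 ((Ultrafilter.of_le _).trans inf_le_right)
  -- Outside `S` the pair is irrelevant and set to 0, since the ultrafilter contains `S`.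
  have hex : ∀ n, ∃ p : Latent dS dV × Latent dS dV, n ∈ S → p.1 ∈ K ∧ p.2 ∈ K ∧
      sem p.1 = sem p.2 ∧
      ε < dist (sem (reparam M (M' n) p.1)) (sem (reparam M (M' n) p.2)) := fun n => by
    by_cases hn : n ∈ S
    · obtain ⟨p, hp⟩ := hn
      exact ⟨p, fun _ => hp⟩
    · exact ⟨0, fun h => absurd h hn⟩
  choose p hp using hex
  have hlim : ∀ z : ℕ → Latent dS dV, (∀ᶠ n in (U : Filter ℕ), z n ∈ K) →
      ∃ w, Tendsto z U (𝓝 w) := fun z hz => by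
    obtain ⟨w, -, hw⟩ := hK.ultrafilter_le_nhds (U.map z) (le_principal_iff.2 hz)
    exact ⟨w, hw⟩
  obtain ⟨w₁, hw₁⟩ := hlim (fun n => (p n).1) (hUS.mono fun n hn => (hp n hn).1)
  obtain ⟨w₂, hw₂⟩ := hlim (fun n => (p n).2) (hUS.mono fun n hn => (hp n hn).2.1)
  have hw : sem w₁ = sem w₂ := by
    have h1 := (continuous_sem.tendsto w₁).comp hw₁
    have h2 := (continuous_sem.tendsto w₂).comp hw₂
    exact tendsto_nhds_unique (h1.congr' (hUS.mono fun n hn => (hp n hn).2.2.1)) h2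
  have hbd : ∀ n, BoundedDiffeo (M' n).f (M' n).f.symm B.finv1 B.f2 B.f3 := fun n =>
    (V.adm' n).boundedDiffeo (V.bdd' n)
  set κ := √(Fintype.card (Fin dS ⊕ Fin dV)) * B.finv1 ^ 3 * B.f2
  have hκ0 : 0 ≤ κ := by
    have := (hbd 0).f2_nonneg
    have := (hbd 0).b_nonneg
    positivity
  have hfd : ∀ n, fderiv ℝ (fun x => (M' n).f.symm x - (M' n).f.symm 0) = fderiv ℝ (M' n).f.symm :=
    fun n => funext fun x => fderiv_sub_const _
  -- The values f'ₙ⁻¹(0) need not stay bounded, so they are subtracted; only differences of semantic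
  -- factors matter.
  obtain ⟨φ₀, A, hA, hAlim, hφ⟩ := exists_ultrafilter_limit U
    (φ := fun n x => (M' n).f.symm x - (M' n).f.symm 0) (b := B.finv1) (κ := κ)
    (fun n => sub_self _) (fun n => (V.adm' n).finv_diff.sub_const _)
    (fun n x => by rw [hfd]; exact (V.bdd' n).finv1 x)
    (fun n x y => by
      rw [hfd]
      exact convex_univ.norm_image_sub_le_of_norm_fderiv_le (fun z _ => (V.adm' n).finv_diff2 z)
        (fun z _ => ContinuousLinearMap.opNorm_le_bound₂ _ hκ0 fun u v =>
          (hbd n).norm_fderiv_fderiv_inv_le z u v) (Set.mem_univ y) (Set.mem_univ x))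
    (fun n x u => by
      rw [hfd, sub_sub_sub_cancel_right]
      refine norm_sub_sub_fderiv_le (V.adm' n).finv_diff (V.adm' n).finv_diff2 (fun x u => ?_) x u
      refine ((hbd n).norm_fderiv_fderiv_inv_le x u u).trans_eq ?_
      ring)
  simp only [hfd] at hAlim
  have hsem : ∀ x : Obs dS dV, Tendsto
      (fun n => sem ((M' n).f.symm x - (M' n).f.symm 0)) U (𝓝 (sem (φ₀ x))) := fun x =>
    (continuous_sem.tendsto _).comp (hφ (fun _ => x) x tendsto_const_nhds)
  -- In the limit q(x) ≤ B_p |det A x|, and the left side is positive.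
  have hdet : ∀ x, (A x).det ≠ 0 := fun x h0 => by
    have h1 := ((ContinuousLinearMap.continuous_det.tendsto (A x)).comp (hAlim x)).abs.const_mul B.p
    have h2 := le_of_tendsto_of_tendsto ((V.tendsto_obsDens x).mono_left hU) h1
      (Eventually.of_forall fun n => obsDens_le_mul_abs_det (V.bdd' n) x)
    rw [h0, abs_zero, mul_zero] at h2
    exact absurd (V.adm.obsDens_pos V.bdd x) (not_lt.2 h2)
  -- The required inclusion of fibres comes from the injectivity of `M.g`, which is fixed, and not
  -- from that of the varying `(M' n).g`.
  have hfib : sem (φ₀ (M.f w₁)) = sem (φ₀ (M.f w₂)) :=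
    fibre_constant (semL (dS := dS) (dV := dV)) hA hdet V.adm.finv_diff V.adm.f_diff
      M.f.apply_symm_apply M.f.symm_apply_apply (fun x y hxy => by
        refine V.sem_eq_of_tendsto hU ?_
        have h1 := (hsem x).sub (hsem y)
        have hxy' : sem (φ₀ x) = sem (φ₀ y) := hxy
        rw [hxy', sub_self] at h1
        refine h1.congr fun n => ?_
        rw [sem_sub, sem_sub, sub_sub_sub_cancel_right]) hw
  have hend : ∀ (z : ℕ → Latent dS dV) (w : Latent dS dV), Tendsto z U (𝓝 w) →
      Tendsto (fun n => sem ((M' n).f.symm (M.f (z n)) - (M' n).f.symm 0)) U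
        (𝓝 (sem (φ₀ (M.f w)))) := fun z w hz =>
    (continuous_sem.tendsto _).comp (hφ (fun n => M.f (z n)) _ ((M.f.continuous.tendsto w).comp hz))
  have h5 := (hend _ _ hw₁).dist (hend _ _ hw₂)
  rw [hfib, dist_self] at h5
  have h6 : ε ≤ 0 := by
    refine ge_of_tendsto h5 (hUS.mono fun n hn => ?_)
    rw [dist_eq_norm, sem_sub, sem_sub, sub_sub_sub_cancel_right, ← dist_eq_norm]
    exact (hp n hn).2.2.2.le
  exact absurd hε (not_lt.2 h6)

theorem asympSemanticEquivalent (V : VanishingNoise M B μ M' μ') :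
    AsympSemanticEquivalent M μ M' μ' :=
  ⟨V.sem_const, V.prior_tv, V.prior_dens, fun n h z => by rw [mechX_reparam, h], V.mechX_lim,
    V.mechY_lim⟩

end VanishingNoise

end

end CausalSemantic

end

theorem theorem1 (dS dV dY : ℕ) :
    -- (i) common noise law with an a.e. non-zero characteristic function: exact equivalence
    (∀ (M M' : CausalSemantic.Model dS dV dY) (B : CausalSemantic.Bounds)
      (μ : Measure (CausalSemantic.Obs dS dV)),
      M.Admissible → M'.Admissible → M.BoundedBy B → M'.BoundedBy B →
      M.out.SameKind M'.out → IsProbabilityMeasure μ →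
      (∀ᵐ t ∂(volume : Measure (CausalSemantic.Obs dS dV)), charFun μ t ≠ 0) →
      (M.toCSG μ).dataLaw = (M'.toCSG μ).dataLaw →
      CausalSemantic.SemanticEquivalent (M.toCSG μ) (M'.toCSG μ) ∧
      CausalSemantic.IsSemanticReparam (M.toCSG μ) (M'.toCSG μ) (CausalSemantic.reparam M M')) ∧
    -- (ii) vanishing noise: asymptotic equivalence
    (∀ (M : CausalSemantic.Model dS dV dY) (M' : ℕ → CausalSemantic.Model dS dV dY)
      (B : CausalSemantic.Bounds) (μ μ' : ℕ → Measure (CausalSemantic.Obs dS dV)),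
      M.Admissible → M.BoundedBy B →
      (∀ n, (M' n).Admissible ∧ (M' n).BoundedBy B ∧ M.out.SameKind (M' n).out) →
      (∀ n, IsProbabilityMeasure (μ n) ∧ Integrable (fun u => ‖u‖ ^ 2) (μ n)) →
      (∀ n, IsProbabilityMeasure (μ' n) ∧ Integrable (fun u => ‖u‖ ^ 2) (μ' n)) →
      Tendsto (fun n => ∫ u, ‖u‖ ^ 2 ∂(μ n)) atTop (𝓝 0) →
      Tendsto (fun n => ∫ u, ‖u‖ ^ 2 ∂(μ' n)) atTop (𝓝 0) →
      (∀ n, (M.toCSG (μ n)).dataLaw = ((M' n).toCSG (μ' n)).dataLaw) →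
      CausalSemantic.AsympSemanticEquivalent M μ M' μ') ∧
    -- (iii) noise small compared to the threshold: equivalence up to a small error
    (∀ (M M' : CausalSemantic.Model dS dV dY) (B : CausalSemantic.Bounds)
      (μ μ' : Measure (CausalSemantic.Obs dS dV)) (σ2 ε : ℝ),
      M.Admissible → M'.Admissible → M.BoundedBy B → M'.BoundedBy B →
      M.out.SameMean M'.out →
      IsProbabilityMeasure μ → IsProbabilityMeasure μ' →
      Integrable (fun u => ‖u‖ ^ 2) μ → Integrable (fun u => ‖u‖ ^ 2) μ' →
      ∫ u, u ∂μ = ∫ u, u ∂μ' →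
      ∫ u, ‖u‖ ^ 2 ∂μ ≤ σ2 → ∫ u, ‖u‖ ^ 2 ∂μ' ≤ σ2 →
      σ2 * B.threshold dS dV ≤ ε →
      (M.toCSG μ).dataLaw = (M'.toCSG μ').dataLaw →
      CausalSemantic.NearSemanticEquivalent M M' μ μ' B σ2 ε) := by
  refine ⟨fun M M' B μ hM hM' hB hB' _ hμ hc he => ?_, fun M M' B μ μ' hM hB hM' hμ hμ' hl hl' he => ?_,
    fun M M' B μ μ' σ2 ε hM hM' hB hB' ho hμ hμ' hi hi' hm hσ hσ' hε he =>
      CausalSemantic.nearSemanticEquivalent hM hM' hB hB' ho hμ hμ' hi hi' hm hσ hσ' hε he⟩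
  · obtain ⟨hq, hL⟩ := CausalSemantic.exact_identification hM hM' hB hB' hc he
    have h := CausalSemantic.isSemanticReparam_of_identification hM hM' μ hq hL
    exact ⟨⟨_, h⟩, h⟩
  · exact CausalSemantic.VanishingNoise.asympSemanticEquivalent (B := B)
      { adm := hM
        bdd := hB
        adm' := fun n => (hM' n).1
        bdd' := fun n => (hM' n).2.1
        prob := fun n => (hμ n).1
        prob' := fun n => (hμ' n).1
        int := fun n => by
          have := (hμ n).1
          exact CausalSemantic.integrable_norm_of_sq (hμ n).2
        int' := fun n => by
          have := (hμ' n).1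
          exact CausalSemantic.integrable_norm_of_sq (hμ' n).2
        lim := CausalSemantic.tendsto_integral_norm_of_sq hμ hl
        lim' := CausalSemantic.tendsto_integral_norm_of_sq hμ' hl'
        law_eq := he }
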